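/- **Proposition 3.3.** Let $X$ be a connected, non-compact complex manifold of complex dimension $n$ (Hausdorff and second countable), and let $D=\sum_i D_i\subset X$ be a compact simple normal crossing divisor (possibly empty) with irreducible components $D_i$; let $\beta_i\in(0,1)$ for each $i$. Let $g$ be an ALE conical Kähler metric on $(X,\sum_i(1-\beta_i)D_i)$, that is, a smooth Kähler metric on $X^\circ=X\setminus D$ such that: (i) for every $p\in D$ there are complex coordinates $(z_1,\dots,z_n)$ centred at $p$, an integer $1\le k\le n$ and distinct indices $i_1,\dots,i_k$ such that in the coordinate domain $D=\{z_1\cdots z_k=0\}$ with $D_{i_j}=\{z_j=0\}$ for $1\le j\le k$, and a constant $C>1$ such that on the complement of $D$ in this domain $$C^{-1}g_\beta\le g\le C g_\beta,\qquad g_\beta=\sum_{j=1}^k|z_j|^{2\beta_{i_j}-2}|dz_j|^2+\sum_{j=k+1}^n|dz_j|^2;$$ (ii) there are a compact set $K\subset X$, a finite group $\Gamma\subset U(n)$ acting freely on $\mathbb{C}^n\setminus\{0\}$, a real number $R_0$ and a diffeomorphism $\phi$ from $X\setminus K$ onto $\{|z|>R_0\}/\Gamma\subset\mathbb{C}^n/\Gamma$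 such that $|\phi(x)|\to\infty$ exactly when $x\to\infty$ in $X$ (i.e. when $x$ leaves every compact subset of $X$), and a number $\lambda>0$ such that, $g_0$ denoting the flat metric with its connection $\nabla_0$, $$\big\|\nabla_0^k\big((\phi^{-1})^*g-g_0\big)\big\|_{g_0}=O(|z|^{-\lambda-k})\quad\text{as }|z|\to\infty,\ \text{for every integer }k\ge0.$$ Let $\mu_g$ be the Borel measure $\mu_g(A)=\int_{A\cap X^\circ}dV_g$ on $X$. Then the Riemannian distance of $(X^\circ,g)$ extends to a continuous function $d_g:X\times X\to\mathbb{R}$, and $(X,d_g,\mu_g)$ satisfies a local $(1,2)$-Poincaré inequality: there are $\Lambda>1$ and a function $c:(0,\infty)\to(0,\infty)$ such that for every $R>0$, every $x\in X$, every $0<r\le R$ and every Lipschitz function $f:(X,d_g)\to\mathbb{R}$, writing $B=\{y: d_g(x,y)<r\}$ and $\Lambda B=\{y: d_g(x,y)<\Lambda r\}$, $$\frac1{\mu_g(B)}\int_B|f-f_B|\,d\mu_g\ \le\ c(R)\,r\left(\frac1{\mu_g(\Lambda B)}\int_{\Lambda B}(\mathrm{Lip} f)^2\,d\mu_g\right)^{1/2}.$$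 Here $f_B=\frac1{\mu_g(B)}\int_B f\,d\mu_g$ and $\mathrm{Lip} f(y)=\limsup_{w\to y,\,w\ne y}\frac{|f(w)-f(y)|}{d_g(w,y)}$; the balls have positive finite measure and the integrals are finite. -/

import Mathlib

open Set Filter MeasureTheory Topology
open scoped Manifold ContDiff ENNReal

noncomputable section

/-! ### Complex coordinates and tensors on a complex manifold -/

/-- The coordinate space `ℂⁿ` with its Hermitian norm. -/
abbrev Cn (n : ℕ) : Type := EuclideanSpace ℂ (Fin n)

/-- The flat metric `g₀` of `ℂⁿ`, i.e. `g₀(v, w) = Re ⟨v, w⟩`, as a real bilinear form. -/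
def flatMetric (n : ℕ) : Cn n →L[ℝ] Cn n →L[ℝ] ℝ := innerSL ℝ

/-- A field of real bilinear forms on the tangent spaces of a manifold `X` modelled on `ℂⁿ`.
The real tangent space `TangentSpace 𝓘(ℝ, Cn n) x` is by definition a copy of `Cn n` (the vectors
being read in the preferred chart at `x`). -/
abbrev BilinField (n : ℕ) (X : Type*) : Type _ := X → (Cn n →L[ℝ] Cn n →L[ℝ] ℝ)

section Manifold

variable {n : ℕ} {X : Type*} [TopologicalSpace X] [ChartedSpace (Cn n) X]

/-- The (real) differential at `z` of a map from `ℂⁿ` to the manifold. -/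
def realDifferential (F : Cn n → X) (z : Cn n) : Cn n →L[ℝ] Cn n :=
  mfderiv 𝓘(ℝ, Cn n) 𝓘(ℝ, Cn n) F z

/-- The pull-back `F^* g` at `z`: `(v, w) ↦ g (dF_z v, dF_z w)`. -/
def pullbackMetric (g : BilinField n X) (F : Cn n → X) (z : Cn n) : Cn n →L[ℝ] Cn n →L[ℝ] ℝ :=
  (g (F z)).bilinearComp (realDifferential F z) (realDifferential F z)

/-- `g` is a smooth Kähler metric on the open subset `U` of the complex manifold `X`. In every
holomorphic chart `ψ`, the coordinate expression `G` of `g` is symmetric, positive definite,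
invariant under the complex structure, smooth, and its Kähler form `ω(v, w) = G(iv, w)` is closed:
`dω(u, v, w) = ∂_u ω(v, w) + ∂_v ω(w, u) + ∂_w ω(u, v) = 0` for constant vectors `u, v, w`. -/
structure IsKahlerMetricOn (g : BilinField n X) (U : Set X) : Prop where
  symm : ∀ ψ ∈ IsManifold.maximalAtlas 𝓘(ℂ, Cn n) ω X, ∀ z ∈ ψ.target ∩ ψ.symm ⁻¹' U, ∀ v w,
    pullbackMetric g ψ.symm z v w = pullbackMetric g ψ.symm z w v
  pos : ∀ ψ ∈ IsManifold.maximalAtlas 𝓘(ℂ, Cn n) ω X, ∀ z ∈ ψ.target ∩ ψ.symm ⁻¹' U, ∀ v, v ≠ 0 →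
    0 < pullbackMetric g ψ.symm z v v
  hermitian : ∀ ψ ∈ IsManifold.maximalAtlas 𝓘(ℂ, Cn n) ω X, ∀ z ∈ ψ.target ∩ ψ.symm ⁻¹' U, ∀ v w,
    pullbackMetric g ψ.symm z (Complex.I • v) (Complex.I • w) = pullbackMetric g ψ.symm z v w
  smooth : ∀ ψ ∈ IsManifold.maximalAtlas 𝓘(ℂ, Cn n) ω X,
    ContDiffOn ℝ ∞ (pullbackMetric g ψ.symm) (ψ.target ∩ ψ.symm ⁻¹' U)
  closed : ∀ ψ ∈ IsManifold.maximalAtlas 𝓘(ℂ, Cn n) ω X, ∀ z ∈ ψ.target ∩ ψ.symm ⁻¹' U, ∀ u v w,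
    fderiv ℝ (fun y ↦ pullbackMetric g ψ.symm y (Complex.I • v) w) z u +
      fderiv ℝ (fun y ↦ pullbackMetric g ψ.symm y (Complex.I • w) u) z v +
      fderiv ℝ (fun y ↦ pullbackMetric g ψ.symm y (Complex.I • u) v) z w = 0

/-! ### Simple normal crossing divisors -/

variable {ι : Type*}

/-- `ψ = (z₁, …, zₙ)` are complex coordinates centred at `p` in whose domain the components of
`D = ⋃ Dᵢ` that occur are exactly the `D_{σ j} = {z_j = 0}`, for the first `k` coordinates
(the labels `σ j` being distinct). -/
structure IsAdaptedChart (D : ι → Set X) (p : X) (ψ : OpenPartialHomeomorph X (Cn n))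
    (k : ℕ) (hk : k ≤ n) (σ : Fin k → ι) : Prop where
  mem_atlas : ψ ∈ IsManifold.maximalAtlas 𝓘(ℂ, Cn n) ω X
  mem_source : p ∈ ψ.source
  centred : ψ p = 0
  injective : Function.Injective σ
  mem_iff : ∀ j : Fin k, ∀ x ∈ ψ.source, x ∈ D (σ j) ↔ ψ x (Fin.castLE hk j) = 0
  disjoint : ∀ i, i ∉ range σ → Disjoint (D i) ψ.source

/-- `D = ∑ Dᵢ` is a compact simple normal crossing divisor with irreducible components `Dᵢ`:
each `Dᵢ` is nonempty and connected, and near each point of `D` the components are coordinate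
hyperplanes (in particular they are smooth hypersurfaces which cross normally). -/
structure IsCompactSNCDivisor (n : ℕ) {X : Type*} [TopologicalSpace X] [ChartedSpace (Cn n) X]
    {ι : Type*} (D : ι → Set X) : Prop where
  isCompact : IsCompact (⋃ i, D i)
  isConnected : ∀ i, IsConnected (D i)
  exists_chart : ∀ p ∈ ⋃ i, D i, ∃ (ψ : OpenPartialHomeomorph X (Cn n)) (k : ℕ) (hk : k ≤ n)
    (σ : Fin k → ι), IsAdaptedChart D p ψ k hk σ

/-- The quadratic form `g_b(v, v) = ∑_{j ≤ k} |z_j|^{2 b_j - 2} |v_j|² + ∑_{j > k} |v_j|²` of the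
model cone metric on `ℂⁿ` with cone angles `2π b_j` along `{z_j = 0}`, `1 ≤ j ≤ k`. -/
def modelConeMetric (n k : ℕ) (b : Fin k → ℝ) (z v : Cn n) : ℝ :=
  ∑ j : Fin n, if h : (j : ℕ) < k then ‖z j‖ ^ (2 * b ⟨j, h⟩ - 2) * ‖v j‖ ^ 2 else ‖v j‖ ^ 2

/-! ### ALE conical Kähler metrics -/

/-- `g` is asymptotically locally Euclidean. There are a compact set `K ⊆ X`, a finite group
`Γ ⊂ U(n)` acting freely away from zero, and a diffeomorphism `φ` from `X \ K` onto a neighbourhood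
of infinity `{|z| > R₀} / Γ` of `ℂⁿ / Γ` with respect to which `g` is asymptotic to the flat metric
at the rate `|z|^{-ℓ}` with all derivatives. The diffeomorphism is given through the composition
`Φ = φ⁻¹ ∘ π : {|z| > R₀} → X \ K` with the quotient map `π`: this is a surjective local
diffeomorphism whose fibres are the orbits of `Γ`, and `Φ^* g` is `(φ⁻¹)^* g` read in the
coordinates `z`. The condition `cocompact` says that `|φ(x)| → ∞` precisely when `x → ∞` in `X`. -/
def IsALE (g : BilinField n X) : Prop :=
  ∃ (K : Set X) (Γ : Subgroup (Cn n ≃ₗᵢ[ℂ] Cn n)) (R₀ : ℝ) (Φ : Cn n → X),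
    IsCompact K ∧ Finite Γ ∧ (∀ γ ∈ Γ, γ ≠ 1 → ∀ z, z ≠ 0 → γ z ≠ z) ∧
    IsLocalDiffeomorphOn 𝓘(ℝ, Cn n) 𝓘(ℝ, Cn n) ∞ Φ {z | R₀ < ‖z‖} ∧
    Φ '' {z | R₀ < ‖z‖} = Kᶜ ∧
    (∀ z w, R₀ < ‖z‖ → R₀ < ‖w‖ → (Φ z = Φ w ↔ ∃ γ ∈ Γ, γ z = w)) ∧
    map Φ (Bornology.cobounded (Cn n)) = cocompact X ∧
    ∃ ℓ : ℝ, 0 < ℓ ∧ ∀ k : ℕ,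
      (fun z ↦ iteratedFDeriv ℝ k (fun y ↦ pullbackMetric g Φ y - flatMetric n) z)
        =O[Bornology.cobounded (Cn n)] fun z ↦ ‖z‖ ^ (-ℓ - k)

/-- `g` is an ALE conical Kähler metric on the pair `(X, ∑ (1 - βᵢ) Dᵢ)`. -/
structure IsALEConicalKahlerMetric (D : ι → Set X) (β : ι → ℝ) (g : BilinField n X) : Prop where
  kahler : IsKahlerMetricOn g (⋃ i, D i)ᶜ
  conical : ∀ p ∈ ⋃ i, D i, ∃ (ψ : OpenPartialHomeomorph X (Cn n)) (k : ℕ) (hk : k ≤ n)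
    (σ : Fin k → ι), IsAdaptedChart D p ψ k hk σ ∧ ∃ C : ℝ, 1 < C ∧
      ∀ z ∈ ψ.target, ψ.symm z ∉ ⋃ i, D i → ∀ v : Cn n,
        C⁻¹ * modelConeMetric n k (β ∘ σ) z v ≤ pullbackMetric g ψ.symm z v v ∧
        pullbackMetric g ψ.symm z v v ≤ C * modelConeMetric n k (β ∘ σ) z v
  ale : IsALE g

/-! ### The metric measure space `(X, d_g, μ_g)` -/

/-- The velocity `γ'(t)` of a path in `X`. -/
def pathVelocity (γ : ℝ → X) (t : ℝ) : Cn n :=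
  mfderiv 𝓘(ℝ, ℝ) 𝓘(ℝ, Cn n) γ t (1 : ℝ)

/-- The `g`-length of a path `γ : [0, 1] → X`, the integral of `g(γ', γ')^{1/2}`. -/
def gLength (g : BilinField n X) (γ : ℝ → X) : ℝ≥0∞ :=
  ∫⁻ t in Icc (0 : ℝ) 1, ENNReal.ofReal
    (√(g (γ t) (pathVelocity γ t) (pathVelocity γ t)))

/-- The Riemannian distance of `(U, g)`: the infimum of the lengths of the `C¹` paths in `U`. -/
def riemannianEDistOn (g : BilinField n X) (U : Set X) (x y : X) : ℝ≥0∞ :=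
  ⨅ (γ : ℝ → X) (_ : ContMDiffOn 𝓘(ℝ, ℝ) 𝓘(ℝ, Cn n) 1 γ (Icc 0 1) ∧
    MapsTo γ (Icc 0 1) U ∧ γ 0 = x ∧ γ 1 = y), gLength g γ

/-- The distance `d_g` on `X`: the continuous extension to `X × X` of the Riemannian distance
of `(X \ D, g)`. -/
def conicalDist (g : BilinField n X) (D : Set X) (x y : X) : ℝ :=
  extendFrom (Dᶜ ×ˢ Dᶜ) (fun p : X × X ↦ (riemannianEDistOn g Dᶜ p.1 p.2).toReal) (x, y)

/-- The Riemannian volume density of a bilinear form `G` on `ℂⁿ = ℝ²ⁿ` with respect to Lebesgue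
measure: the square root of the determinant of its matrix in a real orthonormal basis. -/
def volumeDensity (G : Cn n →L[ℝ] Cn n →L[ℝ] ℝ) : ℝ :=
  √(Matrix.det (Matrix.of fun a b ↦
    G (stdOrthonormalBasis ℝ (Cn n) a) (stdOrthonormalBasis ℝ (Cn n) b)))

/-- The Riemannian measure of `(X \ D, g)` in the domain of a chart `ψ` (zero elsewhere). -/
def chartMeasure [MeasurableSpace X] (g : BilinField n X) (D : Set X)
    (ψ : OpenPartialHomeomorph X (Cn n)) : Measure X :=
  Measure.map ψ.symm ((volume.restrict (ψ.target ∩ ψ.symm ⁻¹' Dᶜ)).withDensity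
    fun z ↦ ENNReal.ofReal (volumeDensity (pullbackMetric g ψ.symm z)))

/-- The measure `μ_g(A) = ∫_{A \ D} dV_g` on `X`: the least measure that dominates the Riemannian
measure of `(X \ D, g)` in every holomorphic chart. (The chart measures agree on overlaps, so
that it coincides with each of them on its domain.) -/
def conicalMeasure [MeasurableSpace X] (g : BilinField n X) (D : Set X) : Measure X :=
  ⨆ ψ ∈ IsManifold.maximalAtlas 𝓘(ℂ, Cn n) ω X, chartMeasure g D ψ

end Manifold

/-! ### The local Poincaré inequality -/

section Poincare

variable {X : Type*}

/-- The open ball of a distance function `d`. -/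
def distBall (d : X → X → ℝ) (x : X) (r : ℝ) : Set X := {y | d x y < r}

/-- `f` is Lipschitz with respect to `d`. -/
def IsLipschitzFor (d : X → X → ℝ) (f : X → ℝ) : Prop :=
  ∃ L : ℝ, ∀ x y, |f x - f y| ≤ L * d x y

/-- The local Lipschitz constant `Lip f (x) = limsup_{y → x, y ≠ x} |f y - f x| / d(x, y)`. -/
def localLip (d : X → X → ℝ) (f : X → ℝ) (x : X) : ℝ :=
  limsup (fun y ↦ |f y - f x| / d x y) (comap (d x) (𝓝[>] 0))

/-- The local `(1,2)`-Poincaré inequality, together with the finiteness of the quantities in it. -/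
def LocalPoincare12 [MeasurableSpace X] (d : X → X → ℝ) (μ : Measure X) : Prop :=
  ∃ Λ : ℝ, 1 < Λ ∧ ∃ c : ℝ → ℝ, (∀ R, 0 < R → 0 < c R) ∧
    ∀ R, 0 < R → ∀ (x : X) (r : ℝ), 0 < r → r ≤ R →
      (0 < μ (distBall d x r) ∧ μ (distBall d x (Λ * r)) < ⊤) ∧
      ∀ f : X → ℝ, IsLipschitzFor d f →
        IntegrableOn f (distBall d x r) μ ∧
        IntegrableOn (fun y ↦ localLip d f y ^ 2) (distBall d x (Λ * r)) μ ∧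
        ⨍ y in distBall d x r, |f y - ⨍ z in distBall d x r, f z ∂μ| ∂μ ≤
          c R * r * √(⨍ y in distBall d x (Λ * r), localLip d f y ^ 2 ∂μ)

end Poincare

end

/-! A length distance satisfies a local Poincaré inequality as soon as every point is the centre of
a chart of one fixed size in which distance and measure are comparable, with uniform constants, to
those of a Euclidean ball. The geometry of `g` serves to produce such charts.

Near `D`, the map `z_j ↦ |z_j|^(β-1) z_j` in each normal coordinate straightens the cone: it
stretches by `β|z|^(β-1)` radially and by `|z|^(β-1)` tangentially, so the model metric becomes
uniformly equivalent to the flat one (`norm_fderiv_radial`, `IsAdaptedChart.exists_isConeChart`).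
Off `D` a holomorphic chart works by continuity of `g`. Near infinity unit balls in the asymptotic
coordinates embed, because a nontrivial element of the free group `Γ` moves `z` by at least `δ|z|`
(`IsALE.exists_isConeChart`). Compactness of the remaining region makes all constants uniform
(`IsALE.hasUniformConeCharts`).

In such a chart `D` is a union of complex coordinate hyperplanes. These have real codimension two,
so points off `D` are joined off `D` by paths no longer than a multiple of their Euclidean distance
(`IsConeChart.exists_quadratic_path`); conversely a short path cannot leave the chart
(`IsConeChart.mem_source_of_gLengthOn_lt`). The Riemannian distance is therefore locally
bi-Lipschitz to the Euclidean one, extends continuously across `D`, and the extension is a length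
distance. The hyperplanes are null sets, and a Gram determinant estimate compares the volume with
Lebesgue measure.

At small scales the `(1,1)` inequality comes from integrating the gradient along segments
(`exists_lintegral_ball_enorm_sub_le`). To pass to larger radii, a ball whose radius grows by `s /
2` is covered by a bounded number of balls of the previous radius, and their constants are compared
on overlaps (`exists_lintegral_enorm_sub_le_of_net`). The number of steps needed depends on `R`,
whence the constant `c(R)`. Local doubling and Jensen's inequality turn `(1,1)` into `(1,2)`. -/

noncomputable section

set_option linter.unusedSectionVars false

/-! ### The (1,1)-Poincaré inequality on Euclidean balls -/

section EuclideanPoincare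

variable {E : Type*} [NormedAddCommGroup E] [NormedSpace ℝ E]

/-- `h` is an upper gradient of `u` in the pointwise sense: `Lip u ≤ h` on `s`. -/
def IsLipBoundOn (u : E → ℝ) (h : E → ℝ≥0∞) (s : Set E) : Prop :=
  ∀ w ∈ s, ∀ c : ℝ, h w < ENNReal.ofReal c → ∀ᶠ w' in 𝓝 w, |u w' - u w| ≤ c * ‖w' - w‖

/-- A Lipschitz function restricted to a segment is absolutely continuous, hence the integral of its
derivative, and that derivative is bounded by `h` times the speed `‖y - x‖`. -/
lemma enorm_sub_le_lintegral_segment {u : E → ℝ} {h : E → ℝ≥0∞} {s : Set E} (hs : Convex ℝ s)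
    {K : NNReal} (hu : LipschitzOnWith K u s) (hgrad : IsLipBoundOn u h s) {x y : E}
    (hx : x ∈ s) (hy : y ∈ s) :
    ‖u y - u x‖ₑ ≤ ‖y - x‖ₑ * ∫⁻ t in Icc (0 : ℝ) 1, h ((1 - t) • x + t • y) := by
  rcases eq_or_ne y x with rfl | hxy
  · simp
  have hN : 0 < ‖y - x‖ := norm_pos_iff.2 (sub_ne_zero.2 hxy)
  have hmem : ∀ t ∈ Icc (0 : ℝ) 1, (1 - t) • x + t • y ∈ s := fun t ht ↦
    hs hx hy (by linarith [ht.2]) ht.1 (by ring)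
  have hdiff : ∀ t t' : ℝ, ((1 - t) • x + t • y) - ((1 - t') • x + t' • y) = (t - t') • (y - x) := by
    intro t t'; module
  set φ : ℝ → ℝ := fun t ↦ u ((1 - t) • x + t • y) with hφ
  have hlip : LipschitzOnWith (K * ‖y - x‖₊) φ (uIcc 0 1) := by
    rw [uIcc_of_le zero_le_one]
    refine LipschitzOnWith.of_dist_le_mul fun t ht t' ht' ↦ ?_
    refine (hu.dist_le_mul _ (hmem t ht) _ (hmem t' ht')).trans_eq ?_
    rw [dist_eq_norm, hdiff, norm_smul, dist_eq_norm]
    push_cast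
    ring
  have hFTC := hlip.absolutelyContinuousOnInterval.integral_deriv_eq_sub
  have h01 : u y - u x = ∫ t in Icc (0 : ℝ) 1, deriv φ t := by
    rw [integral_Icc_eq_integral_Ioc, ← intervalIntegral.integral_of_le zero_le_one, hFTC]
    simp [hφ]
  rw [h01]
  refine (enorm_integral_le_lintegral_enorm _).trans ?_
  rw [← lintegral_const_mul' _ _ enorm_ne_top]
  rw [← restrict_Ioo_eq_restrict_Icc]
  refine setLIntegral_mono' measurableSet_Ioo fun t ht ↦ ?_
  set w := (1 - t) • x + t • y with hw
  have key : ∀ c : ℝ, h w < ENNReal.ofReal c → ‖deriv φ t‖ ≤ c * ‖y - x‖ := by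
    intro c hc
    have hc0 : 0 < c := ENNReal.ofReal_pos.1 (bot_le.trans_lt hc)
    refine norm_deriv_le_of_lip' (by positivity) ?_
    have hcont : ContinuousAt (fun t : ℝ ↦ (1 - t) • x + t • y) t := by fun_prop
    filter_upwards [hcont (hgrad w (hmem t (Ioo_subset_Icc_self ht)) c hc)] with t' ht'
    have : |u ((1 - t') • x + t' • y) - u w| ≤ c * ‖((1 - t') • x + t' • y) - w‖ := ht'
    rw [hw, hdiff, norm_smul] at this
    rw [Real.norm_eq_abs]
    refine this.trans_eq ?_
    ring
  rcases eq_or_ne (h w) ⊤ with htop | hfin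
  · rw [htop, ENNReal.mul_top (by simpa using hN.ne')]
    exact le_top
  · have : ‖deriv φ t‖ ≤ (h w).toReal * ‖y - x‖ := by
      rw [← div_le_iff₀ hN]
      refine le_of_forall_gt_imp_ge_of_dense fun c hc ↦ ?_
      rw [div_le_iff₀ hN]
      exact key c ((ENNReal.lt_ofReal_iff_toReal_lt hfin).2 hc)
    rw [← ofReal_norm, ← ofReal_norm, ← ENNReal.ofReal_toReal hfin,
      ← ENNReal.ofReal_mul (norm_nonneg _), mul_comm]
    exact ENNReal.ofReal_le_ofReal this

variable [FiniteDimensional ℝ E] [MeasurableSpace E] [BorelSpace E]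
  (μ : Measure E) [μ.IsAddHaarMeasure]

/-- Change of variables: the Jacobian factor `t⁻¹ ^ m`, with `m` the dimension, is at most `2 ^ m`
because `t ≥ 1/2`. -/
lemma lintegral_comp_add_smul_le {h : E → ℝ≥0∞} (hh : Measurable h) (v : E) {t : ℝ}
    (ht : 1 / 2 ≤ t) :
    ∫⁻ y, h (v + t • y) ∂μ ≤ 2 ^ Module.finrank ℝ E * ∫⁻ y, h y ∂μ := by
  have ht0 : 0 < t := by linarith
  have h1 : ∫⁻ y, h (v + t • y) ∂μ = ∫⁻ y, h (v + y) ∂(Measure.map (fun x ↦ t • x) μ) := by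
    rw [lintegral_map (by fun_prop) (by fun_prop)]
  have h2 : |(t ^ Module.finrank ℝ E)⁻¹| ≤ 2 ^ Module.finrank ℝ E := by
    rw [abs_of_pos (by positivity), ← inv_pow]
    gcongr
    rw [inv_le_comm₀ ht0 two_pos]
    linarith
  rw [h1, Measure.map_addHaar_smul μ ht0.ne', lintegral_smul_measure,
    lintegral_add_left_eq_self (μ := μ) h v, smul_eq_mul]
  gcongr
  refine (ENNReal.ofReal_le_ofReal h2).trans_eq ?_
  rw [ENNReal.ofReal_pow two_pos.le]
  simp

/-- The `(1,1)`-Poincaré inequality on Euclidean balls. -/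
theorem exists_lintegral_ball_enorm_sub_le {u : E → ℝ} {h : E → ℝ≥0∞} (hh : Measurable h)
    {w₀ : E} {s : ℝ} (hs : 0 < s) {K : NNReal} (hu : LipschitzOnWith K u (Metric.ball w₀ s))
    (hgrad : IsLipBoundOn u h (Metric.ball w₀ s)) :
    ∃ a : ℝ, ∫⁻ y in Metric.ball w₀ s, ‖u y - a‖ₑ ∂μ ≤
      ENNReal.ofReal (2 * s) * 2 ^ Module.finrank ℝ E * ∫⁻ y in Metric.ball w₀ s, h y ∂μ := by
  set B := Metric.ball w₀ s with hB
  have hBm : MeasurableSet B := Metric.isOpen_ball.measurableSet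
  have hBc : Convex ℝ B := convex_ball _ _
  have hB0 : μ B ≠ 0 := (Metric.measure_ball_pos μ _ hs).ne'
  have hBt : μ B ≠ ⊤ := Metric.isBounded_ball.measure_lt_top.ne
  set m := Module.finrank ℝ E
  -- Extending `h` by zero lets the substitutions below run over the whole space.
  set k : E → ℝ≥0∞ := B.indicator h with hk
  have hkm : Measurable k := hh.indicator hBm
  have hkI : ∫⁻ y, k y ∂μ = ∫⁻ y in B, h y ∂μ := lintegral_indicator hBm _
  -- the double integral of the segment integrals
  have hG : ∀ t ∈ Icc (0 : ℝ) 1,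
      ∫⁻ x in B, ∫⁻ y in B, k ((1 - t) • x + t • y) ∂μ ∂μ ≤ μ B * (2 ^ m * ∫⁻ y, k y ∂μ) := by
    intro t ht
    -- Substituting in `y` costs a factor `t⁻¹ ^ m`, harmless for `t ≥ 1/2`. For `t ≤ 1/2` the roles
    -- of `x` and `y` are exchanged, so no singularity at `t = 0` appears.
    have main : ∀ t : ℝ, 1 / 2 ≤ t →
        ∫⁻ x in B, ∫⁻ y in B, k ((1 - t) • x + t • y) ∂μ ∂μ ≤ μ B * (2 ^ m * ∫⁻ y, k y ∂μ) := by
      intro t ht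
      calc ∫⁻ x in B, ∫⁻ y in B, k ((1 - t) • x + t • y) ∂μ ∂μ
          ≤ ∫⁻ x in B, (2 ^ m * ∫⁻ y, k y ∂μ) ∂μ := lintegral_mono fun x ↦
            (setLIntegral_le_lintegral _ _).trans (lintegral_comp_add_smul_le μ hkm _ ht)
        _ = μ B * (2 ^ m * ∫⁻ y, k y ∂μ) := by rw [setLIntegral_const, mul_comm]
    rcases le_total (1 / 2) t with h2 | h2
    · exact main t h2
    · rw [lintegral_lintegral_swap]
      · have := main (1 - t) (by linarith)
        simp only [sub_sub_cancel] at this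
        simpa only [add_comm] using this
      · have : Measurable fun p : E × E ↦ k ((1 - t) • p.1 + t • p.2) :=
          hkm.comp (by fun_prop)
        exact this.aemeasurable
  have hpt : ∀ x ∈ B, ∀ y ∈ B, ‖u y - u x‖ₑ ≤
      ENNReal.ofReal (2 * s) * ∫⁻ t in Icc (0 : ℝ) 1, k ((1 - t) • x + t • y) := by
    intro x hx y hy
    refine (enorm_sub_le_lintegral_segment hBc hu hgrad hx hy).trans ?_
    have hxy : ‖y - x‖ₑ ≤ ENNReal.ofReal (2 * s) := by
      rw [← ofReal_norm]
      refine ENNReal.ofReal_le_ofReal ?_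
      rw [← dist_eq_norm]
      have := Metric.mem_ball.1 hx
      have := Metric.mem_ball.1 hy
      linarith [dist_triangle_right y x w₀]
    refine mul_le_mul' hxy (setLIntegral_mono' measurableSet_Icc fun t ht ↦ ?_)
    rw [hk, indicator_of_mem]
    exact hBc hx hy (by linarith [ht.2]) ht.1 (by ring)
  have hdouble : ∫⁻ x in B, ∫⁻ y in B, ‖u y - u x‖ₑ ∂μ ∂μ ≤
      μ B * (ENNReal.ofReal (2 * s) * 2 ^ m * ∫⁻ y in B, h y ∂μ) := by
    calc ∫⁻ x in B, ∫⁻ y in B, ‖u y - u x‖ₑ ∂μ ∂μ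
        ≤ ∫⁻ x in B, ∫⁻ y in B, ENNReal.ofReal (2 * s) *
            ∫⁻ t in Icc (0 : ℝ) 1, k ((1 - t) • x + t • y) ∂volume ∂μ ∂μ :=
          setLIntegral_mono' hBm fun x hx ↦ setLIntegral_mono' hBm fun y hy ↦ hpt x hx y hy
      _ = ENNReal.ofReal (2 * s) * ∫⁻ x in B, ∫⁻ y in B,
            ∫⁻ t in Icc (0 : ℝ) 1, k ((1 - t) • x + t • y) ∂volume ∂μ ∂μ := by
          simp_rw [lintegral_const_mul' _ _ ENNReal.ofReal_ne_top]
      _ = ENNReal.ofReal (2 * s) * ∫⁻ x in B, ∫⁻ t in Icc (0 : ℝ) 1,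
            ∫⁻ y in B, k ((1 - t) • x + t • y) ∂μ ∂volume ∂μ := by
          congr 1
          refine lintegral_congr fun x ↦ ?_
          refine lintegral_lintegral_swap ?_
          have : Measurable fun p : E × ℝ ↦ k ((1 - p.2) • x + p.2 • p.1) :=
            hkm.comp (by fun_prop)
          exact this.aemeasurable
      _ = ENNReal.ofReal (2 * s) * ∫⁻ t in Icc (0 : ℝ) 1, ∫⁻ x in B,
            ∫⁻ y in B, k ((1 - t) • x + t • y) ∂μ ∂μ ∂volume := by
          congr 1
          refine lintegral_lintegral_swap ?_
          have : Measurable fun p : (E × ℝ) × E ↦ k ((1 - p.1.2) • p.1.1 + p.1.2 • p.2) :=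
            hkm.comp (by fun_prop)
          exact (this.lintegral_prod_right' (ν := μ.restrict B)).aemeasurable
      _ ≤ ENNReal.ofReal (2 * s) * ∫⁻ _ in Icc (0 : ℝ) 1, μ B * (2 ^ m * ∫⁻ y, k y ∂μ) := by
          refine mul_le_mul' le_rfl ?_
          exact setLIntegral_mono' measurableSet_Icc hG
      _ = _ := by
          rw [setLIntegral_const, hkI]
          simp only [Real.volume_Icc, sub_zero, ENNReal.ofReal_one, mul_one]
          ring
  have hum : AEMeasurable u (μ.restrict B) := hu.continuousOn.aemeasurable hBm
  have hum2 : AEMeasurable (fun x ↦ ∫⁻ y in B, ‖u y - u x‖ₑ ∂μ) (μ.restrict B) := by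
    have : AEMeasurable (fun p : E × E ↦ ‖u p.2 - u p.1‖ₑ)
        ((μ.restrict B).prod (μ.restrict B)) := by
      refine (AEMeasurable.sub ?_ ?_).enorm
      · exact hum.comp_quasiMeasurePreserving Measure.quasiMeasurePreserving_snd
      · exact hum.comp_quasiMeasurePreserving Measure.quasiMeasurePreserving_fst
    exact this.lintegral_prod_right'
  -- Some `x` makes the inner integral at most its average over `B`; the constant is then `u x`.
  obtain ⟨x, -, hx⟩ := exists_le_setLAverage hB0 hBt hum2
  refine ⟨u x, hx.trans ?_⟩
  rw [setLAverage_eq]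
  exact ENNReal.div_le_of_le_mul' hdouble

end EuclideanPoincare

/-! ### Length distances and the measurability of the local Lipschitz constant -/

section MetricMeasure

variable {X : Type*} [TopologicalSpace X]

/-- A (pseudo-)distance function, continuous for the given topology, all of whose points can be
joined through intermediate points at (almost) prescribed distances. -/
structure IsLengthDist (d : X → X → ℝ) : Prop where
  self : ∀ x, d x x = 0
  symm : ∀ x y, d x y = d y x
  triangle : ∀ x y z, d x z ≤ d x y + d y z
  continuous : Continuous fun p : X × X ↦ d p.1 p.2
  exists_between : ∀ x y a b, 0 < a → 0 < b → d x y < a + b → ∃ z, d x z < a ∧ d z y < b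

namespace IsLengthDist

variable {d : X → X → ℝ} (hd : IsLengthDist d)
include hd

lemma nonneg (x y : X) : 0 ≤ d x y := by
  have := hd.triangle x y x
  rw [hd.self, hd.symm y x] at this
  linarith

lemma isOpen_distBall (x : X) (r : ℝ) : IsOpen (distBall d x r) :=
  isOpen_lt (hd.continuous.comp (by fun_prop : Continuous fun y ↦ (x, y))) continuous_const

lemma distBall_subset {x y : X} {r t : ℝ} (h : d x y + r ≤ t) :
    distBall d y r ⊆ distBall d x t := fun z hz ↦ by
  have : d y z < r := hz
  exact (hd.triangle x y z).trans_lt (by linarith)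

lemma exists_lipschitz_const {f : X → ℝ} (hf : IsLipschitzFor d f) :
    ∃ L : ℝ, 0 ≤ L ∧ ∀ x y, |f x - f y| ≤ L * d x y := by
  obtain ⟨L, hL⟩ := hf
  exact ⟨max L 0, le_max_right _ _, fun x y ↦ (hL x y).trans
    (mul_le_mul_of_nonneg_right (le_max_left _ _) (hd.nonneg x y))⟩

lemma continuous_of_isLipschitzFor {f : X → ℝ} (hf : IsLipschitzFor d f) : Continuous f := by
  obtain ⟨L, -, hL⟩ := hd.exists_lipschitz_const hf
  refine continuous_iff_continuousAt.2 fun x ↦ ?_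
  rw [ContinuousAt, tendsto_iff_dist_tendsto_zero]
  have h1 : Tendsto (fun y ↦ L * d y x) (𝓝 x) (𝓝 0) := by
    have : Continuous fun y ↦ L * d y x :=
      continuous_const.mul (hd.continuous.comp (by fun_prop : Continuous fun y ↦ (y, x)))
    simpa [hd.self] using this.tendsto x
  exact squeeze_zero (fun _ ↦ dist_nonneg) (fun y ↦ hL y x) h1

lemma eventually_comap_pos (x : X) : ∀ᶠ y in comap (d x) (𝓝[>] 0), 0 < d x y :=
  preimage_mem_comap self_mem_nhdsWithin

lemma localLip_eq (f : X → ℝ) (x : X) : localLip d f x =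
    sInf {a : ℝ | ∀ᶠ y in comap (d x) (𝓝[>] 0), |f y - f x| / d x y ≤ a} := by
  rw [localLip, limsup_eq]

/-- If no points lie at small positive distance from `x`, the filter is `⊥`, every real is an
eventual bound, and `sInf univ = 0` by convention. -/
lemma localLip_nonneg (f : X → ℝ) (x : X) : 0 ≤ localLip d f x := by
  rw [hd.localLip_eq]
  rcases eq_or_neBot (comap (d x) (𝓝[>] 0)) with h | h
  · simp [h]
  · refine Real.sInf_nonneg fun a ha ↦ ?_
    obtain ⟨y, hy⟩ := (show ∀ᶠ y in comap (d x) (𝓝[>] 0), |f y - f x| / d x y ≤ a from ha).exists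
    exact (div_nonneg (abs_nonneg _) (hd.nonneg x y)).trans hy

lemma bddBelow_localLip {f : X → ℝ} {x : X} (h : (comap (d x) (𝓝[>] 0)).NeBot) :
    BddBelow {a : ℝ | ∀ᶠ y in comap (d x) (𝓝[>] 0), |f y - f x| / d x y ≤ a} := by
  refine ⟨0, fun a ha ↦ ?_⟩
  obtain ⟨y, hy⟩ := (show ∀ᶠ y in comap (d x) (𝓝[>] 0), |f y - f x| / d x y ≤ a from ha).exists
  exact (div_nonneg (abs_nonneg _) (hd.nonneg x y)).trans hy

lemma eventually_div_le {f : X → ℝ} {L : ℝ} (hL : ∀ x y, |f x - f y| ≤ L * d x y) (x : X) :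
    ∀ᶠ y in comap (d x) (𝓝[>] 0), |f y - f x| / d x y ≤ L := by
  filter_upwards [hd.eventually_comap_pos x] with y hy
  rw [div_le_iff₀ hy, hd.symm x y]
  exact hL y x

lemma localLip_le {f : X → ℝ} {L : ℝ} (hL0 : 0 ≤ L) (hL : ∀ x y, |f x - f y| ≤ L * d x y) (x : X) :
    localLip d f x ≤ L := by
  rw [hd.localLip_eq]
  rcases eq_or_neBot (comap (d x) (𝓝[>] 0)) with h | h
  · simp [h, hL0]
  · exact csInf_le (hd.bddBelow_localLip h) (hd.eventually_div_le hL x)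

/-- The strict inequality supplies a slope bound on a punctured ball, the form in which `Lip f` is
used. Positivity of `c` is what makes it hold for the default value `0` on the trivial filter. -/
lemma localLip_lt_iff {f : X → ℝ} (hf : IsLipschitzFor d f) {x : X} {c : ℝ} (hc : 0 < c) :
    localLip d f x < c ↔
      ∃ a < c, ∀ᶠ y in comap (d x) (𝓝[>] 0), |f y - f x| / d x y ≤ a := by
  obtain ⟨L, -, hL⟩ := hd.exists_lipschitz_const hf
  rw [hd.localLip_eq]
  rcases eq_or_neBot (comap (d x) (𝓝[>] 0)) with h | h
  · simp only [h, eventually_bot, ofPred_true, Real.sInf_univ, hc, and_true, true_iff]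
    exact exists_lt c
  · rw [csInf_lt_iff (hd.bddBelow_localLip h) ⟨L, hd.eventually_div_le hL x⟩]
    simp only [mem_ofPred_eq]
    exact exists_congr fun a ↦ and_comm

lemma eventually_comap_iff {p : X → Prop} {x : X} :
    (∀ᶠ y in comap (d x) (𝓝[>] 0), p y) ↔
      ∃ k : ℕ, ∀ y, 0 < d x y → d x y < 1 / ((k : ℝ) + 1) → p y := by
  rw [eventually_comap]
  constructor
  · intro h
    obtain ⟨u, hu, hsub⟩ := mem_nhdsGT_iff_exists_Ioo_subset.1 h
    obtain ⟨k, hk⟩ := exists_nat_one_div_lt (show (0 : ℝ) < u from hu)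
    exact ⟨k, fun y h0 h1 ↦ hsub ⟨h0, h1.trans hk⟩ y rfl⟩
  · rintro ⟨k, hk⟩
    refine mem_nhdsGT_iff_exists_Ioo_subset.2 ⟨1 / ((k : ℝ) + 1), ?_, ?_⟩
    · exact mem_Ioi.2 (by positivity)
    · rintro t ⟨h0, h1⟩ y rfl
      exact hk y h0 h1

lemma measurable_localLip [MeasurableSpace X] [BorelSpace X] {f : X → ℝ}
    (hf : IsLipschitzFor d f) : Measurable (localLip d f) := by
  have hfc := hd.continuous_of_isLipschitzFor hf
  refine measurable_of_Iio fun c ↦ ?_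
  rcases le_or_gt c 0 with hc | hc
  · convert! MeasurableSet.empty
    ext x
    simpa using hc.trans (hd.localLip_nonneg f x)
  -- Rational slopes `q` and radii `1 / (k + 1)` make the outer unions countable. The union over `y`
  -- is uncountable, but each of its members is open in `x`.
  have : localLip d f ⁻¹' Iio c = ⋃ (q : ℚ) (_ : (q : ℝ) < c) (k : ℕ),
      (⋃ y, {x | 0 < d x y ∧ d x y < 1 / ((k : ℝ) + 1) ∧ q * d x y < |f y - f x|})ᶜ := by
    ext x
    simp only [mem_preimage, mem_Iio, hd.localLip_lt_iff hf hc, mem_iUnion, mem_compl_iff,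
      mem_ofPred_eq, not_exists, not_and, not_lt, exists_prop, hd.eventually_comap_iff]
    constructor
    · rintro ⟨a, hac, k, hk⟩
      obtain ⟨q, haq, hqc⟩ := exists_rat_btwn hac
      refine ⟨q, hqc, k, fun y h0 h1 ↦ ?_⟩
      have := hk y h0 h1
      rw [div_le_iff₀ h0] at this
      exact this.trans (mul_le_mul_of_nonneg_right haq.le h0.le)
    · rintro ⟨q, hqc, k, hk⟩
      exact ⟨q, hqc, k, fun y h0 h1 ↦ (div_le_iff₀ h0).2 (hk y h0 h1)⟩
  rw [this]
  refine MeasurableSet.iUnion fun q ↦ MeasurableSet.iUnion fun _ ↦ MeasurableSet.iUnion fun k ↦ ?_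
  refine (isOpen_iUnion fun y ↦ ?_).measurableSet.compl
  have hdc : Continuous fun x ↦ d x y :=
    hd.continuous.comp (by fun_prop : Continuous fun x ↦ (x, y))
  exact (isOpen_lt continuous_const hdc).inter ((isOpen_lt hdc continuous_const).inter
    (isOpen_lt (continuous_const.mul hdc) (continuous_const.sub hfc).abs))

end IsLengthDist

end MetricMeasure

/-! ### Transport of the small scale inequality through a bi-Lipschitz chart -/

section UniformChart

variable {X : Type*} [TopologicalSpace X] [MeasurableSpace X] [BorelSpace X]
  {E : Type*} [NormedAddCommGroup E] [NormedSpace ℝ E] [FiniteDimensional ℝ E]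
  [MeasurableSpace E] [BorelSpace E]

/-- `Ψ` identifies a neighbourhood of `x` in `(X, d, μ)`, containing the ball of radius `ρ / L`,
with a piece of `E` containing the ball of radius `ρ`, up to a factor `L` for the distances and
a factor `C` for the measures. -/
structure IsUniformChart (d : X → X → ℝ) (μ : Measure X) (ν : Measure E) (L ρ : ℝ) (C : ℝ≥0∞)
    (x : X) (Ψ : OpenPartialHomeomorph X E) : Prop where
  mem_source : x ∈ Ψ.source
  ball_subset : Metric.ball (Ψ x) ρ ⊆ Ψ.target
  dist_le : ∀ w ∈ Metric.ball (Ψ x) ρ, ∀ w' ∈ Metric.ball (Ψ x) ρ,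
    d (Ψ.symm w) (Ψ.symm w') ≤ L * ‖w - w'‖
  le_dist : ∀ y, d x y < ρ / L → y ∈ Ψ.source ∧ ‖Ψ y - Ψ x‖ ≤ L * d x y
  measure_le : μ.restrict Ψ.source ≤ C • (ν.restrict Ψ.target).map Ψ.symm
  le_measure : (ν.restrict Ψ.target).map Ψ.symm ≤ C • μ

namespace IsUniformChart

variable {d : X → X → ℝ} {μ : Measure X} {ν : Measure E} [ν.IsAddHaarMeasure] {L ρ : ℝ}
  {C : ℝ≥0∞} {x : X} {Ψ : OpenPartialHomeomorph X E} (hΨ : IsUniformChart d μ ν L ρ C x Ψ)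
  (hd : IsLengthDist d) (hL : 1 ≤ L)

include hΨ

lemma symm_mem_distBall (hL : 1 ≤ L) {t : ℝ} (ht : t ≤ ρ) {w : E}
    (hw : w ∈ Metric.ball (Ψ x) t) : Ψ.symm w ∈ distBall d x (L * t) := by
  have hw' := mem_ball_iff_norm'.1 hw
  have ht0 : 0 < t := (norm_nonneg _).trans_lt hw'
  have h := hΨ.dist_le (Ψ x) (Metric.mem_ball_self (ht0.trans_le ht)) w
    (Metric.ball_subset_ball ht hw)
  rw [Ψ.left_inv hΨ.mem_source] at h
  exact h.trans_lt (mul_lt_mul_of_pos_left hw' (by linarith))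

lemma mem_of_mem_distBall (hL : 1 ≤ L) {r : ℝ} (hr : L * r ≤ ρ) {y : X}
    (hy : y ∈ distBall d x r) : y ∈ Ψ.source ∧ Ψ y ∈ Metric.ball (Ψ x) (L * r) := by
  have hL0 : 0 < L := by linarith
  have hy' : d x y < r := hy
  obtain ⟨h1, h2⟩ := hΨ.le_dist y (hy'.trans_le ((le_div_iff₀' hL0).2 hr))
  exact ⟨h1, mem_ball_iff_norm.2 (h2.trans_lt (mul_lt_mul_of_pos_left hy' hL0))⟩

lemma aemeasurable_symm : AEMeasurable Ψ.symm (ν.restrict Ψ.target) :=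
  Ψ.continuousOn_symm.aemeasurable Ψ.open_target.measurableSet

-- Since `L * r ≤ ρ`, the ball stays in the chart domain and its image in the Euclidean ball of
-- radius `L * r`, so the comparison of measures can be integrated there.
include hd in
lemma setLIntegral_distBall_le (hL : 1 ≤ L) {r : ℝ} (hr : L * r ≤ ρ) {k : X → ℝ≥0∞}
    (hk : Measurable k) :
    ∫⁻ y in distBall d x r, k y ∂μ ≤ C * ∫⁻ w in Metric.ball (Ψ x) (L * r), k (Ψ.symm w) ∂ν := by
  have hBm : MeasurableSet (distBall d x r) := (hd.isOpen_distBall x r).measurableSet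
  have hsub : distBall d x r ⊆ Ψ.source := fun y hy ↦ (hΨ.mem_of_mem_distBall hL hr hy).1
  calc ∫⁻ y in distBall d x r, k y ∂μ
      = ∫⁻ y in distBall d x r, k y ∂(μ.restrict Ψ.source) := by
        rw [Measure.restrict_restrict hBm, inter_eq_left.2 hsub]
    _ = ∫⁻ y, (distBall d x r).indicator k y ∂(μ.restrict Ψ.source) :=
        (lintegral_indicator hBm _).symm
    _ ≤ ∫⁻ y, (distBall d x r).indicator k y ∂(C • (ν.restrict Ψ.target).map Ψ.symm) :=
        lintegral_mono' hΨ.measure_le le_rfl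
    _ = C * ∫⁻ w in Ψ.target, (distBall d x r).indicator k (Ψ.symm w) ∂ν := by
        rw [lintegral_smul_measure, smul_eq_mul,
          lintegral_map' (hk.indicator hBm).aemeasurable hΨ.aemeasurable_symm]
    _ ≤ C * ∫⁻ w in Ψ.target, (Metric.ball (Ψ x) (L * r)).indicator (fun w ↦ k (Ψ.symm w)) w ∂ν := by
        refine mul_le_mul' le_rfl ?_
        refine setLIntegral_mono' Ψ.open_target.measurableSet fun w hw ↦ ?_
        by_cases h : Ψ.symm w ∈ distBall d x r
        · have := (hΨ.mem_of_mem_distBall hL hr h).2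
          rw [Ψ.right_inv hw] at this
          rw [indicator_of_mem h, indicator_of_mem this]
        · rw [indicator_of_notMem h]
          exact zero_le
    _ ≤ C * ∫⁻ w, (Metric.ball (Ψ x) (L * r)).indicator (fun w ↦ k (Ψ.symm w)) w ∂ν := by
        refine mul_le_mul' le_rfl ?_
        exact setLIntegral_le_lintegral _ _
    _ = _ := by rw [lintegral_indicator Metric.isOpen_ball.measurableSet]

include hd in
lemma setLIntegral_ball_le (hL : 1 ≤ L) {t : ℝ} (ht : t ≤ ρ) {k : X → ℝ≥0∞}
    (hk : Measurable k) :
    ∫⁻ w in Metric.ball (Ψ x) t, k (Ψ.symm w) ∂ν ≤ C * ∫⁻ y in distBall d x (L * t), k y ∂μ := by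
  have hBm : MeasurableSet (distBall d x (L * t)) := (hd.isOpen_distBall x _).measurableSet
  have hsub : Metric.ball (Ψ x) t ⊆ Ψ.target :=
    (Metric.ball_subset_ball ht).trans hΨ.ball_subset
  calc ∫⁻ w in Metric.ball (Ψ x) t, k (Ψ.symm w) ∂ν
      ≤ ∫⁻ w in Metric.ball (Ψ x) t, (distBall d x (L * t)).indicator k (Ψ.symm w) ∂ν := by
        refine setLIntegral_mono' Metric.isOpen_ball.measurableSet fun w hw ↦ ?_
        rw [indicator_of_mem (hΨ.symm_mem_distBall hL ht hw)]
    _ ≤ ∫⁻ w in Ψ.target, (distBall d x (L * t)).indicator k (Ψ.symm w) ∂ν :=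
        lintegral_mono_set hsub
    _ = ∫⁻ y, (distBall d x (L * t)).indicator k y ∂((ν.restrict Ψ.target).map Ψ.symm) := by
        rw [lintegral_map' (hk.indicator hBm).aemeasurable hΨ.aemeasurable_symm]
    _ ≤ ∫⁻ y, (distBall d x (L * t)).indicator k y ∂(C • μ) := lintegral_mono' hΨ.le_measure le_rfl
    _ = _ := by rw [lintegral_smul_measure, smul_eq_mul, lintegral_indicator hBm]

include hd in
lemma measure_distBall_le (hL : 1 ≤ L) {r : ℝ} (hr : L * r ≤ ρ) :
    μ (distBall d x r) ≤ C * ν (Metric.ball 0 (L * r)) := by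
  have := hΨ.setLIntegral_distBall_le hd hL hr (k := fun _ ↦ 1) measurable_const
  simpa [Measure.addHaar_ball_center] using this

include hd in
lemma measure_ball_le (hL : 1 ≤ L) {t : ℝ} (ht : t ≤ ρ) :
    ν (Metric.ball 0 t) ≤ C * μ (distBall d x (L * t)) := by
  have := hΨ.setLIntegral_ball_le hd hL ht (k := fun _ ↦ 1) measurable_const
  simpa [Measure.addHaar_ball_center] using this

-- The inverse chart increases distances at most by the factor `L`, so it increases slopes by at
-- most `L` as well.
include hd in
lemma isLipBoundOn (hL : 1 ≤ L) {f : X → ℝ} (hf : IsLipschitzFor d f) :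
    IsLipBoundOn (f ∘ Ψ.symm) (fun w ↦ ENNReal.ofReal (L * localLip d f (Ψ.symm w)))
      (Metric.ball (Ψ x) ρ) := by
  intro w hw c hc
  have hL0 : 0 < L := by linarith
  have hc0 : 0 < c := ENNReal.ofReal_pos.1 (bot_le.trans_lt hc)
  rw [ENNReal.ofReal_lt_ofReal_iff hc0, ← lt_div_iff₀' hL0,
    hd.localLip_lt_iff hf (by positivity)] at hc
  obtain ⟨a, hac, ha⟩ := hc
  obtain ⟨k, hk⟩ := hd.eventually_comap_iff.1 ha
  have hδ : 0 < 1 / ((k : ℝ) + 1) / L := by positivity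
  filter_upwards [Metric.isOpen_ball.mem_nhds hw, Metric.ball_mem_nhds w hδ] with w' hw' hww'
  have h1 := hΨ.dist_le w hw w' hw'
  rw [mem_ball_iff_norm', lt_div_iff₀' hL0] at hww'
  have hle : d (Ψ.symm w) (Ψ.symm w') ≤ L * ‖w' - w‖ := by rwa [norm_sub_rev]
  -- `d` is only known to be a pseudo-distance: points at distance zero are invisible to `localLip`,
  -- but a Lipschitz `f` agrees at them.
  rcases (hd.nonneg (Ψ.symm w) (Ψ.symm w')).eq_or_lt with h0 | h0
  · obtain ⟨K, hK0, hK⟩ := hd.exists_lipschitz_const hf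
    have := hK (Ψ.symm w') (Ψ.symm w)
    rw [hd.symm, ← h0, mul_zero] at this
    exact this.trans (by positivity)
  · have := hk _ h0 (h1.trans_lt hww')
    rw [div_le_iff₀ h0] at this
    have hc' : a ≤ c / L := hac.le
    calc |(f ∘ Ψ.symm) w' - (f ∘ Ψ.symm) w| ≤ a * d (Ψ.symm w) (Ψ.symm w') := this
      _ ≤ c / L * d (Ψ.symm w) (Ψ.symm w') := by gcongr
      _ ≤ c / L * (L * ‖w' - w‖) := by gcongr
      _ = c * ‖w' - w‖ := by field_simp

/-- The small scale Poincaré inequality. -/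
lemma exists_lintegral_enorm_sub_le (hd : IsLengthDist d) (hL : 1 ≤ L) {r : ℝ} (hr0 : 0 < r)
    (hr : L * r ≤ ρ) {f : X → ℝ} (hf : IsLipschitzFor d f) :
    ∃ a : ℝ, ∫⁻ y in distBall d x r, ‖f y - a‖ₑ ∂μ ≤
      (C * C * ENNReal.ofReal (2 * L * L) * 2 ^ Module.finrank ℝ E) * ENNReal.ofReal r *
        ∫⁻ y in distBall d x (L * L * r), ENNReal.ofReal (localLip d f y) ∂μ := by
  have hL0 : 0 < L := by linarith
  have hLr : 0 < L * r := by positivity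
  have hlipm := hd.measurable_localLip hf
  have hsub : Metric.ball (Ψ x) (L * r) ⊆ Metric.ball (Ψ x) ρ := Metric.ball_subset_ball hr
  classical
  -- The Euclidean inequality requires a globally measurable gradient, while `Ψ.symm` is controlled
  -- only on its target; `σ` is a measurable extension.
  let σ : E → X := Ψ.target.piecewise Ψ.symm fun _ ↦ x
  have hσ : Measurable σ := Ψ.continuousOn_symm.measurable_piecewise continuousOn_const
    Ψ.open_target.measurableSet
  have hσeq : ∀ w ∈ Metric.ball (Ψ x) (L * r), σ w = Ψ.symm w := fun w hw ↦
    piecewise_eq_of_mem _ _ _ (hΨ.ball_subset (hsub hw))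
  obtain ⟨K, hK0, hK⟩ := hd.exists_lipschitz_const hf
  have hu : LipschitzOnWith (Real.toNNReal (K * L)) (f ∘ Ψ.symm) (Metric.ball (Ψ x) (L * r)) := by
    refine LipschitzOnWith.of_dist_le_mul fun w hw w' hw' ↦ ?_
    rw [Real.coe_toNNReal _ (by positivity), Real.dist_eq, dist_eq_norm, mul_assoc]
    exact (hK _ _).trans (mul_le_mul_of_nonneg_left (hΨ.dist_le w (hsub hw) w' (hsub hw')) hK0)
  have hgrad : IsLipBoundOn (f ∘ Ψ.symm) (fun w ↦ ENNReal.ofReal (L * localLip d f (σ w)))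
      (Metric.ball (Ψ x) (L * r)) := by
    intro w hw c hc
    simp only [hσeq w hw] at hc
    exact hΨ.isLipBoundOn hd hL hf w (hsub hw) c hc
  obtain ⟨a, ha⟩ := exists_lintegral_ball_enorm_sub_le ν
    ((measurable_const.mul (hlipm.comp hσ)).ennreal_ofReal) hLr hu hgrad
  refine ⟨a, ?_⟩
  have hfm : Measurable f := (hd.continuous_of_isLipschitzFor hf).measurable
  calc ∫⁻ y in distBall d x r, ‖f y - a‖ₑ ∂μ
      ≤ C * ∫⁻ w in Metric.ball (Ψ x) (L * r), ‖f (Ψ.symm w) - a‖ₑ ∂ν :=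
        hΨ.setLIntegral_distBall_le hd hL hr (hfm.sub measurable_const).enorm
    _ ≤ C * (ENNReal.ofReal (2 * (L * r)) * 2 ^ Module.finrank ℝ E *
          ∫⁻ w in Metric.ball (Ψ x) (L * r), ENNReal.ofReal (L * localLip d f (σ w)) ∂ν) := by
        gcongr
        exact ha
    _ = C * (ENNReal.ofReal (2 * (L * r)) * 2 ^ Module.finrank ℝ E * (ENNReal.ofReal L *
          ∫⁻ w in Metric.ball (Ψ x) (L * r), ENNReal.ofReal (localLip d f (Ψ.symm w)) ∂ν)) := by
        congr 2
        rw [← lintegral_const_mul' _ _ ENNReal.ofReal_ne_top]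
        refine setLIntegral_congr_fun Metric.isOpen_ball.measurableSet fun w hw ↦ ?_
        simp only [hσeq w hw, ENNReal.ofReal_mul hL0.le]
    _ ≤ C * (ENNReal.ofReal (2 * (L * r)) * 2 ^ Module.finrank ℝ E * (ENNReal.ofReal L *
          (C * ∫⁻ y in distBall d x (L * (L * r)), ENNReal.ofReal (localLip d f y) ∂μ))) := by
        refine mul_le_mul' le_rfl (mul_le_mul' le_rfl (mul_le_mul' le_rfl ?_))
        exact hΨ.setLIntegral_ball_le hd hL hr hlipm.ennreal_ofReal
    _ = _ := by
        rw [show 2 * (L * r) = 2 * L * r by ring, show 2 * L * L = (2 * L) * L by ring,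
          ENNReal.ofReal_mul (by positivity : 0 ≤ 2 * L),
          ENNReal.ofReal_mul (by positivity : 0 ≤ 2 * L), mul_assoc L L r]
        ring

end IsUniformChart

end UniformChart

/-! ### From small to bounded scales: nets, doubling and chaining -/

section UniformAtlas

lemma setLIntegral_biUnion_finset_le {α κ : Type*} [MeasurableSpace α] (μ : Measure α)
    (V : Finset κ) (s : κ → Set α) (f : α → ℝ≥0∞) :
    ∫⁻ y in ⋃ v ∈ V, s v, f y ∂μ ≤ ∑ v ∈ V, ∫⁻ y in s v, f y ∂μ := by
  classical
  induction V using Finset.induction_on with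
  | empty => simp
  | insert v V hv ih =>
    rw [Finset.set_biUnion_insert, Finset.sum_insert hv]
    exact (lintegral_union_le _ _ _).trans (add_le_add le_rfl ih)

variable {X : Type*} [TopologicalSpace X] [MeasurableSpace X] [BorelSpace X]
  {E : Type*} [NormedAddCommGroup E] [NormedSpace ℝ E] [FiniteDimensional ℝ E]
  [MeasurableSpace E] [BorelSpace E]
  {d : X → X → ℝ} {μ : Measure X} {ν : Measure E} [ν.IsAddHaarMeasure] {L ρ : ℝ}
  {C : ℝ≥0∞}

/-- Balls of radius `s` are covered by a fixed number of balls of radius `s / 2`. -/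
lemma exists_uniform_net (hL : 1 ≤ L)
    (hch : ∀ x, ∃ Ψ : OpenPartialHomeomorph X E, IsUniformChart d μ ν L ρ C x Ψ) {s : ℝ}
    (hs0 : 0 < s) (hs : L * s ≤ ρ) :
    ∃ V : Finset E, ∀ x, ∃ z : E → X, (∀ v ∈ V, d x (z v) < L * L * s) ∧
      ∀ y, d x y < s → ∃ v ∈ V, d (z v) y < s / 2 := by
  have hL0 : 0 < L := by linarith
  have htb : TotallyBounded (Metric.ball (0 : E) L) :=
    (isCompact_closedBall (0 : E) L).totallyBounded.subset Metric.ball_subset_closedBall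
  -- One net in the model ball, independent of `x`, is scaled by `s`. Its mesh `1 / (2 * L)` becomes
  -- `s / 2` after the chart inverse multiplies by at most `L`.
  obtain ⟨t, htB, htfin, hcov⟩ := Metric.finite_approx_of_totallyBounded htb (1 / (2 * L))
    (by positivity)
  refine ⟨htfin.toFinset, fun x ↦ ?_⟩
  obtain ⟨Ψ, hΨ⟩ := hch x
  have hmem : ∀ u ∈ Metric.ball (0 : E) L, Ψ x + s • u ∈ Metric.ball (Ψ x) (L * s) := by
    intro u hu
    rw [mem_ball_zero_iff] at hu
    rw [mem_ball_iff_norm, add_sub_cancel_left, norm_smul, Real.norm_of_nonneg hs0.le, mul_comm]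
    exact mul_lt_mul_of_pos_right hu hs0
  refine ⟨fun v ↦ Ψ.symm (Ψ x + s • v), fun v hv ↦ ?_, fun y hy ↦ ?_⟩
  · have := hΨ.symm_mem_distBall hL hs (hmem v (htB (htfin.mem_toFinset.1 hv)))
    rwa [← mul_assoc] at this
  · obtain ⟨hy1, hy2⟩ := hΨ.mem_of_mem_distBall hL hs hy
    set u : E := s⁻¹ • (Ψ y - Ψ x) with hu
    have hyu : Ψ y = Ψ x + s • u := by
      rw [hu, smul_inv_smul₀ hs0.ne']
      abel
    have huB : u ∈ Metric.ball (0 : E) L := by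
      rw [mem_ball_zero_iff, hu, norm_smul, norm_inv, Real.norm_of_nonneg hs0.le,
        inv_mul_lt_iff₀ hs0, mul_comm]
      exact mem_ball_iff_norm.1 hy2
    obtain ⟨v, hv, huv⟩ := mem_iUnion₂.1 (hcov huB)
    refine ⟨v, htfin.mem_toFinset.2 hv, ?_⟩
    have h1 := hΨ.dist_le _ (Metric.ball_subset_ball hs (hmem v (htB hv))) _
      (Metric.ball_subset_ball hs hy2)
    rw [Ψ.left_inv hy1] at h1
    refine h1.trans_lt ?_
    rw [hyu, add_sub_add_left_eq_sub, ← smul_sub, norm_smul, Real.norm_of_nonneg hs0.le]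
    rw [mem_ball_iff_norm', lt_div_iff₀ (by positivity)] at huv
    nlinarith

/-- Enlarging the radius by `s / 2` amounts to taking a fixed number of balls. -/
lemma distBall_subset_iUnion_of_net (hd : IsLengthDist d) {s : ℝ} (hs0 : 0 < s) {V : Finset E}
    {x : X} {z : E → X} (hnet : ∀ y, d x y < s → ∃ v ∈ V, d (z v) y < s / 2) {t : ℝ}
    (ht : s / 2 < t) : distBall d x (t + s / 2) ⊆ ⋃ v ∈ V, distBall d (z v) t := by
  intro y hy
  have hy' : d x y < t + s / 2 := hy
  -- Stop at `p`, within `s` of `x`, on a nearly shortest way to `y`. The net point close to `p`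
  -- loses `s / 2`, which the radius `t - s / 2` has reserved.
  obtain ⟨p, hp1, hp2⟩ := hd.exists_between x y s (t - s / 2) hs0 (by linarith) (by linarith)
  obtain ⟨v, hv, hvp⟩ := hnet p hp1
  refine mem_iUnion₂.2 ⟨v, hv, ?_⟩
  have : d (z v) y ≤ d (z v) p + d p y := hd.triangle _ _ _
  exact this.trans_lt (by linarith)

/-- Each growth of the radius by `s / 2` multiplies the bound by the cardinality of the net,
starting from a ball inside a chart. -/
lemma exists_measure_distBall_le (hd : IsLengthDist d) (hL : 1 ≤ L) (hC : C ≠ ⊤)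
    (hch : ∀ x, ∃ Ψ : OpenPartialHomeomorph X E, IsUniformChart d μ ν L ρ C x Ψ) {s : ℝ}
    (hs0 : 0 < s) (hs : L * s ≤ ρ) (j : ℕ) :
    ∃ N : ℝ≥0∞, N ≠ ⊤ ∧ ∀ x, μ (distBall d x (s + j * (s / 2))) ≤ N := by
  obtain ⟨V, hV⟩ := exists_uniform_net hL hch hs0 hs
  induction j with
  | zero =>
    refine ⟨C * ν (Metric.ball 0 (L * s)), ENNReal.mul_ne_top hC measure_ball_lt_top.ne,
      fun x ↦ ?_⟩
    obtain ⟨Ψ, hΨ⟩ := hch x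
    simpa using hΨ.measure_distBall_le hd hL hs
  | succ j ih =>
    obtain ⟨N, hN, hNx⟩ := ih
    refine ⟨V.card * N, ENNReal.mul_ne_top (by simp) hN, fun x ↦ ?_⟩
    obtain ⟨z, -, hz⟩ := hV x
    have hpos : 0 ≤ (j : ℝ) * (s / 2) := by positivity
    have hcov := distBall_subset_iUnion_of_net hd hs0 hz
      (show s / 2 < s + j * (s / 2) by linarith)
    have heq : s + ((j + 1 : ℕ) : ℝ) * (s / 2) = s + j * (s / 2) + s / 2 := by push_cast; ring
    rw [heq]
    calc μ (distBall d x (s + j * (s / 2) + s / 2))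
        ≤ μ (⋃ v ∈ V, distBall d (z v) (s + j * (s / 2))) := measure_mono hcov
      _ ≤ ∑ v ∈ V, μ (distBall d (z v) (s + j * (s / 2))) := measure_biUnion_finset_le _ _
      _ ≤ ∑ v ∈ V, N := Finset.sum_le_sum fun v _ ↦ hNx _
      _ = V.card * N := by simp

lemma exists_measure_distBall_le' (hd : IsLengthDist d) (hL : 1 ≤ L) (hρ : 0 < ρ) (hC : C ≠ ⊤)
    (hch : ∀ x, ∃ Ψ : OpenPartialHomeomorph X E, IsUniformChart d μ ν L ρ C x Ψ) (R : ℝ) :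
    ∃ N : ℝ≥0∞, N ≠ ⊤ ∧ ∀ x, ∀ r ≤ R, μ (distBall d x r) ≤ N := by
  have hL0 : 0 < L := by linarith
  set s := ρ / L
  have hs0 : 0 < s := by positivity
  obtain ⟨j, hj⟩ := exists_nat_ge (R / (s / 2))
  obtain ⟨N, hN, hNx⟩ := exists_measure_distBall_le hd hL hC hch hs0
    (mul_div_cancel₀ _ hL0.ne').le j
  refine ⟨N, hN, fun x r hr ↦ (measure_mono fun y hy ↦ ?_).trans (hNx x)⟩
  have hy' : d x y < r := hy
  rw [div_le_iff₀ (by positivity)] at hj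
  have : d x y < s + j * (s / 2) := by linarith
  exact this

/-- A lower bound for the measure of balls of a given radius. -/
lemma exists_le_measure_distBall (hd : IsLengthDist d) (hL : 1 ≤ L) (hρ : 0 < ρ) (hC : C ≠ ⊤)
    (hch : ∀ x, ∃ Ψ : OpenPartialHomeomorph X E, IsUniformChart d μ ν L ρ C x Ψ) {r : ℝ}
    (hr : 0 < r) : ∃ m : ℝ≥0∞, m ≠ 0 ∧ m ≠ ⊤ ∧ ∀ x, ∀ t, r ≤ t → m ≤ μ (distBall d x t) := by
  have hL0 : 0 < L := by linarith
  set t := min (r / L) ρ with ht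
  have ht0 : 0 < t := by positivity
  have hpos : 0 < ν (Metric.ball 0 t) := Metric.measure_ball_pos ν _ ht0
  have hfin : ν (Metric.ball (0 : E) t) ≠ ⊤ := measure_ball_lt_top.ne
  -- If `X` is nonempty, `C` cannot vanish, since a Euclidean ball has positive measure; this is
  -- needed to divide by `C`.
  by_cases hC0 : C = 0
  · by_cases hX : Nonempty X
    · obtain ⟨x⟩ := hX
      obtain ⟨Ψ, hΨ⟩ := hch x
      have := hΨ.measure_ball_le hd hL (min_le_right (r / L) ρ)
      rw [hC0, zero_mul] at this
      exact absurd this (not_le.2 hpos)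
    · exact ⟨1, one_ne_zero, ENNReal.one_ne_top, fun x ↦ (hX ⟨x⟩).elim⟩
  refine ⟨ν (Metric.ball 0 t) / C, (ENNReal.div_pos hpos.ne' hC).ne',
    ENNReal.div_ne_top hfin hC0, fun x t' ht' ↦ ?_⟩
  obtain ⟨Ψ, hΨ⟩ := hch x
  refine (ENNReal.div_le_of_le_mul' (hΨ.measure_ball_le hd hL (min_le_right (r / L) ρ))).trans ?_
  refine measure_mono fun y hy ↦ ?_
  have hy' : d x y < L * t := hy
  have : L * t ≤ r := by
    rw [← le_div_iff₀' hL0]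
    exact min_le_left _ _
  exact hy'.trans_le (this.trans ht')

/-- Local doubling. -/
lemma exists_measure_distBall_mul_le (hd : IsLengthDist d) (hL : 1 ≤ L) (hρ : 0 < ρ) (hC : C ≠ ⊤)
    (hch : ∀ x, ∃ Ψ : OpenPartialHomeomorph X E, IsUniformChart d μ ν L ρ C x Ψ)
    {Λ : ℝ} (hΛ : 1 ≤ Λ) (R : ℝ) :
    ∃ A : ℝ≥0∞, A ≠ ⊤ ∧ ∀ x r, 0 < r → r ≤ R →
      μ (distBall d x (Λ * r)) ≤ A * μ (distBall d x r) := by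
  have hL0 : 0 < L := by linarith
  have hΛ0 : 0 < Λ := by linarith
  -- Below `r₁` the enlarged ball fits in a chart and Euclidean scaling applies; above it the ratio
  -- of the uniform upper and lower bounds suffices.
  set r₁ := ρ / (L * Λ) with hr₁
  have hr₁0 : 0 < r₁ := by positivity
  obtain ⟨N, hN, hNx⟩ := exists_measure_distBall_le' hd hL hρ hC hch (Λ * R)
  obtain ⟨m, hm0, hmt, hm⟩ := exists_le_measure_distBall hd hL hρ hC hch hr₁0
  set k := Module.finrank ℝ E
  refine ⟨N / m + C * ENNReal.ofReal ((L * Λ * L) ^ k) * C, ?_, fun x r hr0 hrR ↦ ?_⟩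
  · exact ENNReal.add_ne_top.2 ⟨ENNReal.div_ne_top hN hm0,
      ENNReal.mul_ne_top (ENNReal.mul_ne_top hC ENNReal.ofReal_ne_top) hC⟩
  rcases le_total r₁ r with h | h
  · calc μ (distBall d x (Λ * r)) ≤ N := hNx x _ (by gcongr)
      _ = N / m * m := (ENNReal.div_mul_cancel hm0 hmt).symm
      _ ≤ N / m * μ (distBall d x r) := by gcongr; exact hm x r h
      _ ≤ _ := by gcongr; exact le_self_add
  · obtain ⟨Ψ, hΨ⟩ := hch x
    have hr : L * (Λ * r) ≤ ρ := by
      rw [hr₁, le_div_iff₀ (by positivity)] at h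
      linarith
    have hrL : r / L ≤ ρ := by
      rw [div_le_iff₀ hL0]
      have h1 : r ≤ L * (Λ * r) := by
        have : 1 * 1 ≤ L * Λ := mul_le_mul hL hΛ zero_le_one hL0.le
        nlinarith
      nlinarith
    have h2 := hΨ.measure_ball_le hd hL hrL
    rw [mul_div_cancel₀ _ hL0.ne'] at h2
    have h3 : ν (Metric.ball 0 (L * (Λ * r))) =
        ENNReal.ofReal ((L * Λ * L) ^ k) * ν (Metric.ball 0 (r / L)) := by
      have : L * (Λ * r) = (L * Λ * L) * (r / L) := by field_simp
      rw [this, Measure.addHaar_ball_mul_of_pos ν _ (by positivity)]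
    calc μ (distBall d x (Λ * r)) ≤ C * ν (Metric.ball 0 (L * (Λ * r))) :=
          hΨ.measure_distBall_le hd hL hr
      _ ≤ C * (ENNReal.ofReal ((L * Λ * L) ^ k) * (C * μ (distBall d x r))) := by
          rw [h3]; gcongr
      _ = C * ENNReal.ofReal ((L * Λ * L) ^ k) * C * μ (distBall d x r) := by ring
      _ ≤ _ := by gcongr; exact le_add_self

/-- The medium scale Poincaré inequality, by induction on the scale. -/
lemma exists_lintegral_enorm_sub_le_of_net (hd : IsLengthDist d) (hL : 1 ≤ L) (hC : C ≠ ⊤)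
    (hch : ∀ x, ∃ Ψ : OpenPartialHomeomorph X E, IsUniformChart d μ ν L ρ C x Ψ) {s : ℝ}
    (hs0 : 0 < s) (hs : L * ((L * L + 1) * s) ≤ ρ) {A : ℝ≥0∞} (hA : A ≠ ⊤) (j : ℕ) :
    ∃ B : ℝ≥0∞, B ≠ ⊤ ∧ ∀ (f : X → ℝ) (a : X → ℝ) (G : X → ℝ≥0∞), Measurable f →
      (∀ x, ∫⁻ y in distBall d x ((L * L + 1) * s), ‖f y - a x‖ₑ ∂μ ≤
        A * ∫⁻ y in distBall d x (L * L * ((L * L + 1) * s)), G y ∂μ) →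
      ∀ x, ∫⁻ y in distBall d x ((L * L + 1) * s + j * (s / 2)), ‖f y - a x‖ₑ ∂μ ≤
        B * ∫⁻ y in distBall d x (L * L * ((L * L + 1) * s) + j * (L * L * s)), G y ∂μ := by
  have hL0 : 0 < L := by linarith
  have hLL : 1 ≤ L * L := by nlinarith
  have hsτ : s ≤ (L * L + 1) * s := by nlinarith
  have hsρ : L * s ≤ ρ := (mul_le_mul_of_nonneg_left hsτ hL0.le).trans hs
  have hρ : 0 < ρ := (mul_pos hL0 hs0).trans_le hsρ
  obtain ⟨V, hV⟩ := exists_uniform_net hL hch hs0 hsρ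
  obtain ⟨m, hm0, hmt, hm⟩ := exists_le_measure_distBall hd hL hρ hC hch hs0
  -- With this base radius, the base ball of `x` contains the `s`-ball around every net point, whose
  -- distance from `x` is below `L * L * s`.
  set τs := (L * L + 1) * s with hτs
  have hτs0 : 0 < τs := by positivity
  induction j with
  | zero => exact ⟨A, hA, fun f a G _ h x ↦ by simpa using h x⟩
  | succ j ih =>
    obtain ⟨B, hB, hBx⟩ := ih
    obtain ⟨N, hN, hNx⟩ := exists_measure_distBall_le' hd hL hρ hC hch (τs + j * (s / 2))
    refine ⟨V.card * (B + N * (2 * A / m)), ENNReal.mul_ne_top (by simp) (ENNReal.add_ne_top.2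
      ⟨hB, ENNReal.mul_ne_top hN (ENNReal.div_ne_top (ENNReal.mul_ne_top (by simp) hA) hm0)⟩),
      fun f a G hf h x ↦ ?_⟩
    obtain ⟨z, hz1, hz⟩ := hV x
    have hpos : 0 ≤ (j : ℝ) * (s / 2) := by positivity
    have hpos' : 0 ≤ (j : ℝ) * (L * L * s) := by positivity
    have hcov := distBall_subset_iUnion_of_net hd hs0 hz (show s / 2 < τs + j * (s / 2) by linarith)
    have heq : τs + ((j + 1 : ℕ) : ℝ) * (s / 2) = τs + j * (s / 2) + s / 2 := by push_cast; ring
    have heq' : L * L * τs + ((j + 1 : ℕ) : ℝ) * (L * L * s) =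
      L * L * s + (L * L * τs + j * (L * L * s)) := by push_cast; ring
    rw [heq, heq']
    set I := ∫⁻ y in distBall d x (L * L * s + (L * L * τs + j * (L * L * s))), G y ∂μ with hI
    have hIv : ∀ v ∈ V, ∀ t ≤ L * L * τs + j * (L * L * s),
        ∫⁻ y in distBall d (z v) t, G y ∂μ ≤ I := fun v hv t ht ↦
      lintegral_mono_set (hd.distBall_subset (by linarith [hz1 v hv]))
    have hIx : ∫⁻ y in distBall d x (L * L * τs), G y ∂μ ≤ I := by
      refine lintegral_mono_set (hd.distBall_subset ?_)
      rw [hd.self]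
      have : 0 < L * L * s := by positivity
      linarith
    -- Both constants approximate `f` on the `s`-ball around `z v`, whose measure is at least `m`;
    -- the triangle inequality integrated over it bounds their difference.
    have hav : ∀ v ∈ V, ‖a (z v) - a x‖ₑ ≤ 2 * A / m * I := by
      intro v hv
      have h1 : m * ‖a (z v) - a x‖ₑ ≤ 2 * A * I := by
        calc m * ‖a (z v) - a x‖ₑ
            ≤ μ (distBall d (z v) s) * ‖a (z v) - a x‖ₑ := by gcongr; exact hm _ _ le_rfl
          _ = ∫⁻ y in distBall d (z v) s, ‖a (z v) - a x‖ₑ ∂μ := by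
              rw [setLIntegral_const, mul_comm]
          _ ≤ ∫⁻ y in distBall d (z v) s, (‖f y - a (z v)‖ₑ + ‖f y - a x‖ₑ) ∂μ := by
              refine lintegral_mono fun y ↦ ?_
              have : a (z v) - a x = (f y - a x) - (f y - a (z v)) := by ring
              rw [this, add_comm]
              exact enorm_sub_le
          _ = ∫⁻ y in distBall d (z v) s, ‖f y - a (z v)‖ₑ ∂μ +
                ∫⁻ y in distBall d (z v) s, ‖f y - a x‖ₑ ∂μ :=
              lintegral_add_left (hf.sub measurable_const).enorm _
          _ ≤ ∫⁻ y in distBall d (z v) τs, ‖f y - a (z v)‖ₑ ∂μ +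
                ∫⁻ y in distBall d x τs, ‖f y - a x‖ₑ ∂μ := by
              refine add_le_add (lintegral_mono_set (hd.distBall_subset ?_))
                (lintegral_mono_set (hd.distBall_subset ?_))
              · rw [hd.self]; linarith
              · have := hz1 v hv
                rw [hτs]; linarith
          _ ≤ A * I + A * I := by
              refine add_le_add ((h _).trans ?_) ((h _).trans ?_)
              · refine mul_le_mul' le_rfl (hIv v hv _ (by linarith))
              · exact mul_le_mul' le_rfl hIx
          _ = 2 * A * I := by ring
      have h2 : ‖a (z v) - a x‖ₑ ≤ 2 * A * I / m :=
        (ENNReal.le_div_iff_mul_le (Or.inl hm0) (Or.inl hmt)).2 (by rwa [mul_comm])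
      rwa [ENNReal.mul_div_right_comm] at h2
    calc ∫⁻ y in distBall d x (τs + j * (s / 2) + s / 2), ‖f y - a x‖ₑ ∂μ
        ≤ ∫⁻ y in ⋃ v ∈ V, distBall d (z v) (τs + j * (s / 2)), ‖f y - a x‖ₑ ∂μ :=
          lintegral_mono_set hcov
      _ ≤ ∑ v ∈ V, ∫⁻ y in distBall d (z v) (τs + j * (s / 2)), ‖f y - a x‖ₑ ∂μ :=
          setLIntegral_biUnion_finset_le μ V _ _
      _ ≤ ∑ v ∈ V, (B + N * (2 * A / m)) * I := by
          refine Finset.sum_le_sum fun v hv ↦ ?_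
          calc ∫⁻ y in distBall d (z v) (τs + j * (s / 2)), ‖f y - a x‖ₑ ∂μ
              ≤ ∫⁻ y in distBall d (z v) (τs + j * (s / 2)),
                  (‖f y - a (z v)‖ₑ + ‖a (z v) - a x‖ₑ) ∂μ := by
                refine lintegral_mono fun y ↦ ?_
                have : f y - a x = (f y - a (z v)) + (a (z v) - a x) := by ring
                rw [this]
                exact enorm_add_le _ _
            _ = ∫⁻ y in distBall d (z v) (τs + j * (s / 2)), ‖f y - a (z v)‖ₑ ∂μ +
                  ‖a (z v) - a x‖ₑ * μ (distBall d (z v) (τs + j * (s / 2))) := by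
                rw [lintegral_add_right _ measurable_const, setLIntegral_const]
            _ ≤ B * I + 2 * A / m * I * N := by
                refine add_le_add ((hBx f a G hf h _).trans ?_)
                  (mul_le_mul' (hav v hv) (hNx _ _ le_rfl))
                exact mul_le_mul' le_rfl (hIv v hv _ le_rfl)
            _ = _ := by ring
      _ = _ := by simp [mul_assoc]

/-- The `(1,1)`-Poincaré inequality at all bounded scales. -/
lemma exists_lintegral_enorm_sub_le_of_le (hd : IsLengthDist d) (hL : 1 ≤ L) (hρ : 0 < ρ)
    (hC : C ≠ ⊤) (hch : ∀ x, ∃ Ψ : OpenPartialHomeomorph X E, IsUniformChart d μ ν L ρ C x Ψ)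
    (R : ℝ) :
    ∃ A : ℝ≥0∞, A ≠ ⊤ ∧ ∀ x r, 0 < r → r ≤ R → ∀ f : X → ℝ, IsLipschitzFor d f → ∃ a : ℝ,
      ∫⁻ y in distBall d x r, ‖f y - a‖ₑ ∂μ ≤ A * ENNReal.ofReal r *
        ∫⁻ y in distBall d x (3 * (L * L) * r), ENNReal.ofReal (localLip d f y) ∂μ := by
  have hL0 : 0 < L := by linarith
  have hLL : 1 ≤ L * L := by nlinarith
  set s := ρ / (L * (L * L + 1)) with hs
  have hs0 : 0 < s := by positivity
  set τs := (L * L + 1) * s with hτs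
  have hsτ : s ≤ τs := by nlinarith
  have hτs0 : 0 < τs := hs0.trans_le hsτ
  have hsρ : L * τs = ρ := by rw [hτs, hs]; field_simp
  set A₀ : ℝ≥0∞ := C * C * ENNReal.ofReal (2 * L * L) * 2 ^ Module.finrank ℝ E with hA₀
  have hA₀t : A₀ ≠ ⊤ := by finiteness
  choose B hBt hB using exists_lintegral_enorm_sub_le_of_net hd hL hC hch hs0 hsρ.le
    (ENNReal.mul_ne_top hA₀t (ENNReal.ofReal_ne_top (r := τs)))
  -- At most `J` enlargements are needed for `r ≤ R`, so the sum of the `B j` dominates each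
  -- constant used. Dividing it by `τs` produces the factor `r` in the range `r ≥ τs`.
  set J := ⌈R / (s / 2)⌉₊ with hJ
  refine ⟨A₀ + (∑ j ∈ Finset.range (J + 1), B j) / ENNReal.ofReal τs,
    ENNReal.add_ne_top.2 ⟨hA₀t, ENNReal.div_ne_top ((ENNReal.sum_ne_top).2 fun j _ ↦ hBt j)
      (by simpa using hτs0)⟩, fun x r hr0 hrR f hf ↦ ?_⟩
  have hfm : Measurable f := (hd.continuous_of_isLipschitzFor hf).measurable
  rcases le_total r τs with h | h
  · obtain ⟨Ψ, hΨ⟩ := hch x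
    obtain ⟨a, ha⟩ := hΨ.exists_lintegral_enorm_sub_le hd hL hr0
      ((mul_le_mul_of_nonneg_left h hL0.le).trans_eq hsρ) hf
    refine ⟨a, ha.trans ?_⟩
    refine mul_le_mul' (mul_le_mul' le_self_add le_rfl) (lintegral_mono_set (hd.distBall_subset ?_))
    rw [hd.self]
    nlinarith
  · have hbase : ∀ x, ∃ a : ℝ, ∫⁻ y in distBall d x τs, ‖f y - a‖ₑ ∂μ ≤
        A₀ * ENNReal.ofReal τs *
          ∫⁻ y in distBall d x (L * L * τs), ENNReal.ofReal (localLip d f y) ∂μ := fun x ↦ by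
      obtain ⟨Ψ, hΨ⟩ := hch x
      exact hΨ.exists_lintegral_enorm_sub_le hd hL hτs0 hsρ.le hf
    choose a ha using hbase
    set j := ⌈(r - τs) / (s / 2)⌉₊ with hj
    have hj1 : (r - τs) / (s / 2) ≤ j := Nat.le_ceil _
    have hj2 : (j : ℝ) < (r - τs) / (s / 2) + 1 :=
      Nat.ceil_lt_add_one (div_nonneg (by linarith) (by positivity))
    have hjJ : j ≤ J := Nat.ceil_le_ceil (by gcongr; linarith)
    rw [div_le_iff₀ (by positivity)] at hj1
    have hj3 : (j : ℝ) * (s / 2) < r - τs + s / 2 := by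
      have := mul_lt_mul_of_pos_right hj2 (show 0 < s / 2 by positivity)
      rwa [add_mul, div_mul_cancel₀ _ (by positivity), one_mul] at this
    refine ⟨a x, ?_⟩
    calc ∫⁻ y in distBall d x r, ‖f y - a x‖ₑ ∂μ
        ≤ ∫⁻ y in distBall d x (τs + j * (s / 2)), ‖f y - a x‖ₑ ∂μ :=
          lintegral_mono_set (hd.distBall_subset (by rw [hd.self]; linarith))
      _ ≤ B j * ∫⁻ y in distBall d x (L * L * τs + j * (L * L * s)),
            ENNReal.ofReal (localLip d f y) ∂μ := hB j f a _ hfm ha x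
      _ ≤ (∑ j ∈ Finset.range (J + 1), B j) * ∫⁻ y in distBall d x (3 * (L * L) * r),
            ENNReal.ofReal (localLip d f y) ∂μ := by
          refine mul_le_mul' (Finset.single_le_sum (f := B) (fun _ _ ↦ zero_le)
            (Finset.mem_range.2 (Nat.lt_succ_of_le hjJ)))
            (lintegral_mono_set (hd.distBall_subset ?_))
          rw [hd.self]
          -- The radius on the left grows by `s / 2` per step and, up to the factor `L * L`, the one
          -- on the right by `s`; hence `j * s` is about `2 * (r - τs)`.
          have h1 : τs + j * s ≤ 3 * r := by linarith
          calc 0 + (L * L * τs + j * (L * L * s)) = L * L * (τs + j * s) := by ring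
            _ ≤ L * L * (3 * r) := by gcongr
            _ = _ := by ring
      _ ≤ _ := by
          refine mul_le_mul' ?_ le_rfl
          have h1 : ENNReal.ofReal τs ≠ 0 := by simpa using hτs0
          calc ∑ j ∈ Finset.range (J + 1), B j
              = (∑ j ∈ Finset.range (J + 1), B j) / ENNReal.ofReal τs * ENNReal.ofReal τs :=
                (ENNReal.div_mul_cancel h1 ENNReal.ofReal_ne_top).symm
            _ ≤ _ := by
                gcongr
                exact le_add_self

/-- Uniform charts imply the local `(1,2)`-Poincaré inequality. -/
theorem localPoincare12_of_uniformChart (hd : IsLengthDist d) (hL : 1 ≤ L) (hρ : 0 < ρ)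
    (hC : C ≠ ⊤) (hch : ∀ x, ∃ Ψ : OpenPartialHomeomorph X E, IsUniformChart d μ ν L ρ C x Ψ) :
    LocalPoincare12 d μ := by
  have hLL : 1 ≤ L * L := by nlinarith
  set Λ := 3 * (L * L) with hΛ
  have hΛ1 : 1 < Λ := by linarith
  choose A hAt hA using exists_lintegral_enorm_sub_le_of_le hd hL hρ hC hch
  choose D hDt hD using exists_measure_distBall_mul_le hd hL hρ hC hch hΛ1.le
  refine ⟨Λ, hΛ1, fun R ↦ 2 * (A R).toReal * (D R).toReal + 1, fun R _ ↦ by positivity,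
    fun R hR x r hr hrR ↦ ?_⟩
  have hB0 : 0 < μ (distBall d x r) := by
    obtain ⟨m, hm0, -, hm⟩ := exists_le_measure_distBall hd hL hρ hC hch hr
    exact (pos_iff_ne_zero.2 hm0).trans_le (hm x r le_rfl)
  have hΛB : μ (distBall d x (Λ * r)) < ⊤ := by
    obtain ⟨N, hN, hNx⟩ := exists_measure_distBall_le' hd hL hρ hC hch (Λ * r)
    exact (hNx x _ le_rfl).trans_lt hN.lt_top
  have hsub : distBall d x r ⊆ distBall d x (Λ * r) :=
    hd.distBall_subset (by rw [hd.self]; nlinarith)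
  have hB : μ (distBall d x r) < ⊤ := (measure_mono hsub).trans_lt hΛB
  refine ⟨⟨hB0, hΛB⟩, fun f hf ↦ ?_⟩
  have hfc := hd.continuous_of_isLipschitzFor hf
  obtain ⟨K, hK0, hK⟩ := hd.exists_lipschitz_const hf
  have hBm : MeasurableSet (distBall d x r) := (hd.isOpen_distBall x r).measurableSet
  have hΛBm : MeasurableSet (distBall d x (Λ * r)) := (hd.isOpen_distBall x _).measurableSet
  have hlipm := hd.measurable_localLip hf
  have hlip0 := hd.localLip_nonneg f
  have hlipK := hd.localLip_le hK0 hK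
  have hfi : IntegrableOn f (distBall d x r) μ := by
    refine Measure.integrableOn_of_bounded hB.ne hfc.aestronglyMeasurable (M := |f x| + K * r) ?_
    refine (ae_restrict_iff' hBm).2 (ae_of_all _ fun y hy ↦ ?_)
    have hy' : d x y < r := hy
    have h1 := hK y x
    rw [hd.symm] at h1
    have h2 : K * d x y ≤ K * r := by gcongr
    have h3 : |f y| ≤ |f y - f x| + |f x| := by
      simpa using abs_add_le (f y - f x) (f x)
    rw [Real.norm_eq_abs]
    linarith
  have hl2 : IntegrableOn (fun y ↦ localLip d f y ^ 2) (distBall d x (Λ * r)) μ := by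
    refine Measure.integrableOn_of_bounded hΛB.ne (hlipm.pow_const 2).aestronglyMeasurable
      (M := K ^ 2) (ae_of_all _ fun y ↦ ?_)
    rw [Real.norm_of_nonneg (sq_nonneg _)]
    exact pow_le_pow_left₀ (hlip0 y) (hlipK y) 2
  have hl1 : IntegrableOn (localLip d f) (distBall d x (Λ * r)) μ := by
    refine Measure.integrableOn_of_bounded hΛB.ne hlipm.aestronglyMeasurable
      (M := K) (ae_of_all _ fun y ↦ ?_)
    rw [Real.norm_of_nonneg (hlip0 y)]
    exact hlipK y
  refine ⟨hfi, hl2, ?_⟩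
  obtain ⟨a, ha⟩ := hA R x r hr hrR f hf
  set B := distBall d x r
  set B' := distBall d x (Λ * r)
  set b := μ.real B with hb
  have hb0 : 0 < b := ENNReal.toReal_pos hB0.ne' hB.ne
  have hB'0 : 0 < μ B' := hB0.trans_le (measure_mono hsub)
  have : IsFiniteMeasure (μ.restrict B) := ⟨by simpa using hB⟩
  have : NeZero (μ.restrict B) := ⟨by simpa using hB0.ne'⟩
  have hfa : IntegrableOn (fun y ↦ f y - a) B μ := hfi.sub (integrable_const a)
  -- replacing the mean value by another constant
  have h1 : ⨍ y in B, |f y - ⨍ z in B, f z ∂μ| ∂μ ≤ 2 * ⨍ y in B, |f y - a| ∂μ := by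
    have hmean : |a - ⨍ z in B, f z ∂μ| ≤ ⨍ y in B, |f y - a| ∂μ := by
      have : a - ⨍ z in B, f z ∂μ = - ⨍ z in B, (f z - a) ∂μ := by
        rw [setAverage_eq, setAverage_eq, integral_sub hfi (integrable_const a), setIntegral_const]
        simp only [smul_eq_mul]
        rw [← hb]
        field_simp
        ring
      rw [this, abs_neg, setAverage_eq, setAverage_eq, smul_eq_mul, smul_eq_mul, abs_mul,
        abs_of_nonneg (by positivity)]
      gcongr
      exact abs_integral_le_integral_abs
    have hle : ∀ c : ℝ, ⨍ y in B, |f y - c| ∂μ ≤ ⨍ y in B, (|f y - a| + |a - c|) ∂μ := by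
      intro c
      rw [setAverage_eq, setAverage_eq, smul_eq_mul, smul_eq_mul]
      refine mul_le_mul_of_nonneg_left ?_ (inv_nonneg.2 hb0.le)
      exact integral_mono (hfi.sub (integrable_const _)).abs (hfa.abs.add (integrable_const _))
        fun y ↦ abs_sub_le _ _ _
    refine (hle _).trans ?_
    rw [setAverage_eq, integral_add hfa.abs (integrable_const _), setIntegral_const, smul_add,
      ← setAverage_eq, smul_smul, inv_mul_cancel₀ hb0.ne', one_smul]
    linarith
  have h2 : ∫ y in B, |f y - a| ∂μ ≤ (A R).toReal * r * ∫ y in B', localLip d f y ∂μ := by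
    rw [integral_eq_lintegral_of_nonneg_ae (ae_of_all _ fun _ ↦ abs_nonneg _)
      hfa.abs.aestronglyMeasurable,
      integral_eq_lintegral_of_nonneg_ae (ae_of_all _ hlip0) hl1.aestronglyMeasurable]
    have hfin : ∫⁻ y in B', ENNReal.ofReal (localLip d f y) ∂μ ≠ ⊤ := by
      have := hl1.lintegral_lt_top
      exact this.ne
    rw [← ENNReal.toReal_ofReal hr.le, ← ENNReal.toReal_mul, ← ENNReal.toReal_mul]
    refine ENNReal.toReal_mono (ENNReal.mul_ne_top (ENNReal.mul_ne_top (hAt R)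
      ENNReal.ofReal_ne_top) hfin) ((lintegral_mono fun y ↦ ?_).trans ha)
    rw [← Real.norm_eq_abs, ofReal_norm]
  -- Doubling replaces the normalisation by the small ball with that by the large one.
  have h3 : μ.real B' ≤ (D R).toReal * b := by
    rw [hb, measureReal_def, measureReal_def, ← ENNReal.toReal_mul]
    exact ENNReal.toReal_mono (ENNReal.mul_ne_top (hDt R) hB.ne) (hD R x r hr hrR)
  have hb'0 : 0 < μ.real B' := ENNReal.toReal_pos hB'0.ne' hΛB.ne
  -- Jensen's inequality for the square, the passage from exponent one to exponent two.
  have h4 : ⨍ y in B', localLip d f y ∂μ ≤ √(⨍ y in B', localLip d f y ^ 2 ∂μ) := by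
    refine Real.le_sqrt_of_sq_le ?_
    exact (even_two.convexOn_pow (𝕜 := ℝ)).map_set_average_le (continuous_pow 2).continuousOn
      isClosed_univ hB'0.ne' hΛB.ne (ae_of_all _ fun _ ↦ mem_univ _) hl1 hl2
  set q := √(⨍ y in B', localLip d f y ^ 2 ∂μ) with hq
  have hq0 : 0 ≤ q := Real.sqrt_nonneg _
  have h5 : ∫ y in B', localLip d f y ∂μ = μ.real B' * ⨍ y in B', localLip d f y ∂μ := by
    rw [setAverage_eq, smul_eq_mul, mul_inv_cancel_left₀ hb'0.ne']
  have h6 : ⨍ y in B, |f y - a| ∂μ ≤ (A R).toReal * r * ((D R).toReal * q) := by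
    rw [setAverage_eq, smul_eq_mul, inv_mul_le_iff₀ hb0]
    calc ∫ y in B, |f y - a| ∂μ ≤ (A R).toReal * r * (μ.real B' * q) := by
          refine h2.trans ?_
          rw [h5]
          gcongr
      _ ≤ (A R).toReal * r * ((D R).toReal * b * q) := by gcongr
      _ = _ := by ring
  calc _ ≤ 2 * ((A R).toReal * r * ((D R).toReal * q)) := h1.trans (by gcongr)
    _ = (2 * (A R).toReal * (D R).toReal) * r * q := by ring
    _ ≤ (2 * (A R).toReal * (D R).toReal + 1) * r * q := by gcongr; linarith

end UniformAtlas

/-! ### Lengths of paths and the Riemannian distance on an open part -/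

section Paths

open Manifold

variable {n : ℕ} {X : Type*} [TopologicalSpace X] [ChartedSpace (Cn n) X]

/-- The length of a path between the times `a` and `b`. -/
def gLengthOn (g : BilinField n X) (γ : ℝ → X) (a b : ℝ) : ℝ≥0∞ :=
  ∫⁻ t in Icc a b, ENNReal.ofReal (√(g (γ t) (pathVelocity γ t) (pathVelocity γ t)))

/-- The (extended) norms on the tangent spaces that are associated with a metric. -/
@[reducible] def metricENorm (g : BilinField n X) (x : X) : ENorm (TangentSpace 𝓘(ℝ, Cn n) x) :=
  ⟨fun v ↦ ENNReal.ofReal (√(g x v v))⟩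

/-- Homogeneity follows from bilinearity alone, whatever the values of `g` on `D`, and it is what
reparametrisation of paths requires. -/
lemma metricENorm_smulClass (g : BilinField n X) (x : X) :
    letI := metricENorm g x
    ENormSMulClass ℝ (TangentSpace 𝓘(ℝ, Cn n) x) := by
  let := metricENorm g x
  have key : ∀ (c : ℝ) (v : Cn n), ENNReal.ofReal (√(g x (c • v) (c • v))) =
      ‖c‖ₑ * ENNReal.ofReal (√(g x v v)) := fun c v ↦ by
    have h : g x (c • v) (c • v) = c ^ 2 * g x v v := by
      rw [map_smul, map_smul, smul_apply, smul_eq_mul, smul_eq_mul]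
      ring
    rw [h, Real.sqrt_mul (sq_nonneg c), Real.sqrt_sq_eq_abs, ENNReal.ofReal_mul (abs_nonneg c),
      ← Real.norm_eq_abs, ofReal_norm]
  exact ⟨fun c v ↦ key c v⟩

variable {g : BilinField n X} {γ γ' : ℝ → X} {a b c : ℝ}

lemma gLengthOn_eq_pathELength :
    letI := metricENorm g
    gLengthOn g γ a b = pathELength 𝓘(ℝ, Cn n) γ a b := by
  let := metricENorm g
  rw [pathELength_eq_lintegral_mfderiv_Icc]
  rfl

lemma gLengthOn_congr (h : EqOn γ γ' (Icc a b)) : gLengthOn g γ a b = gLengthOn g γ' a b := by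
  let := metricENorm g
  rw [gLengthOn_eq_pathELength, gLengthOn_eq_pathELength]
  exact pathELength_congr h

lemma gLengthOn_add (h : a ≤ b) (h' : b ≤ c) :
    gLengthOn g γ a b + gLengthOn g γ b c = gLengthOn g γ a c := by
  let := metricENorm g
  simp only [gLengthOn_eq_pathELength]
  exact pathELength_add h h'

lemma gLengthOn_comp_of_monotoneOn {f : ℝ → ℝ} (h : a ≤ b) (hf : MonotoneOn f (Icc a b))
    (h'f : DifferentiableOn ℝ f (Icc a b))
    (hγ : MDifferentiableOn 𝓘(ℝ, ℝ) 𝓘(ℝ, Cn n) γ (Icc (f a) (f b))) :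
    gLengthOn g (γ ∘ f) a b = gLengthOn g γ (f a) (f b) := by
  let := metricENorm g
  have : ∀ x : X, ENormSMulClass ℝ (TangentSpace 𝓘(ℝ, Cn n) x) := metricENorm_smulClass g
  simp only [gLengthOn_eq_pathELength]
  exact pathELength_comp_of_monotoneOn h hf h'f hγ

lemma gLengthOn_comp_of_antitoneOn {f : ℝ → ℝ} (h : a ≤ b) (hf : AntitoneOn f (Icc a b))
    (h'f : DifferentiableOn ℝ f (Icc a b))
    (hγ : MDifferentiableOn 𝓘(ℝ, ℝ) 𝓘(ℝ, Cn n) γ (Icc (f b) (f a))) :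
    gLengthOn g (γ ∘ f) a b = gLengthOn g γ (f b) (f a) := by
  let := metricENorm g
  have : ∀ x : X, ENormSMulClass ℝ (TangentSpace 𝓘(ℝ, Cn n) x) := metricENorm_smulClass g
  simp only [gLengthOn_eq_pathELength]
  exact pathELength_comp_of_antitoneOn h hf h'f hγ

variable {U : Set X} {x y z : X} {r : ℝ≥0∞}

lemma riemannianEDistOn_le_gLengthOn (hab : a ≤ b)
    (hγ : ContMDiffOn 𝓘(ℝ, ℝ) 𝓘(ℝ, Cn n) 1 γ (Icc a b)) (hU : MapsTo γ (Icc a b) U) :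
    riemannianEDistOn g U (γ a) (γ b) ≤ gLengthOn g γ a b := by
  let η : ℝ → ℝ := fun t ↦ a + t * (b - a)
  have hη : ContDiff ℝ 1 η := by fun_prop
  have h0 : η 0 = a := by simp [η]
  have h1 : η 1 = b := by simp [η]
  have hmono : Monotone η := fun s t hst ↦ by
    have : s * (b - a) ≤ t * (b - a) := mul_le_mul_of_nonneg_right hst (by linarith)
    simp only [η]
    linarith
  have hmaps : MapsTo η (Icc 0 1) (Icc a b) := fun t ht ↦
    ⟨h0 ▸ hmono ht.1, h1 ▸ hmono ht.2⟩
  have hlen : gLength g (γ ∘ η) = gLengthOn g γ a b := by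
    change gLengthOn g (γ ∘ η) 0 1 = _
    rw [gLengthOn_comp_of_monotoneOn zero_le_one (hmono.monotoneOn _)
      (hη.differentiable one_ne_zero).differentiableOn, h0, h1]
    rw [h0, h1]
    exact hγ.mdifferentiableOn one_ne_zero
  rw [← hlen]
  refine iInf₂_le (γ ∘ η) ⟨hγ.comp (contMDiff_iff_contDiff.2 hη).contMDiffOn hmaps,
    hU.comp hmaps, ?_, ?_⟩
  · simp [h0]
  · simp [h1]

lemma exists_path_of_riemannianEDistOn_lt (h : riemannianEDistOn g U x y < r) :
    ∃ γ : ℝ → X, ContMDiffOn 𝓘(ℝ, ℝ) 𝓘(ℝ, Cn n) 1 γ (Icc 0 1) ∧ MapsTo γ (Icc 0 1) U ∧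
      γ 0 = x ∧ γ 1 = y ∧ gLengthOn g γ 0 1 < r := by
  simp only [riemannianEDistOn, iInf_lt_iff, exists_prop] at h
  obtain ⟨γ, ⟨h1, h2, h3, h4⟩, h5⟩ := h
  exact ⟨γ, h1, h2, h3, h4, h5⟩

/-- Short paths can be chosen to be constant near the endpoints. -/
lemma exists_locally_constant_path_of_riemannianEDistOn_lt (hr : riemannianEDistOn g U x y < r)
    (hab : a < b) :
    ∃ γ : ℝ → X, γ a = x ∧ γ b = y ∧ ContMDiff 𝓘(ℝ, ℝ) 𝓘(ℝ, Cn n) 1 γ ∧ (∀ t, γ t ∈ U) ∧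
      gLengthOn g γ a b < r ∧ γ =ᶠ[𝓝 a] (fun _ ↦ x) ∧ γ =ᶠ[𝓝 b] (fun _ ↦ y) := by
  obtain ⟨γ, γ_smooth, γU, hγx, hγy, hγ⟩ := exists_path_of_riemannianEDistOn_lt hr
  rcases exists_between hab with ⟨a', haa', ha'b⟩
  rcases exists_between ha'b with ⟨b', ha'b', hb'b⟩
  -- A smooth monotone time change, stationary before `a'` and after `b'`, leaves the length
  -- unchanged.
  let η (t : ℝ) : ℝ := Real.smoothTransition ((b' - a')⁻¹ * (t - a'))
  have A (t) (ht : t < a') : η t = 0 := by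
    simp only [η, Real.smoothTransition.zero_iff_nonpos]
    apply mul_nonpos_of_nonneg_of_nonpos
    · simpa using ha'b'.le
    · linarith
  have A' (t) (ht : t < a') : (γ ∘ η) t = x := by simp [A t ht, hγx]
  have B (t) (ht : b' < t) : η t = 1 := by
    simp only [η, Real.smoothTransition.eq_one_iff_one_le, inv_mul_eq_div]
    rw [one_le_div₀] <;> linarith
  have B' (t) (ht : b' < t) : (γ ∘ η) t = y := by simp [B t ht, hγy]
  have hη01 : ∀ t, η t ∈ Icc (0 : ℝ) 1 := fun t ↦
    ⟨Real.smoothTransition.nonneg _, Real.smoothTransition.le_one _⟩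
  refine ⟨γ ∘ η, A' _ haa', B' _ hb'b, ?_, fun t ↦ γU (hη01 t), ?_, ?_, ?_⟩
  · rw [← contMDiffOn_univ]
    apply γ_smooth.comp
    · rw [contMDiffOn_univ, contMDiff_iff_contDiff]
      fun_prop
    · exact fun t _ ↦ hη01 t
  · convert! hγ using 1
    rw [← A a haa', ← B b hb'b]
    apply gLengthOn_comp_of_monotoneOn hab.le
    · apply Monotone.monotoneOn
      apply Real.smoothTransition.monotone.comp
      intro t u htu
      dsimp only
      gcongr
    · simp only [η]
      apply (ContDiff.contDiffOn _).differentiableOn one_ne_zero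
      fun_prop
    · rw [A a haa', B b hb'b]
      apply γ_smooth.mdifferentiableOn one_ne_zero
  · filter_upwards [Iio_mem_nhds haa'] with t ht using A' t ht
  · filter_upwards [Ioi_mem_nhds hb'b] with t ht using B' t ht

lemma riemannianEDistOn_self (hx : x ∈ U) : riemannianEDistOn g U x x = 0 := by
  refine le_antisymm ?_ zero_le
  have := riemannianEDistOn_le_gLengthOn (g := g) (U := U) (γ := fun _ : ℝ ↦ x) (le_refl (0 : ℝ))
    contMDiffOn_const fun _ _ ↦ hx
  exact this.trans_eq (by simp [gLengthOn])

lemma riemannianEDistOn_comm : riemannianEDistOn g U x y = riemannianEDistOn g U y x := by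
  suffices H : ∀ x y, riemannianEDistOn g U y x ≤ riemannianEDistOn g U x y from
    le_antisymm (H y x) (H x y)
  intro x y
  apply le_of_forall_gt (fun r hr ↦ ?_)
  rcases exists_locally_constant_path_of_riemannianEDistOn_lt hr zero_lt_one
    with ⟨γ, γ0, γ1, γ_smooth, γU, hγ, -⟩
  let η : ℝ → ℝ := fun t ↦ 1 - t
  have h_smooth : ContMDiff 𝓘(ℝ, ℝ) 𝓘(ℝ, Cn n) 1 (γ ∘ η) := by
    apply γ_smooth.comp ?_
    simp only [contMDiff_iff_contDiff]
    fun_prop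
  have h1 : gLengthOn g (γ ∘ η) 0 1 = gLengthOn g γ 0 1 := by
    rw [gLengthOn_comp_of_antitoneOn zero_le_one]
    · simp [η]
    · intro s _ t _ hst
      simp only [η]
      linarith
    · fun_prop
    · exact γ_smooth.contMDiffOn.mdifferentiableOn one_ne_zero
  have := riemannianEDistOn_le_gLengthOn (g := g) (U := U) zero_le_one
    (h_smooth.contMDiffOn (s := Icc 0 1)) fun t _ ↦ γU _
  simp only [Function.comp, η, sub_zero, sub_self, γ0, γ1] at this
  refine (this.trans_eq ?_).trans_lt hγ
  exact h1

/-- Concatenation is `C¹` at the junction because both paths can be taken constant there. -/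
lemma riemannianEDistOn_triangle :
    riemannianEDistOn g U x z ≤ riemannianEDistOn g U x y + riemannianEDistOn g U y z := by
  apply le_of_forall_gt (fun r hr ↦ ?_)
  rcases ENNReal.exists_add_lt_of_add_lt hr with ⟨u, hu, v, hv, huv⟩
  rcases exists_locally_constant_path_of_riemannianEDistOn_lt hu zero_lt_one with
    ⟨γ₁, hγ₁0, hγ₁1, hγ₁_smooth, hγ₁U, hγ₁, -, hγ₁_const⟩
  rcases exists_locally_constant_path_of_riemannianEDistOn_lt hv one_lt_two with
    ⟨γ₂, hγ₂1, hγ₂2, hγ₂_smooth, hγ₂U, hγ₂, hγ₂_const, -⟩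
  let γ := piecewise (Iic 1) γ₁ γ₂
  have hγU : ∀ t, γ t ∈ U := fun t ↦ by
    by_cases ht : t ∈ Iic (1 : ℝ)
    · simpa [γ, piecewise_eq_of_mem _ _ _ ht] using hγ₁U t
    · simpa [γ, piecewise_eq_of_notMem _ _ _ ht] using hγ₂U t
  have h0 : γ 0 = x := by simp [γ, hγ₁0]
  have h2 : γ 2 = z := by simp [γ, hγ₂2]
  have : riemannianEDistOn g U (γ 0) (γ 2) ≤ gLengthOn g γ 0 2 := by
    apply riemannianEDistOn_le_gLengthOn zero_le_two
    · apply ContMDiff.contMDiffOn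
      exact ContMDiff.piecewise_Iic hγ₁_smooth hγ₂_smooth (hγ₁_const.trans hγ₂_const.symm)
    · exact fun t _ ↦ hγU t
  rw [h0, h2] at this
  apply this.trans_lt (lt_trans ?_ huv)
  rw [← gLengthOn_add zero_le_one one_le_two]
  gcongr
  · convert! hγ₁ using 1
    apply gLengthOn_congr
    intro t ht
    simp [γ, ht.2]
  · convert! hγ₂ using 1
    apply gLengthOn_congr
    intro t ht
    rcases ht.1.eq_or_lt with rfl | h
    · simp [γ, hγ₁1, hγ₂1]
    · simp [γ, not_le.2 h]

/-- The points of a short path split its length. -/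
lemma exists_path_add_lt_of_riemannianEDistOn_lt (h : riemannianEDistOn g U x y < r) :
    ∃ γ : ℝ → X, ContinuousOn γ (Icc 0 1) ∧ MapsTo γ (Icc 0 1) U ∧ γ 0 = x ∧ γ 1 = y ∧
      ∀ t ∈ Icc (0 : ℝ) 1, riemannianEDistOn g U x (γ t) + riemannianEDistOn g U (γ t) y < r := by
  obtain ⟨γ, h1, h2, rfl, rfl, h5⟩ := exists_path_of_riemannianEDistOn_lt h
  refine ⟨γ, h1.continuousOn, h2, rfl, rfl, fun t ht ↦ lt_of_le_of_lt ?_ h5⟩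
  rw [← gLengthOn_add ht.1 ht.2]
  have hs1 : Icc 0 t ⊆ Icc 0 1 := Icc_subset_Icc le_rfl ht.2
  have hs2 : Icc t 1 ⊆ Icc 0 1 := Icc_subset_Icc ht.1 le_rfl
  exact add_le_add
    (riemannianEDistOn_le_gLengthOn ht.1 (h1.mono hs1) (h2.mono hs1 Subset.rfl))
    (riemannianEDistOn_le_gLengthOn ht.2 (h1.mono hs2) (h2.mono hs2 Subset.rfl))

end Paths

/-! ### Distances in a chart where the metric is uniformly flat off coordinate hyperplanes -/

section ConeChart

variable {n : ℕ} {X : Type*} [TopologicalSpace X] [ChartedSpace (Cn n) X]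

/-- A chart, smooth outside of `D`, in which the metric is uniformly equivalent to the flat one,
and where `D` is a union of coordinate hyperplanes. -/
structure IsConeChart (g : BilinField n X) (D : Set X) (L : ℝ)
    (Ψ : OpenPartialHomeomorph X (Cn n)) : Prop where
  contMDiffOn : ContMDiffOn 𝓘(ℝ, Cn n) 𝓘(ℝ, Cn n) 1 Ψ (Ψ.source ∩ Dᶜ)
  contMDiffOn_symm : ContMDiffOn 𝓘(ℝ, Cn n) 𝓘(ℝ, Cn n) 1 Ψ.symm (Ψ.target ∩ Ψ.symm ⁻¹' Dᶜ)
  le_pullback : ∀ w ∈ Ψ.target, Ψ.symm w ∉ D → ∀ v : Cn n,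
    ‖v‖ ^ 2 ≤ L ^ 2 * pullbackMetric g Ψ.symm w v v
  pullback_le : ∀ w ∈ Ψ.target, Ψ.symm w ∉ D → ∀ v : Cn n,
    pullbackMetric g Ψ.symm w v v ≤ L ^ 2 * ‖v‖ ^ 2
  divisor : ∃ J : Set (Fin n), ∀ w ∈ Ψ.target, Ψ.symm w ∈ D ↔ ∃ j ∈ J, w j = 0

variable {g : BilinField n X} {D : Set X} {L : ℝ} {Ψ : OpenPartialHomeomorph X (Cn n)}

lemma pathVelocity_comp {F : Cn n → X} {c : ℝ → Cn n} {t : ℝ}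
    (hF : MDifferentiableAt 𝓘(ℝ, Cn n) 𝓘(ℝ, Cn n) F (c t)) (hc : DifferentiableAt ℝ c t) :
    pathVelocity (F ∘ c) t = realDifferential F (c t) (deriv c t) := by
  have h := mfderiv_comp t hF hc.mdifferentiableAt
  rw [pathVelocity, h, mfderiv_eq_fderiv]
  rfl

lemma pullbackMetric_apply (F : Cn n → X) (z v w : Cn n) :
    pullbackMetric g F z v w = g (F z) (realDifferential F z v) (realDifferential F z w) := rfl

namespace IsConeChart

lemma mono (h : IsConeChart g D L Ψ) (hL : 0 < L) {L' : ℝ} (hLL : L ≤ L') :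
    IsConeChart g D L' Ψ where
  contMDiffOn := h.contMDiffOn
  contMDiffOn_symm := h.contMDiffOn_symm
  le_pullback w hw hwD v := by
    have h1 := h.le_pullback w hw hwD v
    have h2 : 0 ≤ pullbackMetric g Ψ.symm w v v := by
      have := (sq_nonneg ‖v‖).trans h1
      exact nonneg_of_mul_nonneg_right this (by positivity)
    exact h1.trans (by gcongr)
  pullback_le w hw hwD v := (h.pullback_le w hw hwD v).trans (by gcongr)
  divisor := h.divisor

lemma isOpen_good (hD : IsClosed D) : IsOpen (Ψ.target ∩ Ψ.symm ⁻¹' Dᶜ) :=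
  Ψ.isOpen_inter_preimage_symm hD.isOpen_compl

lemma mdifferentiableAt_symm (h : IsConeChart g D L Ψ) (hD : IsClosed D) {w : Cn n}
    (hw : w ∈ Ψ.target) (hwD : Ψ.symm w ∉ D) :
    MDifferentiableAt 𝓘(ℝ, Cn n) 𝓘(ℝ, Cn n) Ψ.symm w :=
  (h.contMDiffOn_symm.contMDiffAt ((isOpen_good hD).mem_nhds ⟨hw, hwD⟩)).mdifferentiableAt
    one_ne_zero

/-- The hyperplanes can be avoided by paths whose length is comparable to the distance of their
endpoints. -/
lemma exists_quadratic_path (w w' : Cn n) :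
    ∃ ξ : Cn n, ‖ξ‖ ≤ ‖w - w'‖ ∧ ∀ j, w j ≠ 0 → w' j ≠ 0 → ∀ t ∈ Icc (0 : ℝ) 1,
      ((1 - t) • w + t • w' + (t * (1 - t)) • ξ) j ≠ 0 := by
  classical
  -- A coordinate is bent only when its straight segment would meet zero, that is when `w' j = -s *
  -- w j` with `s ≥ 0`. The bend `I * w j` is orthogonal to the segment, and `|w j| ≤ (1 + s) |w j|
  -- = |w j - w' j|` controls its size.
  let ξ : Cn n := WithLp.toLp 2 fun j ↦
    if ∃ s : ℝ, 0 ≤ s ∧ w' j = -(s : ℂ) * w j then Complex.I * w j else 0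
  have hξ : ∀ j, ξ j = if ∃ s : ℝ, 0 ≤ s ∧ w' j = -(s : ℂ) * w j then Complex.I * w j else 0 :=
    fun j ↦ rfl
  refine ⟨ξ, ?_, fun j hj hj' t ht h0 ↦ ?_⟩
  · rw [EuclideanSpace.norm_eq, EuclideanSpace.norm_eq]
    refine Real.sqrt_le_sqrt (Finset.sum_le_sum fun j _ ↦ ?_)
    refine pow_le_pow_left₀ (norm_nonneg _) ?_ 2
    rw [hξ]
    split_ifs with h
    · obtain ⟨s, hs, h⟩ := h
      have : (w - w') j = (1 + s : ℝ) * w j := by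
        rw [PiLp.sub_apply, h]; push_cast; ring
      rw [this, norm_mul, norm_mul, Complex.norm_I, Complex.norm_real,
        Real.norm_of_nonneg (by positivity)]
      nlinarith [norm_nonneg (w j)]
    · simp
  · simp only [PiLp.add_apply, PiLp.smul_apply, Complex.real_smul, hξ] at h0
    split_ifs at h0 with h
    · obtain ⟨s, hs, h⟩ := h
      rw [h] at h0
      have h1 : (((1 - t - t * s : ℝ) : ℂ) + ((t * (1 - t) : ℝ) : ℂ) * Complex.I) * w j = 0 := by
        rw [← h0]; push_cast; ring
      -- The imaginary part `t * (1 - t)` vanishes only at the ends, where the real part excludes a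
      -- zero.
      rcases mul_eq_zero.1 h1 with h2 | h2
      · have hre := congrArg Complex.re h2
        have him := congrArg Complex.im h2
        simp only [Complex.add_re, Complex.add_im, Complex.ofReal_re, Complex.ofReal_im,
          Complex.mul_re, Complex.mul_im, Complex.I_re, Complex.I_im, Complex.zero_re,
          Complex.zero_im] at hre him
        rcases mul_eq_zero.1 (show t * (1 - t) = 0 by linarith) with ht0 | ht1
        · rw [ht0] at hre; norm_num at hre
        · have ht1' : t = 1 := by linarith
          rw [ht1'] at hre
          have hs0 : s = 0 := by linarith
          exact hj' (by rw [h, hs0]; simp)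
      · exact hj h2
    · rcases ht.1.eq_or_lt with ht0 | ht0
      · rw [← ht0] at h0
        simp at h0
        exact hj h0
      · refine h ⟨(1 - t) / t, div_nonneg (by linarith [ht.2]) ht0.le, ?_⟩
        have htc : (t : ℂ) ≠ 0 := by exact_mod_cast ht0.ne'
        push_cast at h0 ⊢
        field_simp
        linear_combination h0

/-- The quadratic path avoids `D`, has Euclidean speed at most `2 * ‖w - w'‖`, and the metric is
bounded above along it. -/
lemma riemannianEDistOn_symm_le (h : IsConeChart g D L Ψ) (hD : IsClosed D) (hL : 0 < L)
    {p : Cn n} {ρ : ℝ} (hρ : Metric.ball p (5 * ρ) ⊆ Ψ.target) {w w' : Cn n}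
    (hw : w ∈ Metric.ball p ρ) (hw' : w' ∈ Metric.ball p ρ) (hwD : Ψ.symm w ∉ D)
    (hwD' : Ψ.symm w' ∉ D) :
    riemannianEDistOn g Dᶜ (Ψ.symm w) (Ψ.symm w') ≤ ENNReal.ofReal (2 * L * ‖w - w'‖) := by
  obtain ⟨J, hJ⟩ := h.divisor
  have hρ0 : 0 < ρ := dist_nonneg.trans_lt (Metric.mem_ball.1 hw)
  have hsub : Metric.ball p ρ ⊆ Metric.ball p (5 * ρ) := Metric.ball_subset_ball (by linarith)
  obtain ⟨ξ, hξ, hne⟩ := exists_quadratic_path w w'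
  set c : ℝ → Cn n := fun t ↦ (1 - t) • w + t • w' + (t * (1 - t)) • ξ with hc
  have hww : ‖w - w'‖ < 2 * ρ := by
    rw [← dist_eq_norm]
    have := Metric.mem_ball.1 hw
    have := Metric.mem_ball.1 hw'
    linarith [dist_triangle_right w w' p]
  -- The start is within `ρ` of `p`, and the linear and the bending term contribute less than `2 *
  -- ρ` each; hence `5 * ρ`.
  have hcT : ∀ t ∈ Icc (0 : ℝ) 1, c t ∈ Ψ.target := fun t ht ↦ by
    refine hρ (mem_ball_iff_norm.2 ?_)
    have h1 : c t - p = (w - p) + (t • (w' - w) + (t * (1 - t)) • ξ) := by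
      simp only [hc]; module
    have ht1 : 0 ≤ 1 - t := by linarith [ht.2]
    have h2 : ‖t • (w' - w)‖ ≤ ‖w - w'‖ := by
      rw [norm_smul, Real.norm_of_nonneg ht.1, norm_sub_rev]
      exact mul_le_of_le_one_left (norm_nonneg _) ht.2
    have h3 : ‖(t * (1 - t)) • ξ‖ ≤ ‖w - w'‖ := by
      rw [norm_smul, Real.norm_of_nonneg (mul_nonneg ht.1 ht1)]
      refine (mul_le_of_le_one_left (norm_nonneg _) ?_).trans hξ
      nlinarith [ht.1, ht.2]
    rw [h1]
    have h4 := mem_ball_iff_norm.1 hw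
    calc _ ≤ ‖w - p‖ + (‖t • (w' - w)‖ + ‖(t * (1 - t)) • ξ‖) :=
          (norm_add_le _ _).trans (add_le_add le_rfl (norm_add_le _ _))
      _ < 5 * ρ := by linarith
  have hcD : ∀ t ∈ Icc (0 : ℝ) 1, Ψ.symm (c t) ∉ D := fun t ht ↦ by
    rw [hJ _ (hcT t ht)]
    rintro ⟨j, hj, h0⟩
    refine hne j (fun h ↦ hwD ((hJ w (hρ (hsub hw))).2 ⟨j, hj, h⟩))
      (fun h ↦ hwD' ((hJ w' (hρ (hsub hw'))).2 ⟨j, hj, h⟩)) t ht h0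
  have hcs : ContDiff ℝ 1 c := by fun_prop
  have hmaps : MapsTo c (Icc 0 1) (Ψ.target ∩ Ψ.symm ⁻¹' Dᶜ) := fun t ht ↦ ⟨hcT t ht, hcD t ht⟩
  have hderiv : ∀ t : ℝ, deriv c t = (w' - w) + (1 - 2 * t) • ξ := fun t ↦ by
    have h1 : HasDerivAt c ((-1 : ℝ) • w + (1 : ℝ) • w' + (1 * (1 - t) + t * (-1)) • ξ) t := by
      refine (HasDerivAt.add ?_ ?_).add ?_
      · exact ((hasDerivAt_id t).const_sub 1).smul_const w
      · exact (hasDerivAt_id t).smul_const w'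
      · exact ((hasDerivAt_id t).mul ((hasDerivAt_id t).const_sub 1)).smul_const ξ
    rw [h1.deriv]
    module
  have hnorm : ∀ t ∈ Icc (0 : ℝ) 1, ‖deriv c t‖ ≤ 2 * ‖w - w'‖ := fun t ht ↦ by
    rw [hderiv]
    refine (norm_add_le _ _).trans ?_
    rw [norm_smul, norm_sub_rev]
    have : ‖1 - 2 * t‖ ≤ 1 := by
      rw [Real.norm_eq_abs, abs_le]
      constructor <;> linarith [ht.1, ht.2]
    nlinarith [norm_nonneg ξ]
  have h0 : c 0 = w := by simp [hc]
  have h1 : c 1 = w' := by simp [hc]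
  have key := riemannianEDistOn_le_gLengthOn (g := g) (U := Dᶜ) zero_le_one
    (h.contMDiffOn_symm.comp (contMDiff_iff_contDiff.2 hcs).contMDiffOn hmaps)
    (fun t ht ↦ hcD t ht)
  simp only [Function.comp, h0, h1] at key
  refine key.trans ?_
  calc gLengthOn g (Ψ.symm ∘ c) 0 1 ≤ ∫⁻ _ in Icc (0 : ℝ) 1, ENNReal.ofReal (2 * L * ‖w - w'‖) := by
        refine setLIntegral_mono' measurableSet_Icc fun t ht ↦ ENNReal.ofReal_le_ofReal ?_
        rw [pathVelocity_comp (h.mdifferentiableAt_symm hD (hcT t ht) (hcD t ht))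
          (hcs.differentiable one_ne_zero t)]
        refine Real.sqrt_le_iff.2 ⟨by positivity, ?_⟩
        refine (h.pullback_le (c t) (hcT t ht) (hcD t ht) (deriv c t)).trans ?_
        rw [show (2 * L * ‖w - w'‖) ^ 2 = L ^ 2 * (2 * ‖w - w'‖) ^ 2 by ring]
        gcongr
        exact hnorm t ht
    _ = _ := by simp

/-- The lower bound on the metric makes the Euclidean length of the image curve at most `L` times
the `g`-length. -/
lemma enorm_sub_le_gLengthOn (h : IsConeChart g D L Ψ) (hD : IsClosed D) (hL : 0 < L)
    {γ : ℝ → X} {t₁ : ℝ} (ht₁ : 0 ≤ t₁)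
    (hγ : ContMDiffOn 𝓘(ℝ, ℝ) 𝓘(ℝ, Cn n) 1 γ (Icc 0 t₁)) (hγD : MapsTo γ (Icc 0 t₁) Dᶜ)
    (hγs : MapsTo γ (Icc 0 t₁) Ψ.source) :
    ‖Ψ (γ t₁) - Ψ (γ 0)‖ₑ ≤ ENNReal.ofReal L * gLengthOn g γ 0 t₁ := by
  set c : ℝ → Cn n := Ψ ∘ γ with hc
  have hcs : ContDiffOn ℝ 1 c (Icc 0 t₁) := by
    rw [← contMDiffOn_iff_contDiffOn]
    exact h.contMDiffOn.comp hγ fun t ht ↦ ⟨hγs ht, hγD ht⟩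
  refine (enorm_sub_le_lintegral_deriv_of_contDiffOn_Icc hcs ht₁).trans ?_
  rw [gLengthOn, ← lintegral_const_mul' _ _ ENNReal.ofReal_ne_top, ← restrict_Ioo_eq_restrict_Icc]
  refine setLIntegral_mono' measurableSet_Ioo fun t ht ↦ ?_
  have hn : Icc 0 t₁ ∈ 𝓝 t := Icc_mem_nhds ht.1 ht.2
  have hmem := Ioo_subset_Icc_self ht
  have hcT : c t ∈ Ψ.target := Ψ.map_source (hγs hmem)
  have hcγ : Ψ.symm (c t) = γ t := Ψ.left_inv (hγs hmem)
  have hcD : Ψ.symm (c t) ∉ D := by rw [hcγ]; exact hγD hmem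
  have heq : Ψ.symm ∘ c =ᶠ[𝓝 t] γ := by
    filter_upwards [hn] with s hs using Ψ.left_inv (hγs hs)
  have hvel : pathVelocity γ t = realDifferential Ψ.symm (c t) (deriv c t) := by
    rw [← pathVelocity_comp (h.mdifferentiableAt_symm hD hcT hcD)
      ((hcs.contDiffAt hn).differentiableAt one_ne_zero)]
    unfold pathVelocity
    rw [heq.mfderiv_eq]
    rfl
  have hle := h.le_pullback (c t) hcT hcD (deriv c t)
  rw [pullbackMetric_apply, hcγ, ← hvel] at hle
  rw [← ofReal_norm, ← ENNReal.ofReal_mul hL.le]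
  refine ENNReal.ofReal_le_ofReal ?_
  rw [← Real.sqrt_sq hL.le, ← Real.sqrt_mul (sq_nonneg L)]
  exact Real.le_sqrt_of_sq_le hle

/-- A path which is shorter than the size of the chart does not leave it. -/
lemma mem_source_of_gLengthOn_lt [T2Space X] (h : IsConeChart g D L Ψ) (hD : IsClosed D)
    (hL : 0 < L) {γ : ℝ → X} (hγ : ContMDiffOn 𝓘(ℝ, ℝ) 𝓘(ℝ, Cn n) 1 γ (Icc 0 1))
    (hγD : MapsTo γ (Icc 0 1) Dᶜ) {ρ r : ℝ} (h0 : γ 0 ∈ Ψ.source)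
    (hρ : Metric.ball (Ψ (γ 0)) ρ ⊆ Ψ.target) (hlen : gLengthOn g γ 0 1 < ENNReal.ofReal r)
    (hr : L * r ≤ ρ) : γ 1 ∈ Ψ.source ∧ ‖Ψ (γ 1) - Ψ (γ 0)‖ ≤ L * r := by
  have hr0 : 0 < r := ENNReal.ofReal_pos.1 (bot_le.trans_lt hlen)
  set ℓ : ℝ := (gLengthOn g γ 0 1).toReal with hℓ
  have hℓ0 : 0 ≤ ℓ := ENNReal.toReal_nonneg
  have hℓr : ℓ < r := (ENNReal.lt_ofReal_iff_toReal_lt hlen.ne_top).1 hlen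
  have hLℓ : L * ℓ < ρ := (mul_lt_mul_of_pos_left hℓr hL).trans_le hr
  have hest : ∀ t ∈ Icc (0 : ℝ) 1, MapsTo γ (Icc 0 t) Ψ.source → ‖Ψ (γ t) - Ψ (γ 0)‖ ≤ L * ℓ := by
    intro t ht hmaps
    have hs : Icc 0 t ⊆ Icc 0 1 := Icc_subset_Icc le_rfl ht.2
    have h1 := h.enorm_sub_le_gLengthOn hD hL ht.1 (hγ.mono hs) (hγD.mono hs Subset.rfl) hmaps
    have h2 : gLengthOn g γ 0 t ≤ gLengthOn g γ 0 1 := lintegral_mono_set hs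
    have h3 := h1.trans (mul_le_mul' le_rfl h2)
    rwa [← ENNReal.ofReal_toReal hlen.ne_top, ← ENNReal.ofReal_mul hL.le, ← ofReal_norm,
      ENNReal.ofReal_le_ofReal_iff (by positivity)] at h3
  set V : Set X := Ψ.source ∩ Ψ ⁻¹' Metric.ball (Ψ (γ 0)) ρ with hV
  have hVo : IsOpen V := Ψ.isOpen_inter_preimage Metric.isOpen_ball
  have hstay : MapsTo γ (Icc 0 1) V := by
    by_contra hcon
    -- Consider the first exit time `τ` from the open set `V`.
    set T : Set ℝ := Icc 0 1 ∩ γ ⁻¹' Vᶜ with hT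
    have hTc : IsClosed T := hγ.continuousOn.preimage_isClosed_of_isClosed isClosed_Icc
      hVo.isClosed_compl
    have hTK : IsCompact T := isCompact_Icc.of_isClosed_subset hTc inter_subset_left
    have hTne : T.Nonempty := by
      simp only [MapsTo, not_forall] at hcon
      obtain ⟨t, ht, htV⟩ := hcon
      exact ⟨t, ht, htV⟩
    set τ := sInf T with hτ
    have hτT : τ ∈ T := hTK.sInf_mem hTne
    have hbefore : ∀ s, 0 ≤ s → s < τ → γ s ∈ V := fun s hs0 hsτ ↦ by
      by_contra hsV
      have : s ∈ T := ⟨⟨hs0, hsτ.le.trans hτT.1.2⟩, hsV⟩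
      exact absurd (csInf_le hTK.bddBelow this) (not_le.2 hsτ)
    have hτ0 : 0 < τ := by
      refine hτT.1.1.lt_of_ne fun h0τ ↦ hτT.2 ?_
      rw [← h0τ]
      exact ⟨h0, Metric.mem_ball_self (by nlinarith)⟩
    -- Before `τ` the path remains in `K`. Being compact in a Hausdorff space, `K` is closed, so `γ
    -- τ ∈ K ⊆ V`, a contradiction; the strict inequality `L * ℓ < ρ` gives `K ⊆ V`.
    set K : Set X := Ψ.symm '' Metric.closedBall (Ψ (γ 0)) (L * ℓ) with hK
    have hcb : Metric.closedBall (Ψ (γ 0)) (L * ℓ) ⊆ Metric.ball (Ψ (γ 0)) ρ :=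
      Metric.closedBall_subset_ball hLℓ
    have hKc : IsClosed K := ((isCompact_closedBall _ _).image_of_continuousOn
      (Ψ.continuousOn_symm.mono (hcb.trans hρ))).isClosed
    have hKV : K ⊆ V := by
      rintro _ ⟨w, hw, rfl⟩
      have hwT := hρ (hcb hw)
      refine ⟨Ψ.map_target hwT, ?_⟩
      rw [mem_preimage, Ψ.right_inv hwT]
      exact hcb hw
    have hIco : MapsTo γ (Ico 0 τ) K := fun s hs ↦ by
      have hsV := hbefore s hs.1 hs.2
      refine ⟨Ψ (γ s), ?_, Ψ.left_inv hsV.1⟩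
      rw [mem_closedBall_iff_norm]
      exact hest s ⟨hs.1, hs.2.le.trans hτT.1.2⟩ fun s' hs' ↦
        (hbefore s' hs'.1 (hs'.2.trans_lt hs.2)).1
    have hcw : ContinuousWithinAt γ (Ico 0 τ) τ :=
      (hγ.continuousOn τ hτT.1).mono fun s hs ↦ ⟨hs.1, hs.2.le.trans hτT.1.2⟩
    have hτcl : τ ∈ closure (Ico 0 τ) := by
      rw [closure_Ico hτ0.ne]
      exact ⟨hτ0.le, le_rfl⟩
    have := hcw.mem_closure hτcl hIco
    rw [hKc.closure_eq] at this
    exact hτT.2 (hKV this)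
  have h1 : (1 : ℝ) ∈ Icc (0 : ℝ) 1 := ⟨zero_le_one, le_rfl⟩
  exact ⟨(hstay h1).1, (hest 1 h1 fun s hs ↦ (hstay hs).1).trans (by gcongr)⟩

lemma mem_source_of_riemannianEDistOn_lt [T2Space X] (h : IsConeChart g D L Ψ) (hD : IsClosed D)
    (hL : 0 < L) {x y : X} {ρ r : ℝ} (hx : x ∈ Ψ.source) (hρ : Metric.ball (Ψ x) ρ ⊆ Ψ.target)
    (hlen : riemannianEDistOn g Dᶜ x y < ENNReal.ofReal r) (hr : L * r ≤ ρ) :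
    y ∈ Ψ.source ∧ ‖Ψ y - Ψ x‖ ≤ L * r := by
  obtain ⟨γ, h1, h2, rfl, rfl, h5⟩ := exists_path_of_riemannianEDistOn_lt hlen
  exact h.mem_source_of_gLengthOn_lt hD hL h1 h2 hx hρ h5 hr

end IsConeChart

end ConeChart

/-! ### Continuous extension of the distance across the divisor -/

section ConicalDist

variable {n : ℕ} {X : Type*} [TopologicalSpace X] [ChartedSpace (Cn n) X]

/-- Coordinate hyperplanes are proper real subspaces. Their nullity gives both the density of the
complement of `D` and the vanishing of its measure. -/
lemma ae_forall_coord_ne_zero (n : ℕ) : ∀ᵐ w : Cn n, ∀ j, w j ≠ 0 := by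
  rw [ae_all_iff]
  intro j
  let S : Submodule ℝ (Cn n) :=
    { carrier := {w | w j = 0}
      add_mem' := fun {a b} ha hb ↦ by
        have ha' : a j = 0 := ha
        have hb' : b j = 0 := hb
        simp [ha', hb']
      zero_mem' := by simp
      smul_mem' := fun c a ha ↦ by
        have ha' : a j = 0 := ha
        simp [ha'] }
  have hS : S ≠ ⊤ := fun h ↦ by
    have : (EuclideanSpace.single j 1 : Cn n) ∈ S := h ▸ Submodule.mem_top
    have h1 : (EuclideanSpace.single j 1 : Cn n) j = 0 := this
    simp at h1
  have := Measure.addHaar_submodule (volume : Measure (Cn n)) S hS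
  exact measure_eq_zero_iff_ae_notMem.1 this

variable {g : BilinField n X} {D : Set X} {L ρ : ℝ}

/-- Every point is the centre of a chart of a definite size. -/
def HasUniformConeCharts (g : BilinField n X) (D : Set X) (L ρ : ℝ) : Prop :=
  ∀ x, ∃ Ψ : OpenPartialHomeomorph X (Cn n), IsConeChart g D L Ψ ∧ x ∈ Ψ.source ∧
    Metric.ball (Ψ x) ρ ⊆ Ψ.target

lemma IsConeChart.dense_good {Ψ : OpenPartialHomeomorph X (Cn n)} (h : IsConeChart g D L Ψ) :
    Ψ.target ⊆ closure (Ψ.target ∩ Ψ.symm ⁻¹' Dᶜ) := by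
  obtain ⟨J, hJ⟩ := h.divisor
  have hd : Dense {w : Cn n | ∀ j, w j ≠ 0} := Measure.dense_of_ae (ae_forall_coord_ne_zero n)
  refine (hd.open_subset_closure_inter Ψ.open_target).trans (closure_mono ?_)
  rintro w ⟨hw, hw'⟩
  refine ⟨hw, fun hwD ↦ ?_⟩
  obtain ⟨j, -, hj⟩ := (hJ w hw).1 hwD
  exact hw' j hj

namespace HasUniformConeCharts

variable (hu : HasUniformConeCharts g D L ρ)
include hu

lemma dense_compl : Dense Dᶜ := by
  intro x
  obtain ⟨Ψ, h, hx, -⟩ := hu x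
  have h1 : Ψ x ∈ closure (Ψ.target ∩ Ψ.symm ⁻¹' Dᶜ) := h.dense_good (Ψ.map_source hx)
  have h2 : ContinuousWithinAt Ψ.symm (Ψ.target ∩ Ψ.symm ⁻¹' Dᶜ) (Ψ x) :=
    (Ψ.continuousOn_symm _ (Ψ.map_source hx)).mono inter_subset_left
  have := h2.mem_closure h1 (t := Dᶜ) fun w hw ↦ hw.2
  rwa [Ψ.left_inv hx] at this

/-- Near each point, the distance is Lipschitz for some local coordinates. -/
lemma exists_nhds_edist_le (hD : IsClosed D) (hL : 0 < L) (hρ : 0 < ρ) (p : X) :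
    ∃ (Ψ : OpenPartialHomeomorph X (Cn n)) (V : Set X), p ∈ V ∧ IsOpen V ∧ V ⊆ Ψ.source ∧
      ∀ x ∈ V ∩ Dᶜ, ∀ y ∈ V ∩ Dᶜ,
        riemannianEDistOn g Dᶜ x y ≤ ENNReal.ofReal (2 * L * ‖Ψ x - Ψ y‖) := by
  obtain ⟨Ψ, h, hx, hb⟩ := hu p
  have hb' : Metric.ball (Ψ p) (5 * (ρ / 5)) ⊆ Ψ.target := by
    rwa [mul_div_cancel₀ _ (by norm_num)]
  refine ⟨Ψ, Ψ.source ∩ Ψ ⁻¹' Metric.ball (Ψ p) (ρ / 5),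
    ⟨hx, Metric.mem_ball_self (by positivity)⟩, Ψ.isOpen_inter_preimage Metric.isOpen_ball,
    inter_subset_left, ?_⟩
  rintro x ⟨⟨hxs, hxb⟩, hxD⟩ y ⟨⟨hys, hyb⟩, hyD⟩
  have := h.riemannianEDistOn_symm_le hD hL hb' hxb hyb (by rwa [Ψ.left_inv hxs])
    (by rwa [Ψ.left_inv hys])
  rwa [Ψ.left_inv hxs, Ψ.left_inv hys] at this

/-- The points of `X` near which the distance from `x` is finite off `D` form a clopen set. Points
of `D` are included, so connectedness of `X` itself is enough. -/
lemma edist_lt_top [PreconnectedSpace X] (hD : IsClosed D) (hL : 0 < L) (hρ : 0 < ρ) {x y : X}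
    (hx : x ∈ Dᶜ) (hy : y ∈ Dᶜ) : riemannianEDistOn g Dᶜ x y < ⊤ := by
  set S : Set X := {p | ∃ U ∈ 𝓝 p, ∀ z ∈ U ∩ Dᶜ, riemannianEDistOn g Dᶜ x z < ⊤} with hS
  have hnear : ∀ p, ∃ V : Set X, p ∈ V ∧ IsOpen V ∧ ∀ x ∈ V ∩ Dᶜ, ∀ y ∈ V ∩ Dᶜ,
      riemannianEDistOn g Dᶜ x y < ⊤ := fun p ↦ by
    obtain ⟨Ψ, V, hpV, hVo, -, hV⟩ := hu.exists_nhds_edist_le hD hL hρ p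
    exact ⟨V, hpV, hVo, fun x hx y hy ↦ (hV x hx y hy).trans_lt ENNReal.ofReal_lt_top⟩
  have hopen : IsOpen S := by
    rw [isOpen_iff_mem_nhds]
    rintro p ⟨U, hU, hUS⟩
    filter_upwards [eventually_mem_nhds_iff.2 hU] with q hq
    exact ⟨U, hq, hUS⟩
  have hclosed : IsClosed S := by
    refine isClosed_of_closure_subset fun p hp ↦ ?_
    obtain ⟨V, hpV, hVo, hV⟩ := hnear p
    obtain ⟨q, hqV, U, hU, hUS⟩ := mem_closure_iff_nhds.1 hp V (hVo.mem_nhds hpV)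
    obtain ⟨z, hz⟩ := mem_closure_iff_nhds.1 (hu.dense_compl q) (U ∩ V)
      (inter_mem hU (hVo.mem_nhds hqV))
    refine ⟨V, hVo.mem_nhds hpV, fun z' hz' ↦ ?_⟩
    exact riemannianEDistOn_triangle.trans_lt
      (ENNReal.add_lt_top.2 ⟨hUS z ⟨hz.1.1, hz.2⟩, hV z ⟨hz.1.2, hz.2⟩ z' hz'⟩)
  have hne : S.Nonempty := by
    obtain ⟨V, hpV, hVo, hV⟩ := hnear x
    exact ⟨x, V, hVo.mem_nhds hpV, fun z hz ↦ hV x ⟨hpV, hx⟩ z hz⟩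
  have huniv : S = univ := IsClopen.eq_univ ⟨hclosed, hopen⟩ hne
  obtain ⟨U, hU, hUS⟩ : y ∈ S := huniv ▸ mem_univ y
  exact hUS y ⟨mem_of_mem_nhds hU, hy⟩

section Extension

variable [PreconnectedSpace X] (hD : IsClosed D) (hL : 0 < L) (hρ : 0 < ρ)
include hD hL hρ

lemma exists_tendsto (p : X × X) : ∃ l : ℝ,
    Tendsto (fun p : X × X ↦ (riemannianEDistOn g Dᶜ p.1 p.2).toReal) (𝓝[Dᶜ ×ˢ Dᶜ] p) (𝓝 l) := by
  obtain ⟨p, q⟩ := p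
  have hdense : Dense (Dᶜ ×ˢ Dᶜ) := hu.dense_compl.prod hu.dense_compl
  have hne : (𝓝[Dᶜ ×ˢ Dᶜ] (p, q)).NeBot := mem_closure_iff_nhdsWithin_neBot.1 (hdense _)
  rw [← cauchy_map_iff_exists_tendsto, Metric.cauchy_iff]
  refine ⟨inferInstance, fun ε hε ↦ ?_⟩
  -- Moving each endpoint within a coordinate ball of radius `δ` changes the distance by at most `2
  -- * L * (2 * δ) = 2 / 5 * ε`, so both together cost less than `ε`.
  set δ := ε / (10 * L) with hδ
  have hδ0 : 0 < δ := by positivity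
  have hnear : ∀ p, ∃ V ∈ 𝓝 p, ∀ x ∈ V ∩ Dᶜ, ∀ y ∈ V ∩ Dᶜ,
      (riemannianEDistOn g Dᶜ x y).toReal ≤ 2 * L * (2 * δ) := fun p ↦ by
    obtain ⟨Ψ, V, hpV, hVo, hVs, hV⟩ := hu.exists_nhds_edist_le hD hL hρ p
    refine ⟨V ∩ Ψ ⁻¹' Metric.ball (Ψ p) δ, inter_mem (hVo.mem_nhds hpV)
      ((Ψ.continuousAt (hVs hpV)).preimage_mem_nhds (Metric.ball_mem_nhds _ hδ0)), ?_⟩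
    rintro x ⟨⟨hxV, hxb⟩, hxD⟩ y ⟨⟨hyV, hyb⟩, hyD⟩
    refine ENNReal.toReal_le_of_le_ofReal (by positivity) ((hV x ⟨hxV, hxD⟩ y ⟨hyV, hyD⟩).trans
      (ENNReal.ofReal_le_ofReal ?_))
    have h1 : dist (Ψ x) (Ψ y) ≤ 2 * δ := by
      have := Metric.mem_ball.1 hxb
      have := Metric.mem_ball.1 hyb
      linarith [dist_triangle_right (Ψ x) (Ψ y) (Ψ p)]
    rw [← dist_eq_norm]
    gcongr
  obtain ⟨V, hVn, hV⟩ := hnear p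
  obtain ⟨W, hWn, hW⟩ := hnear q
  refine ⟨_, image_mem_map (inter_mem (nhdsWithin_le_nhds (prod_mem_nhds hVn hWn))
    self_mem_nhdsWithin), ?_⟩
  have key : ∀ x ∈ V ∩ Dᶜ, ∀ x' ∈ V ∩ Dᶜ, ∀ y ∈ W ∩ Dᶜ, ∀ y' ∈ W ∩ Dᶜ,
      (riemannianEDistOn g Dᶜ x y).toReal - (riemannianEDistOn g Dᶜ x' y').toReal < ε := by
    intro x hx x' hx' y hy y' hy'
    have hfin : ∀ {x y : X}, x ∈ Dᶜ → y ∈ Dᶜ → riemannianEDistOn g Dᶜ x y ≠ ⊤ := fun h h' ↦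
      (hu.edist_lt_top hD hL hρ h h').ne
    have h1 : riemannianEDistOn g Dᶜ x y ≤ riemannianEDistOn g Dᶜ x x' +
        (riemannianEDistOn g Dᶜ x' y' + riemannianEDistOn g Dᶜ y' y) :=
      riemannianEDistOn_triangle.trans (add_le_add le_rfl riemannianEDistOn_triangle)
    have h2 := ENNReal.toReal_mono (ENNReal.add_ne_top.2 ⟨hfin hx.2 hx'.2,
      ENNReal.add_ne_top.2 ⟨hfin hx'.2 hy'.2, hfin hy'.2 hy.2⟩⟩) h1
    rw [ENNReal.toReal_add (hfin hx.2 hx'.2) (ENNReal.add_ne_top.2 ⟨hfin hx'.2 hy'.2,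
      hfin hy'.2 hy.2⟩), ENNReal.toReal_add (hfin hx'.2 hy'.2) (hfin hy'.2 hy.2)] at h2
    have h3 := hV x hx x' hx'
    have h4 := hW y' hy' y hy
    have h5 : 2 * L * (2 * δ) = 2 / 5 * ε := by rw [hδ]; field_simp; norm_num
    linarith
  rintro _ ⟨⟨x, y⟩, ⟨⟨hx, hy⟩, hxD, hyD⟩, rfl⟩ _ ⟨⟨x', y'⟩, ⟨⟨hx', hy'⟩, hxD', hyD'⟩, rfl⟩
  rw [Real.dist_eq, abs_lt]
  constructor
  · have := key x' ⟨hx', hxD'⟩ x ⟨hx, hxD⟩ y' ⟨hy', hyD'⟩ y ⟨hy, hyD⟩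
    simp only
    linarith
  · exact key x ⟨hx, hxD⟩ x' ⟨hx', hxD'⟩ y ⟨hy, hyD⟩ y' ⟨hy', hyD'⟩

lemma continuous_conicalDist : Continuous fun p : X × X ↦ conicalDist g D p.1 p.2 :=
  continuous_extendFrom (hu.dense_compl.prod hu.dense_compl) (hu.exists_tendsto hD hL hρ)

/-- The limit is taken within `Dᶜ ×ˢ Dᶜ` and includes the point itself, so at such a point its
existence already forces it to be the value. -/
lemma conicalDist_eq {x y : X} (hx : x ∈ Dᶜ) (hy : y ∈ Dᶜ) :
    conicalDist g D x y = (riemannianEDistOn g Dᶜ x y).toReal := by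
  obtain ⟨l, hl⟩ := hu.exists_tendsto hD hL hρ (x, y)
  have hmem : (x, y) ∈ Dᶜ ×ˢ Dᶜ := ⟨hx, hy⟩
  have h1 : (riemannianEDistOn g Dᶜ x y).toReal = l :=
    tendsto_nhds_unique (tendsto_pure_nhds
      (fun p : X × X ↦ (riemannianEDistOn g Dᶜ p.1 p.2).toReal) (x, y))
      (hl.mono_left (pure_le_nhdsWithin hmem))
  rw [h1]
  exact extendFrom_eq (subset_closure hmem) hl

lemma ofReal_conicalDist {x y : X} (hx : x ∈ Dᶜ) (hy : y ∈ Dᶜ) :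
    ENNReal.ofReal (conicalDist g D x y) = riemannianEDistOn g Dᶜ x y := by
  rw [hu.conicalDist_eq hD hL hρ hx hy, ENNReal.ofReal_toReal (hu.edist_lt_top hD hL hρ hx hy).ne]

/-- The extended distance is a length distance. -/
theorem isLengthDist : IsLengthDist (conicalDist g D) := by
  have hcont := hu.continuous_conicalDist hD hL hρ
  have hdense := hu.dense_compl
  have hc1 : ∀ x, Continuous fun y ↦ conicalDist g D x y := fun x ↦
    hcont.comp (by fun_prop : Continuous fun y ↦ (x, y))
  -- Each of the following identities and inequalities is a closed condition that holds on the dense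
  -- complement of `D`.
  have hself : ∀ x, conicalDist g D x x = 0 := fun x ↦ by
    have hcl : IsClosed {x | conicalDist g D x x = 0} :=
      isClosed_eq (hcont.comp (by fun_prop : Continuous fun x ↦ (x, x))) continuous_const
    refine hcl.closure_subset_iff.2 (fun x hx ↦ ?_) (hdense x)
    have : conicalDist g D x x = 0 := by
      rw [hu.conicalDist_eq hD hL hρ hx hx, riemannianEDistOn_self hx, ENNReal.toReal_zero]
    exact this
  have hsymm : ∀ x y, conicalDist g D x y = conicalDist g D y x := fun x y ↦ by
    have hcl : IsClosed {p : X × X | conicalDist g D p.1 p.2 = conicalDist g D p.2 p.1} :=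
      isClosed_eq hcont (hcont.comp continuous_swap)
    refine hcl.closure_subset_iff.2 (fun p hp ↦ ?_) ((hdense.prod hdense) (x, y))
    have : conicalDist g D p.1 p.2 = conicalDist g D p.2 p.1 := by
      rw [hu.conicalDist_eq hD hL hρ hp.1 hp.2, hu.conicalDist_eq hD hL hρ hp.2 hp.1,
        riemannianEDistOn_comm]
    exact this
  have htri : ∀ x y z, conicalDist g D x z ≤ conicalDist g D x y + conicalDist g D y z := by
    intro x y z
    have hcl : IsClosed {p : X × X × X | conicalDist g D p.1 p.2.2 ≤
        conicalDist g D p.1 p.2.1 + conicalDist g D p.2.1 p.2.2} :=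
      isClosed_le (hcont.comp (by fun_prop : Continuous fun p : X × X × X ↦ (p.1, p.2.2)))
        ((hcont.comp (by fun_prop : Continuous fun p : X × X × X ↦ (p.1, p.2.1))).add
          (hcont.comp (by fun_prop : Continuous fun p : X × X × X ↦ (p.2.1, p.2.2))))
    refine hcl.closure_subset_iff.2 (fun p hp ↦ ?_) ((hdense.prod (hdense.prod hdense)) (x, y, z))
    obtain ⟨h1, h2, h3⟩ := hp
    have : conicalDist g D p.1 p.2.2 ≤
        conicalDist g D p.1 p.2.1 + conicalDist g D p.2.1 p.2.2 := by
      rw [hu.conicalDist_eq hD hL hρ h1 h3, hu.conicalDist_eq hD hL hρ h1 h2,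
        hu.conicalDist_eq hD hL hρ h2 h3, ← ENNReal.toReal_add (hu.edist_lt_top hD hL hρ h1 h2).ne
        (hu.edist_lt_top hD hL hρ h2 h3).ne]
      exact ENNReal.toReal_mono (ENNReal.add_ne_top.2 ⟨(hu.edist_lt_top hD hL hρ h1 h2).ne,
        (hu.edist_lt_top hD hL hρ h2 h3).ne⟩) riemannianEDistOn_triangle
    exact this
  refine ⟨hself, hsymm, htri, hcont, fun x y a b ha hb hab ↦ ?_⟩
  -- The slack in `a + b` pays for replacing both endpoints by points off `D` and still leaves
  -- margins of `ε` in `a` and in `b`.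
  set ε := min ((a + b - conicalDist g D x y) / 6) (min (a / 2) (b / 2)) with hε
  have hε0 : 0 < ε := by
    have : 0 < a + b - conicalDist g D x y := by linarith
    positivity
  have hε1 : 6 * ε ≤ a + b - conicalDist g D x y := by
    have := min_le_left ((a + b - conicalDist g D x y) / 6) (min (a / 2) (b / 2))
    linarith
  have hε2 : ε ≤ a / 2 := (min_le_right _ _).trans (min_le_left _ _)
  have hε3 : ε ≤ b / 2 := (min_le_right _ _).trans (min_le_right _ _)
  have happrox : ∀ x, ∃ x' ∈ Dᶜ, conicalDist g D x x' < ε := fun x ↦ by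
    have ho : IsOpen {x' | conicalDist g D x x' < ε} := isOpen_lt (hc1 x) continuous_const
    obtain ⟨x', h1, h2⟩ := hdense.exists_mem_open ho ⟨x, by
      change conicalDist g D x x < ε
      rwa [hself]⟩
    exact ⟨x', h1, h2⟩
  obtain ⟨x', hx'D, hx'⟩ := happrox x
  obtain ⟨y', hy'D, hy'⟩ := happrox y
  have hxy' : conicalDist g D x' y' ≤ conicalDist g D x y + 2 * ε := by
    have h1 := htri x' x y'
    have h2 := htri x y y'
    rw [hsymm x' x] at h1
    linarith
  set r := a + b - 3 * ε with hr
  have hlt : riemannianEDistOn g Dᶜ x' y' < ENNReal.ofReal r := by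
    rw [← hu.ofReal_conicalDist hD hL hρ hx'D hy'D]
    exact (ENNReal.ofReal_lt_ofReal_iff (by linarith)).2 (by linarith)
  obtain ⟨γ, hγc, hγD, hγ0, hγ1, hγ⟩ := exists_path_add_lt_of_riemannianEDistOn_lt hlt
  have hsum : ∀ t ∈ Icc (0 : ℝ) 1,
      conicalDist g D x' (γ t) + conicalDist g D (γ t) y' < r := by
    intro t ht
    have h1 := hγ t ht
    have hf1 := (hu.edist_lt_top hD hL hρ hx'D (hγD ht)).ne
    have hf2 := (hu.edist_lt_top hD hL hρ (hγD ht) hy'D).ne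
    rw [hu.conicalDist_eq hD hL hρ hx'D (hγD ht), hu.conicalDist_eq hD hL hρ (hγD ht) hy'D,
      ← ENNReal.toReal_add hf1 hf2]
    exact (ENNReal.lt_ofReal_iff_toReal_lt (ENNReal.add_ne_top.2 ⟨hf1, hf2⟩)).1 h1
  have hk : ContinuousOn (fun t ↦ conicalDist g D (γ t) y') (Icc 0 1) :=
    (hcont.comp (by fun_prop : Continuous fun z ↦ (z, y'))).comp_continuousOn hγc
  have hfinish : ∀ z, conicalDist g D x' z ≤ a - ε → conicalDist g D z y' < b - ε →
      ∃ z, conicalDist g D x z < a ∧ conicalDist g D z y < b := fun z h1 h2 ↦ by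
    refine ⟨z, ?_, ?_⟩
    · have := htri x x' z
      linarith
    · have := htri z y' y
      rw [hsymm y' y] at this
      linarith
  rcases lt_or_ge (conicalDist g D x' y') (b - ε) with h | h
  · exact hfinish x' (by rw [hself]; linarith) h
  -- Stop the short path where its distance to `y'` is exactly `b - 2 * ε`; the distance from `x'`
  -- is then below `r - (b - 2 * ε) = a - ε`.
  · have hmem : b - 2 * ε ∈ Icc ((fun t ↦ conicalDist g D (γ t) y') 1)
        ((fun t ↦ conicalDist g D (γ t) y') 0) := by
      simp only [hγ0, hγ1, hself]
      constructor <;> linarith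
    obtain ⟨t, ht, hkt⟩ := intermediate_value_Icc' zero_le_one hk hmem
    have hkt' : conicalDist g D (γ t) y' = b - 2 * ε := hkt
    have := hsum t ht
    exact hfinish (γ t) (by linarith) (by linarith)

/-- The estimate off `D` passes to the closure by continuity of both sides. -/
lemma conicalDist_symm_le {Ψ : OpenPartialHomeomorph X (Cn n)} (h : IsConeChart g D L Ψ)
    {p : Cn n} {δ : ℝ} (hb : Metric.ball p (5 * δ) ⊆ Ψ.target) {w w' : Cn n}
    (hw : w ∈ Metric.ball p δ) (hw' : w' ∈ Metric.ball p δ) :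
    conicalDist g D (Ψ.symm w) (Ψ.symm w') ≤ 2 * L * ‖w - w'‖ := by
  have hcont := hu.continuous_conicalDist hD hL hρ
  have hδ0 : 0 < δ := dist_nonneg.trans_lt (Metric.mem_ball.1 hw)
  have hsub : Metric.ball p δ ⊆ Ψ.target :=
    (Metric.ball_subset_ball (by linarith)).trans hb
  set G := Metric.ball p δ ∩ (Ψ.target ∩ Ψ.symm ⁻¹' Dᶜ) with hG
  have hcl : Metric.ball p δ ⊆ closure G := fun z hz ↦
    Metric.isOpen_ball.inter_closure ⟨hz, h.dense_good (hsub hz)⟩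
  have hmem : (w, w') ∈ closure (G ×ˢ G) := by
    rw [closure_prod_eq]
    exact ⟨hcl hw, hcl hw'⟩
  have hc1 : ContinuousOn (fun q : Cn n × Cn n ↦ conicalDist g D (Ψ.symm q.1) (Ψ.symm q.2))
      (Metric.ball p δ ×ˢ Metric.ball p δ) := by
    have h1 : ContinuousOn (fun q : Cn n × Cn n ↦ Ψ.symm q.1)
        (Metric.ball p δ ×ˢ Metric.ball p δ) :=
      (Ψ.continuousOn_symm.mono hsub).comp continuousOn_fst fun q hq ↦ hq.1
    have h2 : ContinuousOn (fun q : Cn n × Cn n ↦ Ψ.symm q.2)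
        (Metric.ball p δ ×ˢ Metric.ball p δ) :=
      (Ψ.continuousOn_symm.mono hsub).comp continuousOn_snd fun q hq ↦ hq.2
    have h3 := hcont.comp_continuousOn (h1.prodMk h2)
    simpa only [Function.comp_def] using h3
  have hsubG : G ×ˢ G ⊆ Metric.ball p δ ×ˢ Metric.ball p δ :=
    prod_mono inter_subset_left inter_subset_left
  have hf : ContinuousWithinAt (fun q : Cn n × Cn n ↦
      conicalDist g D (Ψ.symm q.1) (Ψ.symm q.2)) (G ×ˢ G) (w, w') :=
    (hc1 (w, w') ⟨hw, hw'⟩).mono hsubG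
  have hr : ContinuousWithinAt (fun q : Cn n × Cn n ↦ 2 * L * ‖q.1 - q.2‖) (G ×ˢ G) (w, w') :=
    ((continuous_const.mul (continuous_fst.sub continuous_snd).norm)).continuousWithinAt
  have hle : ∀ q ∈ G ×ˢ G, conicalDist g D (Ψ.symm q.1) (Ψ.symm q.2) ≤ 2 * L * ‖q.1 - q.2‖ := by
    intro q hq
    have := h.riemannianEDistOn_symm_le hD hL hb hq.1.1 hq.2.1 hq.1.2.2 hq.2.2.2
    rw [hu.conicalDist_eq hD hL hρ hq.1.2.2 hq.2.2.2]
    refine ENNReal.toReal_le_of_le_ofReal ?_ this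
    exact mul_nonneg (mul_nonneg two_pos.le hL.le) (norm_nonneg _)
  exact hf.closure_le hmem hr hle

lemma norm_sub_le_conicalDist [T2Space X] {Ψ : OpenPartialHomeomorph X (Cn n)}
    (h : IsConeChart g D L Ψ) {x y : X} {δ : ℝ} (hx : x ∈ Ψ.source)
    (hb : Metric.ball (Ψ x) (4 * δ) ⊆ Ψ.target) (hxy : L * conicalDist g D x y < δ) :
    y ∈ Ψ.source ∧ ‖Ψ y - Ψ x‖ ≤ L * conicalDist g D x y := by
  have hcont := hu.continuous_conicalDist hD hL hρ
  have hδ0 : 0 < δ :=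
    (mul_nonneg hL.le ((hu.isLengthDist hD hL hρ).nonneg x y)).trans_lt hxy
  have hdense : Dense (Dᶜ ×ˢ Dᶜ) := hu.dense_compl.prod hu.dense_compl
  have hne : (𝓝[Dᶜ ×ˢ Dᶜ] (x, y)).NeBot := mem_closure_iff_nhdsWithin_neBot.1 (hdense _)
  have hfst : Tendsto (fun q : X × X ↦ q.1) (𝓝[Dᶜ ×ˢ Dᶜ] (x, y)) (𝓝 x) :=
    (continuous_fst.tendsto (x, y)).mono_left nhdsWithin_le_nhds
  have hsnd : Tendsto (fun q : X × X ↦ q.2) (𝓝[Dᶜ ×ˢ Dᶜ] (x, y)) (𝓝 y) :=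
    (continuous_snd.tendsto (x, y)).mono_left nhdsWithin_le_nhds
  -- Pairs off `D` close to `(x, y)` are joined by genuine short paths, which cannot leave the
  -- chart.
  have key : ∀ r, conicalDist g D x y < r → L * r ≤ δ → ∀ᶠ q in 𝓝[Dᶜ ×ˢ Dᶜ] (x, y),
      q.2 ∈ Ψ.source ∧ ‖Ψ q.2 - Ψ q.1‖ ≤ L * r ∧ ‖Ψ q.1 - Ψ x‖ < δ := by
    intro r hr hrδ
    have h1 : ∀ᶠ q in 𝓝[Dᶜ ×ˢ Dᶜ] (x, y), conicalDist g D q.1 q.2 < r :=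
      nhdsWithin_le_nhds (hcont.continuousAt.eventually_lt continuousAt_const hr)
    have h2 : ∀ᶠ q in 𝓝[Dᶜ ×ˢ Dᶜ] (x, y), q.1 ∈ Ψ.source :=
      hfst.eventually (Ψ.open_source.mem_nhds hx)
    have h3 : ∀ᶠ q in 𝓝[Dᶜ ×ˢ Dᶜ] (x, y), Ψ q.1 ∈ Metric.ball (Ψ x) δ :=
      hfst.eventually ((Ψ.continuousAt hx).preimage_mem_nhds (Metric.ball_mem_nhds _ hδ0))
    filter_upwards [h1, h2, h3, self_mem_nhdsWithin] with q hq1 hq2 hq3 hqD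
    have hr0 : 0 < r := ((hu.isLengthDist hD hL hρ).nonneg x y).trans_lt hr
    have hlt : riemannianEDistOn g Dᶜ q.1 q.2 < ENNReal.ofReal r := by
      rw [← hu.ofReal_conicalDist hD hL hρ hqD.1 hqD.2]
      exact (ENNReal.ofReal_lt_ofReal_iff hr0).2 hq1
    have hball : Metric.ball (Ψ q.1) δ ⊆ Ψ.target :=
      (Metric.ball_subset_ball' (by linarith [Metric.mem_ball.1 hq3])).trans hb
    obtain ⟨h4, h5⟩ := h.mem_source_of_riemannianEDistOn_lt hD hL hq2 hball hlt hrδ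
    exact ⟨h4, h5, mem_ball_iff_norm.1 hq3⟩
  have hy : y ∈ Ψ.source := by
    -- The nearby second points lie in the image of a compact ball. That image is closed, so their
    -- limit `y` remains in the chart.
    have hsub : Metric.closedBall (Ψ x) (2 * δ) ⊆ Ψ.target :=
      (Metric.closedBall_subset_ball (by linarith)).trans hb
    have hK : IsClosed (Ψ.symm '' Metric.closedBall (Ψ x) (2 * δ)) :=
      ((isCompact_closedBall _ _).image_of_continuousOn (Ψ.continuousOn_symm.mono hsub)).isClosed
    have hr : conicalDist g D x y < δ / L := (lt_div_iff₀' hL).2 hxy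
    have hmem : y ∈ Ψ.symm '' Metric.closedBall (Ψ x) (2 * δ) := by
      refine hK.mem_of_tendsto hsnd ?_
      filter_upwards [key _ hr (mul_div_cancel₀ _ hL.ne').le] with q hq
      refine ⟨Ψ q.2, ?_, Ψ.left_inv hq.1⟩
      rw [mem_closedBall_iff_norm]
      have h1 := norm_sub_le_norm_sub_add_norm_sub (Ψ q.2) (Ψ q.1) (Ψ x)
      have h2 := hq.2.1
      rw [mul_div_cancel₀ _ hL.ne'] at h2
      linarith [hq.2.2]
    obtain ⟨w, hw, rfl⟩ := hmem
    exact Ψ.map_target (hsub hw)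
  refine ⟨hy, ?_⟩
  have hlim : Tendsto (fun q : X × X ↦ ‖Ψ q.2 - Ψ q.1‖) (𝓝[Dᶜ ×ˢ Dᶜ] (x, y))
      (𝓝 ‖Ψ y - Ψ x‖) :=
    (((Ψ.continuousAt hy).tendsto.comp hsnd).sub ((Ψ.continuousAt hx).tendsto.comp hfst)).norm
  rw [← div_le_iff₀' hL]
  refine le_of_forall_gt_imp_ge_of_dense fun r hr ↦ ?_
  rw [div_le_iff₀' hL]
  set r' := min r (δ / L) with hr'
  have h1 : conicalDist g D x y < r' := lt_min hr ((lt_div_iff₀' hL).2 hxy)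
  have h2 : L * r' ≤ δ := (le_div_iff₀' hL).1 (min_le_right _ _)
  refine (le_of_tendsto hlim ((key r' h1 h2).mono fun q hq ↦ hq.2.1)).trans ?_
  gcongr
  exact min_le_left _ _

end Extension

end HasUniformConeCharts

end ConicalDist

/-! ### Comparison of Gram determinants -/

section Determinant

open Matrix

/-- Testing the form on unit eigenvectors puts every eigenvalue between `a` and `b`, and the
determinant is their product. -/
lemma Matrix.IsHermitian.pow_card_le_det {κ : Type*} [Fintype κ] [DecidableEq κ]
    {H : Matrix κ κ ℝ} (hH : H.IsHermitian) {a b : ℝ} (ha : 0 ≤ a)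
    (hle : ∀ x : κ → ℝ, a * (x ⬝ᵥ x) ≤ x ⬝ᵥ H *ᵥ x) (hge : ∀ x : κ → ℝ, x ⬝ᵥ H *ᵥ x ≤ b * (x ⬝ᵥ x)) :
    a ^ Fintype.card κ ≤ H.det ∧ H.det ≤ b ^ Fintype.card κ := by
  have hone : ∀ i, (hH.eigenvectorBasis i).ofLp ⬝ᵥ (hH.eigenvectorBasis i).ofLp = 1 := fun i ↦ by
    have h1 : inner ℝ (hH.eigenvectorBasis i) (hH.eigenvectorBasis i) = (1 : ℝ) := by
      rw [real_inner_self_eq_norm_sq, hH.eigenvectorBasis.orthonormal.1 i, one_pow]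
    rw [EuclideanSpace.inner_eq_star_dotProduct] at h1
    simpa using h1
  have heig : ∀ i, a ≤ hH.eigenvalues i ∧ hH.eigenvalues i ≤ b := fun i ↦ by
    have h1 := hle (hH.eigenvectorBasis i).ofLp
    have h2 := hge (hH.eigenvectorBasis i).ofLp
    have h3 := hH.eigenvalues_eq i
    simp only [star_trivial, RCLike.re_to_real] at h3
    rw [hone, mul_one, ← h3] at h1 h2
    exact ⟨h1, h2⟩
  rw [hH.det_eq_prod_eigenvalues]
  simp only [RCLike.ofReal_real_eq_id, id]
  constructor
  · rw [← Finset.card_univ, ← Finset.prod_const]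
    exact Finset.prod_le_prod (fun _ _ ↦ ha) fun i _ ↦ (heig i).1
  · rw [← Finset.card_univ, ← Finset.prod_const]
    exact Finset.prod_le_prod (fun i _ ↦ ha.trans (heig i).1) fun i _ ↦ (heig i).2

variable {E κ : Type*} [NormedAddCommGroup E] [InnerProductSpace ℝ E] [Fintype κ] [DecidableEq κ]

lemma Matrix.dotProduct_gram_mulVec (e : OrthonormalBasis κ ℝ E) (G : E →L[ℝ] E →L[ℝ] ℝ)
    (x y : κ → ℝ) :
    x ⬝ᵥ (Matrix.of fun i j ↦ G (e i) (e j)) *ᵥ y = G (∑ i, x i • e i) (∑ j, y j • e j) := by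
  simp only [dotProduct, mulVec, Matrix.of_apply, map_sum, map_smul, _root_.smul_apply, smul_eq_mul,
    Finset.mul_sum, _root_.sum_apply]
  rw [Finset.sum_comm]
  refine Finset.sum_congr rfl fun i _ ↦ Finset.sum_congr rfl fun j _ ↦ by ring

/-- Comparison of the volume of a scalar product with the Jacobian of a linear map. -/
lemma sqrt_det_gram_le (e : OrthonormalBasis κ ℝ E) {G : E →L[ℝ] E →L[ℝ] ℝ}
    (hsymm : ∀ v w, G v w = G w v) {A : E →L[ℝ] E} (hA : A.det ≠ 0) {L : ℝ} (hL : 0 < L)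
    (hle : ∀ v, ‖A v‖ ^ 2 ≤ L ^ 2 * G v v) (hge : ∀ v, G v v ≤ L ^ 2 * ‖A v‖ ^ 2) :
    √(Matrix.of fun i j ↦ G (e i) (e j)).det ≤ L ^ Fintype.card κ * |A.det| ∧
      |A.det| ≤ L ^ Fintype.card κ * √(Matrix.of fun i j ↦ G (e i) (e j)).det := by
  set M : Matrix κ κ ℝ := Matrix.of fun i j ↦ G (e i) (e j) with hM
  set T : Matrix κ κ ℝ := LinearMap.toMatrix e.toBasis e.toBasis (A : E →ₗ[ℝ] E) with hT
  have hdetT : T.det = A.det := LinearMap.det_toMatrix _ _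
  have hunit : IsUnit T.det := by rw [hdetT]; exact isUnit_iff_ne_zero.2 hA
  -- `H` represents `G` after transport by `A`, so its quadratic form lies between `L⁻²` and `L²`
  -- times the Euclidean one, while `det M = det H * (det A)²`.
  set H : Matrix κ κ ℝ := (T⁻¹)ᵀ * M * T⁻¹ with hH
  have hMs : Mᵀ = M := by
    ext i j
    simp only [hM, Matrix.transpose_apply, Matrix.of_apply]
    exact hsymm _ _
  have hHs : H.IsHermitian := by
    rw [Matrix.IsHermitian, Matrix.conjTranspose_eq_transpose_of_trivial, hH,
      Matrix.transpose_mul, Matrix.transpose_mul, hMs, Matrix.transpose_transpose, mul_assoc]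
  have hquad : ∀ x : κ → ℝ, ∃ v : E, x ⬝ᵥ H *ᵥ x = G v v ∧ x ⬝ᵥ x = ‖A v‖ ^ 2 := by
    intro x
    set y := T⁻¹ *ᵥ x with hy
    have hTy : T *ᵥ y = x := by
      rw [hy, Matrix.mulVec_mulVec, Matrix.mul_nonsing_inv _ hunit, Matrix.one_mulVec]
    refine ⟨∑ i, y i • e i, ?_, ?_⟩
    · rw [← Matrix.dotProduct_gram_mulVec, hH, ← Matrix.mulVec_mulVec, ← Matrix.mulVec_mulVec,
        ← hM, Matrix.dotProduct_mulVec, Matrix.vecMul_transpose]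
    · have h1 : ∀ i, e.repr (A (∑ i, y i • e i)) i = x i := fun i ↦ by
        rw [← hTy]
        have h2 := congrFun (LinearMap.toMatrix_mulVec_repr e.toBasis e.toBasis (A : E →ₗ[ℝ] E)
          (∑ i, y i • e i)) i
        have h3 : ⇑(e.toBasis.repr (∑ i, y i • e i)) = y := by
          have : ∑ i, y i • e i = ∑ i, y i • e.toBasis i := by simp
          rw [this]
          ext i
          rw [Module.Basis.repr_sum_self]
        rw [h3] at h2
        rw [hT, h2]
        simp
      rw [← e.repr.norm_map, EuclideanSpace.norm_sq_eq]
      simp only [h1, dotProduct, Real.norm_eq_abs, sq_abs]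
      exact Finset.sum_congr rfl fun i _ ↦ by ring
  have hL2 : 0 < L ^ 2 := by positivity
  have hdet := hHs.pow_card_le_det (a := (L ^ 2)⁻¹) (b := L ^ 2) (by positivity)
    (fun x ↦ by
      obtain ⟨v, h1, h2⟩ := hquad x
      rw [h1, h2, inv_mul_le_iff₀ hL2]
      exact hle v)
    (fun x ↦ by
      obtain ⟨v, h1, h2⟩ := hquad x
      rw [h1, h2]
      exact hge v)
  have hHdet : M.det = H.det * A.det ^ 2 := by
    rw [hH, Matrix.det_mul, Matrix.det_mul, Matrix.det_transpose, ← hdetT]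
    have : T⁻¹.det * T.det = 1 := by rw [Matrix.det_nonsing_inv_mul_det _ hunit]
    linear_combination (-(M.det) * (T⁻¹.det * T.det + 1)) * this
  have hH0 : 0 ≤ H.det := le_trans (by positivity) hdet.1
  have hsq : √M.det = √H.det * |A.det| := by
    rw [hHdet, Real.sqrt_mul hH0, Real.sqrt_sq_eq_abs]
  have h1 : √H.det ≤ L ^ Fintype.card κ := by
    refine Real.sqrt_le_iff.2 ⟨by positivity, hdet.2.trans_eq ?_⟩
    rw [← pow_mul, ← pow_mul, mul_comm]
  have h2 : 1 ≤ L ^ Fintype.card κ * √H.det := by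
    have : (L ^ Fintype.card κ)⁻¹ ≤ √H.det := by
      refine Real.le_sqrt_of_sq_le (le_trans (le_of_eq ?_) hdet.1)
      rw [inv_pow, inv_pow, ← pow_mul, ← pow_mul, mul_comm]
    rwa [inv_le_iff_one_le_mul₀' (by positivity)] at this
  rw [hsq]
  refine ⟨mul_le_mul_of_nonneg_right h1 (abs_nonneg _), ?_⟩
  calc |A.det| ≤ (L ^ Fintype.card κ * √H.det) * |A.det| := le_mul_of_one_le_left (abs_nonneg _) h2
    _ = _ := by ring

end Determinant

/-! ### Holomorphic maps as real differentiable maps -/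

section RestrictScalars

variable {E F M N : Type*} [NormedAddCommGroup E] [NormedSpace ℂ E] [NormedAddCommGroup F]
  [NormedSpace ℂ F] [TopologicalSpace M] [ChartedSpace E M] [TopologicalSpace N] [ChartedSpace F N]

lemma ContMDiffOn.restrictScalars_real {m : ℕ∞ω} {f : M → N} {s : Set M}
    (hf : ContMDiffOn 𝓘(ℂ, E) 𝓘(ℂ, F) m f s) : ContMDiffOn 𝓘(ℝ, E) 𝓘(ℝ, F) m f s := by
  intro x hx
  have h := hf x hx
  rw [contMDiffWithinAt_iff] at h ⊢
  exact ⟨h.1, h.2.restrict_scalars ℝ⟩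

end RestrictScalars

/-! ### Comparison of the Riemannian measure with Lebesgue measure -/

section ConicalMeasure

variable {n : ℕ} {X : Type*} [TopologicalSpace X] [ChartedSpace (Cn n) X]
  [IsManifold 𝓘(ℂ, Cn n) ω X]

lemma contMDiffOn_real_of_mem_maximalAtlas {ψ : OpenPartialHomeomorph X (Cn n)}
    (hψ : ψ ∈ IsManifold.maximalAtlas 𝓘(ℂ, Cn n) ω X) :
    ContMDiffOn 𝓘(ℝ, Cn n) 𝓘(ℝ, Cn n) 1 ψ ψ.source :=
  ((contMDiffOn_of_mem_maximalAtlas hψ).of_le le_top).restrictScalars_real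

lemma contMDiffOn_real_symm_of_mem_maximalAtlas {ψ : OpenPartialHomeomorph X (Cn n)}
    (hψ : ψ ∈ IsManifold.maximalAtlas 𝓘(ℂ, Cn n) ω X) :
    ContMDiffOn 𝓘(ℝ, Cn n) 𝓘(ℝ, Cn n) 1 ψ.symm ψ.target :=
  ((contMDiffOn_symm_of_mem_maximalAtlas hψ).of_le le_top).restrictScalars_real

variable {g : BilinField n X} {D : Set X} {L : ℝ} {Ψ ψ : OpenPartialHomeomorph X (Cn n)}

/-- The pull-back of a metric under a map that factors, near `z`, through another one. -/
lemma pullbackMetric_comp {P Q : Cn n → X} {F : Cn n → Cn n} {z : Cn n}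
    (heq : P =ᶠ[𝓝 z] Q ∘ F) (hQ : MDifferentiableAt 𝓘(ℝ, Cn n) 𝓘(ℝ, Cn n) Q (F z))
    (hF : DifferentiableAt ℝ F z) (v w : Cn n) :
    pullbackMetric g P z v w = pullbackMetric g Q (F z) (fderiv ℝ F z v) (fderiv ℝ F z w) := by
  have h1 : realDifferential P z = (realDifferential Q (F z)).comp (fderiv ℝ F z) := by
    unfold realDifferential
    rw [heq.mfderiv_eq, mfderiv_comp z hQ hF.mdifferentiableAt, mfderiv_eq_fderiv]
    rfl
  rw [pullbackMetric_apply, pullbackMetric_apply, h1, heq.eq_of_nhds]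
  rfl

section

variable [MeasurableSpace X] [BorelSpace X]

lemma chartMeasure_apply (hD : IsClosed D) {A : Set X} (hA : MeasurableSet A) :
    chartMeasure g D ψ A = ∫⁻ z in ψ.symm ⁻¹' A ∩ (ψ.target ∩ ψ.symm ⁻¹' Dᶜ),
      ENNReal.ofReal (volumeDensity (pullbackMetric g ψ.symm z)) := by
  have hm : MeasurableSet (ψ.target ∩ ψ.symm ⁻¹' Dᶜ) :=
    (IsConeChart.isOpen_good hD).measurableSet
  have hae : AEMeasurable ψ.symm (volume.restrict (ψ.target ∩ ψ.symm ⁻¹' Dᶜ)) :=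
    (ψ.continuousOn_symm.mono inter_subset_left).aemeasurable hm
  rw [chartMeasure, Measure.map_apply_of_aemeasurable
    (hae.mono_ac (withDensity_absolutelyContinuous _ _)) hA, withDensity_apply',
    Measure.restrict_restrict' hm]

lemma map_symm_restrict_apply {A : Set X} (hA : MeasurableSet A) :
    (volume.restrict Ψ.target).map Ψ.symm A = volume (Ψ.symm ⁻¹' A ∩ Ψ.target) := by
  have hm := Ψ.open_target.measurableSet
  rw [Measure.map_apply_of_aemeasurable (Ψ.continuousOn_symm.aemeasurable hm) hA,
    Measure.restrict_apply' hm]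

namespace IsConeChart

lemma volume_preimage_divisor (h : IsConeChart g D L Ψ) :
    volume (Ψ.target ∩ Ψ.symm ⁻¹' D) = 0 := by
  obtain ⟨J, hJ⟩ := h.divisor
  refine measure_mono_null ?_ (ae_iff.1 (ae_forall_coord_ne_zero n))
  rintro w ⟨hw, hwD⟩ hcon
  obtain ⟨j, -, hj⟩ := (hJ w hw).1 hwD
  exact hcon j hj

/-- Off `D` the transition `F` from `ψ` to `Ψ` is `C¹` and injective, so Lebesgue measure in `Ψ` is
the integral of `|det F'|`; the density of `g` in `ψ` is comparable to it by `sqrt_det_gram_le`. -/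
lemma chartMeasure_comparison (h : IsConeChart g D L Ψ) (hL : 0 < L) (hD : IsClosed D)
    (hg : IsKahlerMetricOn g Dᶜ) (hψ : ψ ∈ IsManifold.maximalAtlas 𝓘(ℂ, Cn n) ω X)
    {A : Set X} (hA : MeasurableSet A) (hAs : A ⊆ Ψ.source) :
    chartMeasure g D ψ A ≤ ENNReal.ofReal (L ^ Module.finrank ℝ (Cn n)) *
        volume (Ψ.target ∩ Ψ.symm ⁻¹' (A ∩ ψ.source ∩ Dᶜ)) ∧
      volume (Ψ.target ∩ Ψ.symm ⁻¹' (A ∩ ψ.source ∩ Dᶜ)) ≤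
        ENNReal.ofReal (L ^ Module.finrank ℝ (Cn n)) * chartMeasure g D ψ A := by
  set m := Module.finrank ℝ (Cn n) with hm
  set F : Cn n → Cn n := Ψ ∘ ψ.symm with hF
  set O : Set (Cn n) := ψ.target ∩ ψ.symm ⁻¹' (Ψ.source ∩ Dᶜ) with hO
  have hOo : IsOpen O := ψ.isOpen_inter_preimage_symm (Ψ.open_source.inter hD.isOpen_compl)
  have hFs : ContDiffOn ℝ 1 F O := by
    rw [← contMDiffOn_iff_contDiffOn]
    exact h.contMDiffOn.comp
      ((contMDiffOn_real_symm_of_mem_maximalAtlas hψ).mono inter_subset_left) fun z hz ↦ hz.2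
  have hFd : ∀ z ∈ O, DifferentiableAt ℝ F z := fun z hz ↦
    (hFs.contDiffAt (hOo.mem_nhds hz)).differentiableAt one_ne_zero
  have hFT : ∀ z ∈ O, F z ∈ Ψ.target := fun z hz ↦ Ψ.map_source hz.2.1
  have hsF : ∀ z ∈ O, Ψ.symm (F z) = ψ.symm z := fun z hz ↦ Ψ.left_inv hz.2.1
  have hFD : ∀ z ∈ O, Ψ.symm (F z) ∉ D := fun z hz ↦ by rw [hsF z hz]; exact hz.2.2
  have hpb : ∀ z ∈ O, ∀ v, pullbackMetric g ψ.symm z v v =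
      pullbackMetric g Ψ.symm (F z) (fderiv ℝ F z v) (fderiv ℝ F z v) := fun z hz v ↦ by
    refine pullbackMetric_comp ?_ (h.mdifferentiableAt_symm hD (hFT z hz) (hFD z hz)) (hFd z hz) v v
    filter_upwards [hOo.mem_nhds hz] with z' hz' using (hsF z' hz').symm
  set S : Set (Cn n) := ψ.symm ⁻¹' A ∩ (ψ.target ∩ ψ.symm ⁻¹' Dᶜ) with hS
  have hSO : S ⊆ O := fun z hz ↦ ⟨hz.2.1, hAs hz.1, hz.2.2⟩
  have hSm : MeasurableSet S := by
    have h1 : MeasurableSet (ψ.target ∩ ψ.symm ⁻¹' A) := by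
      classical
      have hmeas : Measurable (ψ.target.piecewise ψ.symm fun _ ↦ ψ.symm 0) :=
        ψ.continuousOn_symm.measurable_piecewise continuousOn_const ψ.open_target.measurableSet
      convert! ψ.open_target.measurableSet.inter (hmeas hA) using 1
      ext z
      refine and_congr_right fun hz ↦ ?_
      rw [mem_preimage, mem_preimage, piecewise_eq_of_mem _ _ _ hz]
    have h2 : S = (ψ.target ∩ ψ.symm ⁻¹' A) ∩ (ψ.target ∩ ψ.symm ⁻¹' Dᶜ) := by
      rw [hS]; ext z; simp only [mem_inter_iff]; tauto
    rw [h2]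
    exact h1.inter (IsConeChart.isOpen_good hD).measurableSet
  have hinj : InjOn F S := by
    intro z hz z' hz' hzz
    have h1 : ψ.symm z = ψ.symm z' := by
      rw [← hsF z (hSO hz), ← hsF z' (hSO hz'), hzz]
    exact ψ.symm.injOn hz.2.1 hz'.2.1 h1
  have himage : F '' S = Ψ.target ∩ Ψ.symm ⁻¹' (A ∩ ψ.source ∩ Dᶜ) := by
    ext w
    constructor
    · rintro ⟨z, hz, rfl⟩
      refine ⟨hFT z (hSO hz), ?_⟩
      rw [mem_preimage, hsF z (hSO hz)]
      exact ⟨⟨hz.1, ψ.map_target hz.2.1⟩, hz.2.2⟩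
    · rintro ⟨hw, ⟨hwA, hws⟩, hwD⟩
      have h1 : ψ.symm (ψ (Ψ.symm w)) = Ψ.symm w := ψ.left_inv hws
      refine ⟨ψ (Ψ.symm w), ⟨?_, ψ.map_source hws, ?_⟩, ?_⟩
      · rwa [mem_preimage, h1]
      · rwa [mem_preimage, h1]
      · rw [hF, Function.comp, h1, Ψ.right_inv hw]
  have hcov : ∫⁻ z in S, ENNReal.ofReal |(fderiv ℝ F z).det| = volume (F '' S) :=
    lintegral_abs_det_fderiv_eq_addHaar_image volume hSm
      (fun z hz ↦ (hFd z (hSO hz)).hasFDerivAt.hasFDerivWithinAt) hinj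
  have hdens : ∀ z ∈ S,
      volumeDensity (pullbackMetric g ψ.symm z) ≤ L ^ m * |(fderiv ℝ F z).det| ∧
      |(fderiv ℝ F z).det| ≤ L ^ m * volumeDensity (pullbackMetric g ψ.symm z) := by
    intro z hz
    have hzO := hSO hz
    -- A vector killed by `F'` would have zero `g`-length, against positivity of the metric.
    have hdet : (fderiv ℝ F z).det ≠ 0 := fun h0 ↦ by
      obtain ⟨v, hv, hv0⟩ := (Submodule.ne_bot_iff _).1
        (LinearMap.bot_lt_ker_of_det_eq_zero (f := (fderiv ℝ F z : Cn n →ₗ[ℝ] Cn n)) h0).ne'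
      have h1 := hg.pos ψ hψ z hz.2 v hv0
      rw [hpb z hzO] at h1
      have h2 : fderiv ℝ F z v = 0 := hv
      rw [h2] at h1
      simp at h1
    have := sqrt_det_gram_le (stdOrthonormalBasis ℝ (Cn n)) (G := pullbackMetric g ψ.symm z)
      (hg.symm ψ hψ z hz.2) hdet hL
      (fun v ↦ by
        rw [hpb z hzO]
        exact h.le_pullback _ (hFT z hzO) (hFD z hzO) _)
      (fun v ↦ by
        rw [hpb z hzO]
        exact h.pullback_le _ (hFT z hzO) (hFD z hzO) _)
    simpa [volumeDensity, hm] using this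
  have hLm : 0 ≤ L ^ m := by positivity
  rw [← himage, ← hcov, chartMeasure_apply hD hA, ← hS,
    ← lintegral_const_mul' _ _ ENNReal.ofReal_ne_top,
    ← lintegral_const_mul' _ _ ENNReal.ofReal_ne_top]
  constructor
  · refine setLIntegral_mono' hSm fun z hz ↦ ?_
    rw [← ENNReal.ofReal_mul hLm]
    exact ENNReal.ofReal_le_ofReal (hdens z hz).1
  · refine setLIntegral_mono' hSm fun z hz ↦ ?_
    rw [← ENNReal.ofReal_mul hLm]
    exact ENNReal.ofReal_le_ofReal (hdens z hz).2

lemma conicalMeasure_restrict_le (h : IsConeChart g D L Ψ) (hL : 0 < L) (hD : IsClosed D)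
    (hg : IsKahlerMetricOn g Dᶜ) :
    (conicalMeasure g D).restrict Ψ.source ≤
      ENNReal.ofReal (L ^ Module.finrank ℝ (Cn n)) • (volume.restrict Ψ.target).map Ψ.symm := by
  set K := ENNReal.ofReal (L ^ Module.finrank ℝ (Cn n))
  set μ := conicalMeasure g D with hμ
  have hs := Ψ.open_source.measurableSet
  -- A supremum of measures is bounded through a measure dominating each of them globally. Adding
  -- `μ` outside the chart provides one, and the extra term disappears upon restriction.
  have hle : μ ≤ K • (volume.restrict Ψ.target).map Ψ.symm + μ.restrict Ψ.sourceᶜ := by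
    rw [hμ, conicalMeasure]
    refine iSup₂_le fun ψ hψ ↦ ?_
    rw [Measure.le_iff]
    intro A hA
    rw [← measure_inter_add_sdiff A hs, Measure.add_apply, Measure.smul_apply, smul_eq_mul]
    refine add_le_add ?_ ?_
    · refine (h.chartMeasure_comparison hL hD hg hψ (hA.inter hs) inter_subset_right).1.trans ?_
      rw [map_symm_restrict_apply hA]
      refine mul_le_mul' le_rfl (measure_mono ?_)
      exact fun w hw ↦ ⟨hw.2.1.1.1, hw.1⟩
    · rw [Measure.restrict_apply hA, ← sdiff_eq]
      exact (le_iSup₂ (f := fun ψ (_ : ψ ∈ IsManifold.maximalAtlas 𝓘(ℂ, Cn n) ω X) ↦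
        chartMeasure g D ψ) ψ hψ) _
  rw [Measure.le_iff]
  intro A hA
  rw [Measure.restrict_apply hA]
  refine (hle (A ∩ Ψ.source)).trans ?_
  rw [Measure.add_apply, Measure.restrict_apply (hA.inter hs)]
  have : A ∩ Ψ.source ∩ Ψ.sourceᶜ = ∅ := by rw [inter_assoc, inter_compl_self, inter_empty]
  rw [this, measure_empty, add_zero]
  exact measure_mono inter_subset_left

/-- On the domain of one holomorphic chart this is the chart comparison, with `D` a null set in `Ψ`.
Countably many such domains, made disjoint, exhaust `X`. -/
lemma map_symm_le_conicalMeasure [SecondCountableTopology X] (h : IsConeChart g D L Ψ)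
    (hL : 0 < L) (hD : IsClosed D) (hg : IsKahlerMetricOn g Dᶜ) :
    (volume.restrict Ψ.target).map Ψ.symm ≤
      ENNReal.ofReal (L ^ Module.finrank ℝ (Cn n)) • conicalMeasure g D := by
  set K := ENNReal.ofReal (L ^ Module.finrank ℝ (Cn n))
  set μ := conicalMeasure g D with hμ
  set ν := (volume.restrict Ψ.target).map Ψ.symm with hν
  have hs := Ψ.open_source.measurableSet
  have hloc : ∀ x : X, ∀ A : Set X, MeasurableSet A → A ⊆ (chartAt (Cn n) x).source →
      ν A ≤ K * μ A := by
    intro x A hA hAx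
    have hψ : chartAt (Cn n) x ∈ IsManifold.maximalAtlas 𝓘(ℂ, Cn n) ω X :=
      IsManifold.chart_mem_maximalAtlas x
    have h1 := (h.chartMeasure_comparison hL hD hg hψ (hA.inter hs) inter_subset_right).2
    have h2 : chartMeasure g D (chartAt (Cn n) x) (A ∩ Ψ.source) ≤ μ A :=
      ((le_iSup₂ (f := fun ψ (_ : ψ ∈ IsManifold.maximalAtlas 𝓘(ℂ, Cn n) ω X) ↦
        chartMeasure g D ψ) _ hψ) _).trans (measure_mono inter_subset_left)
    refine le_trans ?_ (h1.trans (mul_le_mul' le_rfl h2))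
    rw [hν, map_symm_restrict_apply hA]
    have hsub : Ψ.symm ⁻¹' A ∩ Ψ.target ⊆
        (Ψ.target ∩ Ψ.symm ⁻¹' (A ∩ Ψ.source ∩ (chartAt (Cn n) x).source ∩ Dᶜ)) ∪
          (Ψ.target ∩ Ψ.symm ⁻¹' D) := by
      rintro w ⟨hwA, hw⟩
      by_cases hwD : Ψ.symm w ∈ D
      · exact Or.inr ⟨hw, hwD⟩
      · exact Or.inl ⟨hw, ⟨⟨hwA, Ψ.map_target hw⟩, hAx hwA⟩, hwD⟩
    refine (measure_mono hsub).trans ((measure_union_le _ _).trans_eq ?_)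
    rw [h.volume_preimage_divisor, add_zero]
  rw [Measure.le_iff]
  intro A hA
  rw [Measure.smul_apply, smul_eq_mul]
  rcases isEmpty_or_nonempty X with hX | hX
  · rw [eq_empty_of_isEmpty A]; simp
  obtain ⟨s, hsc, hsU⟩ := TopologicalSpace.countable_cover_nhds
    (fun x : X ↦ chart_source_mem_nhds (Cn n) x)
  have hsne : s.Nonempty := by
    rw [nonempty_iff_ne_empty]
    rintro rfl
    rw [biUnion_empty] at hsU
    exact empty_ne_univ hsU
  obtain ⟨f, rfl⟩ := hsc.exists_eq_range hsne
  set B : ℕ → Set X := fun k ↦ (chartAt (Cn n) (f k)).source with hB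
  have hBU : ⋃ k, B k = univ := by simpa using hsU
  have hBm : ∀ k, MeasurableSet (disjointed B k) :=
    MeasurableSet.disjointed fun k ↦ (chartAt (Cn n) (f k)).open_source.measurableSet
  have hAU : A = ⋃ k, A ∩ disjointed B k := by
    rw [← inter_iUnion, iUnion_disjointed, hBU, inter_univ]
  have hdisj : Pairwise (Function.onFun Disjoint fun k ↦ A ∩ disjointed B k) := fun i j hij ↦
    (disjoint_disjointed B hij).mono inter_subset_right inter_subset_right
  calc ν A = ∑' k, ν (A ∩ disjointed B k) := by
        conv_lhs => rw [hAU]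
        exact measure_iUnion hdisj fun k ↦ hA.inter (hBm k)
    _ ≤ ∑' k, K * μ (A ∩ disjointed B k) := ENNReal.tsum_le_tsum fun k ↦
        hloc (f k) _ (hA.inter (hBm k)) (inter_subset_right.trans (disjointed_subset B k))
    _ = K * μ A := by
        rw [ENNReal.tsum_mul_left]
        conv_rhs => rw [hAU]
        rw [measure_iUnion hdisj fun k ↦ hA.inter (hBm k)]

end IsConeChart

end

/-- The conclusion, for a metric that has cone charts of a uniform size around all points. -/
theorem HasUniformConeCharts.localPoincare12 [T2Space X] [SecondCountableTopology X]
    [PreconnectedSpace X] [MeasurableSpace X] [BorelSpace X] {ρ : ℝ}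
    (hu : HasUniformConeCharts g D L ρ) (hD : IsClosed D) (hL : 1 ≤ L) (hρ : 0 < ρ)
    (hg : IsKahlerMetricOn g Dᶜ) :
    LocalPoincare12 (conicalDist g D) (conicalMeasure g D) := by
  have hL0 : 0 < L := by linarith
  have hlen := hu.isLengthDist hD hL0 hρ
  -- The factor `2` is the speed of the quadratic paths, and `ρ / 5` leaves them room inside the
  -- chart.
  refine localPoincare12_of_uniformChart (E := Cn n) (ν := volume) (L := 2 * L) (ρ := ρ / 5)
    (C := ENNReal.ofReal (L ^ Module.finrank ℝ (Cn n))) hlen (by linarith) (by positivity)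
    ENNReal.ofReal_ne_top fun x ↦ ?_
  obtain ⟨Ψ, h, hx, hb⟩ := hu x
  have hb' : Metric.ball (Ψ x) (5 * (ρ / 5)) ⊆ Ψ.target := by
    rwa [mul_div_cancel₀ _ (by norm_num)]
  refine ⟨Ψ, hx, (Metric.ball_subset_ball (by linarith)).trans hb, fun w hw w' hw' ↦
    hu.conicalDist_symm_le hD hL0 hρ h hb' hw hw', fun y hy ↦ ?_,
    h.conicalMeasure_restrict_le hL0 hD hg, h.map_symm_le_conicalMeasure hL0 hD hg⟩
  rw [lt_div_iff₀' (by positivity)] at hy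
  have h0 : 0 ≤ L * conicalDist g D x y := mul_nonneg hL0.le (hlen.nonneg x y)
  obtain ⟨h1, h2⟩ := hu.norm_sub_le_conicalDist hD hL0 hρ h (y := y) (δ := ρ / 5) hx
    ((Metric.ball_subset_ball (by linarith)).trans hb) (by linarith)
  exact ⟨h1, h2.trans (by linarith)⟩

end ConicalMeasure

/-! ### Radial power maps that straighten a cone -/

section Radial

/-- The radial map `z ↦ |z|^(e-1) z` of the plane. -/
def radial (e : ℝ) (z : ℂ) : ℂ := (‖z‖ ^ (e - 1)) • z

lemma radial_zero (e : ℝ) : radial e 0 = 0 := by simp [radial]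

lemma radial_one (z : ℂ) : radial 1 z = z := by simp [radial]

lemma norm_radial {e : ℝ} (he : 0 < e) (z : ℂ) : ‖radial e z‖ = ‖z‖ ^ e := by
  rcases eq_or_ne z 0 with rfl | hz
  · simp [radial, Real.zero_rpow he.ne']
  · have h0 : 0 < ‖z‖ := norm_pos_iff.2 hz
    rw [radial, norm_smul, Real.norm_of_nonneg (by positivity), Real.rpow_sub_one h0.ne',
      div_mul_cancel₀ _ h0.ne']

lemma radial_eq_zero {e : ℝ} (he : 0 < e) {z : ℂ} : radial e z = 0 ↔ z = 0 := by
  rw [← norm_eq_zero, norm_radial he, Real.rpow_eq_zero (norm_nonneg _) he.ne', norm_eq_zero]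

lemma radial_radial {e e' : ℝ} (he : 0 < e) (z : ℂ) :
    radial e' (radial e z) = radial (e * e') z := by
  rcases eq_or_ne z 0 with rfl | hz
  · simp [radial]
  · have h0 : 0 < ‖z‖ := norm_pos_iff.2 hz
    rw [radial, norm_radial he, radial, radial, smul_smul, ← Real.rpow_mul h0.le,
      ← Real.rpow_add h0]
    congr 2
    ring

lemma continuous_radial {e : ℝ} (he : 0 < e) : Continuous (radial e) := by
  rw [continuous_iff_continuousAt]
  intro z
  rcases eq_or_ne z 0 with rfl | hz
  · rw [ContinuousAt, radial_zero, tendsto_zero_iff_norm_tendsto_zero]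
    have h1 : Continuous fun z : ℂ ↦ ‖z‖ ^ e := continuous_norm.rpow_const fun _ ↦ Or.inr he.le
    have h2 := h1.tendsto 0
    simp only [norm_zero, Real.zero_rpow he.ne'] at h2
    simpa only [norm_radial he] using h2
  · exact (continuous_norm.continuousAt.rpow_const (Or.inl (norm_ne_zero_iff.2 hz))).smul
      continuousAt_id

lemma contDiffAt_radial {e : ℝ} {z : ℂ} (h : z ≠ 0 ∨ e = 1) : ContDiffAt ℝ 1 (radial e) z := by
  rcases h with hz | rfl
  · exact ((contDiffAt_norm ℝ hz).rpow_const_of_ne (norm_ne_zero_iff.2 hz)).smul contDiffAt_id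
  · exact contDiffAt_id.congr_of_eventuallyEq (Eventually.of_forall radial_one)

lemma fderiv_radial_apply {e : ℝ} {z : ℂ} (hz : z ≠ 0) (v : ℂ) :
    fderiv ℝ (radial e) z v = (‖z‖ ^ (e - 1)) •
      (v + ((e - 1) * inner ℝ z v / ‖z‖ ^ 2) • z) := by
  have h0 : 0 < ‖z‖ := norm_pos_iff.2 hz
  -- The factor `‖y‖ ^ (e - 1)` is differentiated as a power of the smooth function `‖y‖ ^ 2`.
  have h1 : HasFDerivAt (fun y : ℂ ↦ ‖y‖ ^ 2) (2 • innerSL ℝ z) z :=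
    (hasStrictFDerivAt_norm_sq z).hasFDerivAt
  have h2 := h1.rpow_const (p := (e - 1) / 2) (Or.inl (by positivity))
  have h3 : (fun y : ℂ ↦ (‖y‖ ^ 2) ^ ((e - 1) / 2)) = fun y ↦ ‖y‖ ^ (e - 1) := by
    ext y
    rw [← Real.rpow_natCast, ← Real.rpow_mul (norm_nonneg _)]
    congr 1
    push_cast
    ring
  rw [h3] at h2
  have h4 : HasFDerivAt (radial e) _ z := h2.smul (hasFDerivAt_id z)
  rw [h4.fderiv]
  have h5 : (‖z‖ ^ 2) ^ ((e - 1) / 2 - 1) = ‖z‖ ^ (e - 1) / ‖z‖ ^ 2 := by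
    rw [← Real.rpow_natCast, ← Real.rpow_mul h0.le, ← Real.rpow_sub h0]
    congr 1
    push_cast
    ring
  simp only [h5, _root_.add_apply, _root_.smul_apply, ContinuousLinearMap.id_apply,
    ContinuousLinearMap.smulRight_apply, innerSL_apply_apply, smul_add, smul_smul]
  congr 2
  simp only [nsmul_eq_mul, smul_eq_mul]
  push_cast
  field_simp

/-- The differential scales tangential vectors by `‖z‖ ^ (e - 1)` and radial ones by `e` times that.
Up to the factor `e ^ 2`, the flat metric thus pulls back to the cone metric. -/
lemma norm_fderiv_radial {e : ℝ} (he0 : 0 < e) (he1 : e ≤ 1) {z : ℂ} (h : z ≠ 0 ∨ e = 1) (v : ℂ) :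
    e ^ 2 * (‖z‖ ^ (2 * e - 2) * ‖v‖ ^ 2) ≤ ‖fderiv ℝ (radial e) z v‖ ^ 2 ∧
      ‖fderiv ℝ (radial e) z v‖ ^ 2 ≤ ‖z‖ ^ (2 * e - 2) * ‖v‖ ^ 2 := by
  rcases eq_or_ne e 1 with rfl | hne
  · have h1 : radial 1 = id := funext radial_one
    simp [h1]
  have hz : z ≠ 0 := h.resolve_right hne
  have h0 : 0 < ‖z‖ := norm_pos_iff.2 hz
  have ha : (‖z‖ ^ (e - 1)) ^ 2 = ‖z‖ ^ (2 * e - 2) := by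
    rw [← Real.rpow_natCast, ← Real.rpow_mul h0.le]
    congr 1
    push_cast
    ring
  set t : ℝ := inner ℝ z v with ht
  have hcs : t ^ 2 / ‖z‖ ^ 2 ≤ ‖v‖ ^ 2 := by
    rw [div_le_iff₀ (by positivity), ← mul_pow, mul_comm ‖v‖, sq_le_sq,
      abs_of_nonneg (by positivity : 0 ≤ ‖z‖ * ‖v‖)]
    exact abs_real_inner_le_norm z v
  have hpos : 0 ≤ t ^ 2 / ‖z‖ ^ 2 := by positivity
  have hform : ‖fderiv ℝ (radial e) z v‖ ^ 2 =
      ‖z‖ ^ (2 * e - 2) * (‖v‖ ^ 2 + (e ^ 2 - 1) * (t ^ 2 / ‖z‖ ^ 2)) := by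
    rw [fderiv_radial_apply hz, norm_smul, mul_pow, Real.norm_eq_abs, sq_abs, ha,
      norm_add_sq_real, norm_smul, mul_pow, Real.norm_eq_abs, sq_abs, real_inner_smul_right,
      real_inner_comm z v, ← ht]
    congr 1
    field_simp
    ring
  rw [hform]
  have hp : 0 ≤ ‖z‖ ^ (2 * e - 2) := by positivity
  have he2 : e ^ 2 ≤ 1 := by nlinarith
  constructor
  · rw [mul_left_comm]
    exact mul_le_mul_of_nonneg_left (by nlinarith) hp
  · exact mul_le_mul_of_nonneg_left (by nlinarith) hp

variable {n : ℕ}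

/-- The map of `ℂⁿ` that acts by radial maps on the coordinates. -/
def radialMap (e : Fin n → ℝ) (z : Cn n) : Cn n := WithLp.toLp 2 fun j ↦ radial (e j) (z j)

lemma radialMap_apply (e : Fin n → ℝ) (z : Cn n) (j : Fin n) :
    radialMap e z j = radial (e j) (z j) := rfl

lemma radialMap_radialMap {e e' : Fin n → ℝ} (he : ∀ j, 0 < e j) (h : ∀ j, e j * e' j = 1)
    (z : Cn n) : radialMap e' (radialMap e z) = z := by
  ext j
  rw [radialMap_apply, radialMap_apply, radial_radial (he j), h, radial_one]

lemma continuous_radialMap {e : Fin n → ℝ} (he : ∀ j, 0 < e j) : Continuous (radialMap e) :=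
  (PiLp.continuous_toLp 2 _).comp
    (continuous_pi fun j ↦ (continuous_radial (he j)).comp (by fun_prop))

/-- The homeomorphism of `ℂⁿ` that acts by radial maps with positive exponents. -/
def radialHomeomorph (e : Fin n → ℝ) (he : ∀ j, 0 < e j) : Cn n ≃ₜ Cn n where
  toFun := radialMap e
  invFun := radialMap fun j ↦ (e j)⁻¹
  left_inv := radialMap_radialMap he fun j ↦ mul_inv_cancel₀ (he j).ne'
  right_inv := radialMap_radialMap (fun j ↦ inv_pos.2 (he j)) fun j ↦ inv_mul_cancel₀ (he j).ne'
  continuous_toFun := continuous_radialMap he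
  continuous_invFun := continuous_radialMap fun j ↦ inv_pos.2 (he j)

lemma contDiffAt_radialMap {e : Fin n → ℝ} {z : Cn n} (h : ∀ j, z j ≠ 0 ∨ e j = 1) :
    ContDiffAt ℝ 1 (radialMap e) z := by
  rw [contDiffAt_piLp 2]
  intro j
  have h1 : ContDiffAt ℝ 1 (fun y : Cn n ↦ y j) z := by fun_prop
  exact (contDiffAt_radial (h j)).comp z h1

lemma fderiv_radialMap_apply {e : Fin n → ℝ} {z : Cn n} (h : ∀ j, z j ≠ 0 ∨ e j = 1) (v : Cn n)
    (j : Fin n) : fderiv ℝ (radialMap e) z v j = fderiv ℝ (radial (e j)) (z j) (v j) := by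
  have h1 := ((contDiffAt_radialMap h).differentiableAt one_ne_zero).hasFDerivAt
  have h2 := (PiLp.hasFDerivAt_apply (𝕜 := ℝ) 2 (E := fun _ : Fin n ↦ ℂ) (radialMap e z) j).comp z h1
  have h3 := (PiLp.hasFDerivAt_apply (𝕜 := ℝ) 2 (E := fun _ : Fin n ↦ ℂ) z j)
  have h4 := (((contDiffAt_radial (h j)).differentiableAt one_ne_zero).hasFDerivAt).comp z h3
  have h5 := h2.unique h4
  exact DFunLike.congr_fun h5 v

lemma norm_fderiv_radialMap {e : Fin n → ℝ} (he0 : ∀ j, 0 < e j) (he1 : ∀ j, e j ≤ 1) {c : ℝ}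
    (hc : ∀ j, c ≤ e j ^ 2) {z : Cn n} (h : ∀ j, z j ≠ 0 ∨ e j = 1) (v : Cn n) :
    c * ∑ j, ‖z j‖ ^ (2 * e j - 2) * ‖v j‖ ^ 2 ≤ ‖fderiv ℝ (radialMap e) z v‖ ^ 2 ∧
      ‖fderiv ℝ (radialMap e) z v‖ ^ 2 ≤ ∑ j, ‖z j‖ ^ (2 * e j - 2) * ‖v j‖ ^ 2 := by
  rw [EuclideanSpace.norm_sq_eq, Finset.mul_sum]
  constructor
  · refine Finset.sum_le_sum fun j _ ↦ ?_
    rw [fderiv_radialMap_apply h]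
    exact (mul_le_mul_of_nonneg_right (hc j) (by positivity)).trans
      (norm_fderiv_radial (he0 j) (he1 j) (h j) (v j)).1
  · refine Finset.sum_le_sum fun j _ ↦ ?_
    rw [fderiv_radialMap_apply h]
    exact (norm_fderiv_radial (he0 j) (he1 j) (h j) (v j)).2

lemma bijective_fderiv_radialMap {e : Fin n → ℝ} (he0 : ∀ j, 0 < e j) (he1 : ∀ j, e j ≤ 1)
    {z : Cn n} (h : ∀ j, z j ≠ 0 ∨ e j = 1) :
    Function.Surjective (fderiv ℝ (radialMap e) z) := by
  refine (LinearMap.injective_iff_surjective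
    (f := (fderiv ℝ (radialMap e) z : Cn n →ₗ[ℝ] Cn n))).1 ?_
  refine (injective_iff_map_eq_zero _).2 fun v hv ↦ ?_
  ext j
  have h1 : fderiv ℝ (radial (e j)) (z j) (v j) = 0 := by
    rw [← fderiv_radialMap_apply h]
    have : fderiv ℝ (radialMap e) z v = 0 := hv
    rw [this]
    rfl
  have h2 := (norm_fderiv_radial (he0 j) (he1 j) (h j) (v j)).1
  rw [h1, norm_zero, zero_pow two_ne_zero] at h2
  have h3 : 0 < e j ^ 2 * ‖z j‖ ^ (2 * e j - 2) := by
    refine mul_pos (by have := he0 j; positivity) ?_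
    rcases h j with h4 | h4
    · exact Real.rpow_pos_of_pos (norm_pos_iff.2 h4) _
    · simp [h4]
  rw [← mul_assoc] at h2
  have h4 : ‖v j‖ ^ 2 ≤ 0 := nonpos_of_mul_nonpos_right h2 h3
  have h5 : ‖v j‖ = 0 := by nlinarith [norm_nonneg (v j), sq_nonneg ‖v j‖, sq_eq_zero_iff.1 (le_antisymm h4 (sq_nonneg _))]
  exact norm_eq_zero.1 h5

end Radial

/-! ### Cone charts at points of the divisor -/

section ConicalChart

variable {n : ℕ} {X : Type*} [TopologicalSpace X] [ChartedSpace (Cn n) X]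
  [IsManifold 𝓘(ℂ, Cn n) ω X]

/-- The cone exponents of all the coordinates, `1` in the directions along the divisor. -/
def coneExponent (n k : ℕ) (b : Fin k → ℝ) (j : Fin n) : ℝ :=
  if h : (j : ℕ) < k then b ⟨j, h⟩ else 1

lemma modelConeMetric_eq_sum {k : ℕ} (b : Fin k → ℝ) (z v : Cn n) :
    modelConeMetric n k b z v =
      ∑ j, ‖z j‖ ^ (2 * coneExponent n k b j - 2) * ‖v j‖ ^ 2 := by
  refine Finset.sum_congr rfl fun j _ ↦ ?_
  by_cases h : (j : ℕ) < k <;> simp [coneExponent, h]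

lemma coneExponent_pos {k : ℕ} {b : Fin k → ℝ} (hb : ∀ i, 0 < b i) (j : Fin n) :
    0 < coneExponent n k b j := by
  unfold coneExponent
  split_ifs with h
  exacts [hb _, one_pos]

lemma coneExponent_le_one {k : ℕ} {b : Fin k → ℝ} (hb : ∀ i, b i ≤ 1) (j : Fin n) :
    coneExponent n k b j ≤ 1 := by
  unfold coneExponent
  split_ifs with h
  exacts [hb _, le_rfl]

variable {ι : Type*} {D : ι → Set X} {p : X} {ψ : OpenPartialHomeomorph X (Cn n)} {k : ℕ}
  {hk : k ≤ n} {σ : Fin k → ι}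

lemma IsAdaptedChart.mem_iUnion_iff (h : IsAdaptedChart D p ψ k hk σ) {x : X}
    (hx : x ∈ ψ.source) : x ∈ ⋃ i, D i ↔ ∃ j : Fin n, (j : ℕ) < k ∧ ψ x j = 0 := by
  rw [mem_iUnion]
  constructor
  · rintro ⟨i, hi⟩
    by_cases hr : i ∈ range σ
    · obtain ⟨j, rfl⟩ := hr
      exact ⟨Fin.castLE hk j, j.2, (h.mem_iff j x hx).1 hi⟩
    · exact ((disjoint_left.1 (h.disjoint i hr)) hi hx).elim
  · rintro ⟨j, hj, h0⟩
    exact ⟨σ ⟨j, hj⟩, (h.mem_iff ⟨j, hj⟩ x hx).2 h0⟩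

variable {g : BilinField n X}

/-- Cone coordinates `|z_j|^(b_j - 1) z_j` straighten the model cone metric. -/
lemma IsAdaptedChart.exists_isConeChart (h : IsAdaptedChart D p ψ k hk σ) {b : Fin k → ℝ}
    (hb : ∀ i, b i ∈ Ioo (0 : ℝ) 1) {C : ℝ} (hC : 1 < C)
    (hg : ∀ z ∈ ψ.target, ψ.symm z ∉ ⋃ i, D i → ∀ v : Cn n,
        C⁻¹ * modelConeMetric n k b z v ≤ pullbackMetric g ψ.symm z v v ∧
        pullbackMetric g ψ.symm z v v ≤ C * modelConeMetric n k b z v) :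
    ∃ L, 1 ≤ L ∧ ∃ Ψ : OpenPartialHomeomorph X (Cn n), IsConeChart g (⋃ i, D i) L Ψ ∧
      p ∈ Ψ.source := by
  set e := coneExponent n k b with he
  have he0 : ∀ j, 0 < e j := coneExponent_pos fun i ↦ (hb i).1
  have he1 : ∀ j, e j ≤ 1 := coneExponent_le_one fun i ↦ (hb i).2.le
  obtain ⟨c, hc0, hc⟩ : ∃ c : ℝ, 0 < c ∧ ∀ j, c ≤ e j ^ 2 := by
    rcases isEmpty_or_nonempty (Fin n) with hn | hn
    · exact ⟨1, one_pos, fun j ↦ hn.elim j⟩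
    · obtain ⟨j0, hj0⟩ := Finite.exists_min fun j ↦ e j ^ 2
      exact ⟨_, by have := he0 j0; positivity, hj0⟩
  set W := radialHomeomorph e he0 with hW
  set Ψ := ψ ≫ₕ W.toOpenPartialHomeomorph with hΨ
  have hΨs : Ψ.source = ψ.source := by simp [hΨ]
  have hΨt : ∀ w, w ∈ Ψ.target ↔ W.symm w ∈ ψ.target := fun w ↦ by simp [hΨ]
  have hsy : ∀ w, Ψ.symm w = ψ.symm (W.symm w) := fun w ↦ rfl
  have hgood : ∀ z ∈ ψ.target, ψ.symm z ∉ ⋃ i, D i → ∀ j, z j ≠ 0 ∨ e j = 1 := by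
    intro z hz hzD j
    by_cases hj : (j : ℕ) < k
    · left
      intro h0
      refine hzD ((h.mem_iUnion_iff (ψ.map_target hz)).2 ⟨j, hj, ?_⟩)
      rwa [ψ.right_inv hz]
    · right
      simp [he, coneExponent, hj]
  have hC0 : 0 < C := by linarith
  -- `C` bounds the flat metric by `g`; `C / c` bounds `g` by the flat metric, `c` being the loss in
  -- the radial directions.
  set L := max C (C / c) with hLdef
  have hL1 : 1 ≤ L := hC.le.trans (le_max_left _ _)
  have hLsq : L ≤ L ^ 2 := by nlinarith
  -- the essential computation
  have key : ∀ w ∈ Ψ.target, Ψ.symm w ∉ ⋃ i, D i → ∀ v,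
      ‖v‖ ^ 2 ≤ L ^ 2 * pullbackMetric g Ψ.symm w v v ∧
        pullbackMetric g Ψ.symm w v v ≤ L ^ 2 * ‖v‖ ^ 2 := by
    intro w hw hwD v
    set z := W.symm w with hz
    have hzt : z ∈ ψ.target := (hΨt w).1 hw
    have hzD : ψ.symm z ∉ ⋃ i, D i := hwD
    have hz0 := hgood z hzt hzD
    have hwz : w = radialMap e z := (W.apply_symm_apply w).symm
    -- Every vector `v` in cone coordinates comes from a holomorphic-coordinate vector `u`, on which
    -- the conical hypothesis is available.
    obtain ⟨u, hu⟩ := bijective_fderiv_radialMap he0 he1 hz0 v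
    have hWd : DifferentiableAt ℝ (radialMap e) z :=
      (contDiffAt_radialMap hz0).differentiableAt one_ne_zero
    have hQ : MDifferentiableAt 𝓘(ℝ, Cn n) 𝓘(ℝ, Cn n) Ψ.symm (radialMap e z) := by
      have h1 : MDifferentiableAt 𝓘(ℝ, Cn n) 𝓘(ℝ, Cn n) ψ.symm (W.symm w) :=
        ((contMDiffOn_real_symm_of_mem_maximalAtlas h.mem_atlas).contMDiffAt
          (ψ.open_target.mem_nhds hzt)).mdifferentiableAt one_ne_zero
      have h2 : DifferentiableAt ℝ (radialMap fun j ↦ (e j)⁻¹) w := by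
        refine (contDiffAt_radialMap fun j ↦ ?_).differentiableAt one_ne_zero
        rcases hz0 j with h3 | h3
        · left
          rw [hwz, radialMap_apply, Ne, radial_eq_zero (he0 j)]
          exact h3
        · right
          rw [h3, inv_one]
      rw [← hwz]
      exact MDifferentiableAt.comp (g := ψ.symm) (f := radialMap fun j ↦ (e j)⁻¹) w h1
        h2.mdifferentiableAt
    have heq : ψ.symm =ᶠ[𝓝 z] Ψ.symm ∘ radialMap e :=
      Eventually.of_forall fun y ↦ (congrArg ψ.symm (W.symm_apply_apply y)).symm
    have hcomp := pullbackMetric_comp (g := g) heq hQ hWd u u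
    rw [hu, ← hwz] at hcomp
    obtain ⟨hn1, hn2⟩ := norm_fderiv_radialMap he0 he1 hc hz0 u
    rw [hu, ← modelConeMetric_eq_sum] at hn1 hn2
    obtain ⟨hg1, hg2⟩ := hg z hzt hzD u
    rw [hcomp] at hg1 hg2
    set m := modelConeMetric n k b z u
    set G := pullbackMetric g Ψ.symm w v v
    have hCm : m ≤ C * G := by
      rwa [inv_mul_le_iff₀ hC0] at hg1
    have hm0 : 0 ≤ m := (sq_nonneg _).trans hn2
    have hG0 : 0 ≤ G := by
      by_contra hcon
      push Not at hcon
      nlinarith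
    constructor
    · calc ‖v‖ ^ 2 ≤ C * G := hn2.trans hCm
        _ ≤ L ^ 2 * G := mul_le_mul_of_nonneg_right ((le_max_left _ _).trans hLsq) hG0
    · calc G ≤ C * m := hg2
        _ = C / c * (c * m) := by field_simp
        _ ≤ C / c * ‖v‖ ^ 2 := mul_le_mul_of_nonneg_left hn1 (by positivity)
        _ ≤ L ^ 2 * ‖v‖ ^ 2 :=
          mul_le_mul_of_nonneg_right ((le_max_right _ _).trans hLsq) (sq_nonneg _)
  refine ⟨L, hL1, Ψ, ⟨?_, ?_, fun w hw hwD v ↦ (key w hw hwD v).1,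
    fun w hw hwD v ↦ (key w hw hwD v).2, {j | (j : ℕ) < k}, ?_⟩, by rw [hΨs]; exact h.mem_source⟩
  · intro x hx
    have hxs : x ∈ ψ.source := hΨs ▸ hx.1
    have h1 := (contMDiffOn_real_of_mem_maximalAtlas h.mem_atlas).contMDiffAt
          (ψ.open_source.mem_nhds hxs)
    have h2 : ContMDiffAt 𝓘(ℝ, Cn n) 𝓘(ℝ, Cn n) 1 (radialMap e) (ψ x) := by
      refine (contDiffAt_radialMap (hgood _ (ψ.map_source hxs) ?_)).contMDiffAt
      rw [ψ.left_inv hxs]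
      exact hx.2
    exact (h2.comp x h1).contMDiffWithinAt
  · intro w hw
    have hzt : W.symm w ∈ ψ.target := (hΨt w).1 hw.1
    have h1 := (contMDiffOn_real_symm_of_mem_maximalAtlas h.mem_atlas).contMDiffAt
          (ψ.open_target.mem_nhds hzt)
    have h2 : ContMDiffAt 𝓘(ℝ, Cn n) 𝓘(ℝ, Cn n) 1 (radialMap fun j ↦ (e j)⁻¹) w := by
      refine (contDiffAt_radialMap fun j ↦ ?_).contMDiffAt
      rcases hgood _ hzt hw.2 j with h3 | h3
      · left
        intro h0
        refine h3 ?_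
        change radial (e j)⁻¹ (w j) = 0
        rw [h0, radial_zero]
      · right
        rw [h3, inv_one]
    exact (ContMDiffAt.comp w h1 h2).contMDiffWithinAt
  · intro w hw
    have hzt : W.symm w ∈ ψ.target := (hΨt w).1 hw
    rw [hsy, h.mem_iUnion_iff (ψ.map_target hzt), ψ.right_inv hzt]
    refine exists_congr fun j ↦ and_congr Iff.rfl ?_
    change radial (e j)⁻¹ (w j) = 0 ↔ _
    exact radial_eq_zero (inv_pos.2 (he0 j))

end ConicalChart

/-! ### Charts away from the divisor and at infinity, and their uniform size -/

section Atlas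

variable {n : ℕ} {X : Type*} [TopologicalSpace X] [ChartedSpace (Cn n) X]

lemma abs_bilin_sub_le {A B : Cn n →L[ℝ] Cn n →L[ℝ] ℝ} {ε : ℝ} (h : ‖A - B‖ ≤ ε) (v : Cn n) :
    |A v v - B v v| ≤ ε * ‖v‖ ^ 2 := by
  have h1 := (A - B).le_opNorm₂ v v
  rw [Real.norm_eq_abs, mul_assoc, ← sq] at h1
  exact h1.trans (mul_le_mul_of_nonneg_right h (sq_nonneg _))

lemma exists_pos_le_of_pos_def {B : Cn n →L[ℝ] Cn n →L[ℝ] ℝ} (hB : ∀ v, v ≠ 0 → 0 < B v v) :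
    ∃ c, 0 < c ∧ ∀ v, c * ‖v‖ ^ 2 ≤ B v v := by
  have hcont : Continuous fun v ↦ B v v := by fun_prop
  rcases (Metric.sphere (0 : Cn n) 1).eq_empty_or_nonempty with he | hne
  · refine ⟨1, one_pos, fun v ↦ ?_⟩
    rcases eq_or_ne v 0 with rfl | hv
    · simp
    · exfalso
      have : (‖v‖⁻¹ : ℝ) • v ∈ Metric.sphere (0 : Cn n) 1 := by
        rw [mem_sphere_zero_iff_norm, norm_smul, norm_inv, norm_norm,
          inv_mul_cancel₀ (norm_ne_zero_iff.2 hv)]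
      rw [he] at this
      exact this
  · obtain ⟨u, hu, hmin⟩ := (isCompact_sphere (0 : Cn n) 1).exists_isMinOn hne hcont.continuousOn
    have hu0 : u ≠ 0 := by
      rintro rfl
      simp at hu
    refine ⟨B u u, hB u hu0, fun v ↦ ?_⟩
    rcases eq_or_ne v 0 with rfl | hv
    · simp
    · have hv0 : 0 < ‖v‖ := norm_pos_iff.2 hv
      have hm : (‖v‖⁻¹ : ℝ) • v ∈ Metric.sphere (0 : Cn n) 1 := by
        rw [mem_sphere_zero_iff_norm, norm_smul, norm_inv, norm_norm,
          inv_mul_cancel₀ hv0.ne']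
      have h1 : B u u ≤ B ((‖v‖⁻¹ : ℝ) • v) ((‖v‖⁻¹ : ℝ) • v) := hmin hm
      have h2 : B ((‖v‖⁻¹ : ℝ) • v) ((‖v‖⁻¹ : ℝ) • v) * ‖v‖ ^ 2 = B v v := by
        simp only [map_smul, _root_.smul_apply, smul_eq_mul]
        field_simp
      rw [← h2]
      exact mul_le_mul_of_nonneg_right h1 (sq_nonneg _)

variable {g : BilinField n X} {D : Set X}

/-- Away from `D`, a holomorphic chart is a cone chart near each point. -/
lemma IsKahlerMetricOn.exists_isConeChart [IsManifold 𝓘(ℂ, Cn n) ω X]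
    (hg : IsKahlerMetricOn g Dᶜ) (hD : IsClosed D) {p : X} (hp : p ∉ D) :
    ∃ L, 1 ≤ L ∧ ∃ Ψ : OpenPartialHomeomorph X (Cn n), IsConeChart g D L Ψ ∧ p ∈ Ψ.source := by
  set ψ := chartAt (Cn n) p with hψ
  have hps : p ∈ ψ.source := mem_chart_source _ p
  have hat : ψ ∈ IsManifold.maximalAtlas 𝓘(ℂ, Cn n) ω X :=
    IsManifold.chart_mem_maximalAtlas p
  set U := ψ.target ∩ ψ.symm ⁻¹' Dᶜ with hU
  have hUo : IsOpen U := IsConeChart.isOpen_good hD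
  have hpU : ψ p ∈ U := ⟨ψ.map_source hps, by
    rw [mem_preimage, ψ.left_inv hps]
    exact hp⟩
  set B := pullbackMetric g ψ.symm (ψ p) with hB
  obtain ⟨c, hc, hcB⟩ := exists_pos_le_of_pos_def (hg.pos ψ hat _ hpU)
  have hcont : Tendsto (pullbackMetric g ψ.symm) (𝓝 (ψ p)) (𝓝 B) :=
    (hg.smooth ψ hat).continuousOn.continuousAt (hUo.mem_nhds hpU)
  have hev : ∀ᶠ z in 𝓝 (ψ p), z ∈ U ∧ ‖pullbackMetric g ψ.symm z - B‖ < c / 2 := by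
    refine (hUo.eventually_mem hpU).and ?_
    have hlim : Tendsto (fun z ↦ ‖pullbackMetric g ψ.symm z - B‖) (𝓝 (ψ p)) (𝓝 0) := by
      refine (tendsto_iff_norm_sub_tendsto_zero (E := Cn n →L[ℝ] Cn n →L[ℝ] ℝ)).1 ?_
      exact hcont
    exact hlim.eventually_lt_const (half_pos hc)
  obtain ⟨N, hN, hNo, hpN⟩ := eventually_nhds_iff.1 hev
  -- Large enough for both the lower bound `c / 2` and the upper bound `‖B‖ + c / 2` of the metric
  -- near `p`.
  set L := 1 + 2 / c + ‖B‖ + c / 2 with hLdef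
  have hL1 : 1 ≤ L := by
    have : 0 ≤ 2 / c + ‖B‖ + c / 2 := by positivity
    linarith
  have hLsq : L ≤ L ^ 2 := by nlinarith
  have hbd : ∀ z ∈ N, ∀ v, c / 2 * ‖v‖ ^ 2 ≤ pullbackMetric g ψ.symm z v v ∧
      pullbackMetric g ψ.symm z v v ≤ (‖B‖ + c / 2) * ‖v‖ ^ 2 := by
    intro z hz v
    have h1 := abs_le.1 (abs_bilin_sub_le (hN z hz).2.le v)
    have h2 := hcB v
    have h3 : B v v ≤ ‖B‖ * ‖v‖ ^ 2 := by
      have := (le_abs_self _).trans (B.le_opNorm₂ v v)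
      rwa [mul_assoc, ← sq] at this
    constructor <;> linarith
  refine ⟨L, hL1, (ψ.symm.restrOpen N hNo).symm, ⟨?_, ?_, ?_, ?_, ∅, ?_⟩, ?_⟩
  · exact (contMDiffOn_real_of_mem_maximalAtlas hat).mono fun _ hx ↦ hx.1.1
  · exact (contMDiffOn_real_symm_of_mem_maximalAtlas hat).mono fun _ hx ↦ hx.1.1
  · intro w hw _ v
    have h1 := (hbd w hw.2 v).1
    have h2 : 0 ≤ pullbackMetric g ψ.symm w v v := le_trans (by positivity) h1
    calc ‖v‖ ^ 2 = 2 / c * (c / 2 * ‖v‖ ^ 2) := by field_simp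
      _ ≤ 2 / c * pullbackMetric g ψ.symm w v v := mul_le_mul_of_nonneg_left h1 (by positivity)
      _ ≤ L ^ 2 * pullbackMetric g ψ.symm w v v := by
        refine mul_le_mul_of_nonneg_right (le_trans ?_ hLsq) h2
        have : 0 ≤ ‖B‖ + c / 2 := by positivity
        linarith
  · intro w hw _ v
    refine (hbd w hw.2 v).2.trans (mul_le_mul_of_nonneg_right (le_trans ?_ hLsq) (sq_nonneg _))
    have : 0 ≤ 2 / c := by positivity
    linarith
  · intro w hw
    refine ⟨fun h ↦ ((hN w hw.2).1.2 h).elim, fun ⟨j, hj, _⟩ ↦ hj.elim⟩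
  · exact ⟨hps, hpN⟩

/-- A local diffeomorphism which is injective on an open set is a chart there. -/
lemma IsLocalDiffeomorphOn.exists_openPartialHomeomorph {Φ : Cn n → X} {N : Set (Cn n)}
    (hN : IsOpen N) (h : IsLocalDiffeomorphOn 𝓘(ℝ, Cn n) 𝓘(ℝ, Cn n) ∞ Φ N) (hinj : InjOn Φ N) :
    ∃ E : OpenPartialHomeomorph (Cn n) X, ⇑E = Φ ∧ E.source = N ∧
      ContMDiffOn 𝓘(ℝ, Cn n) 𝓘(ℝ, Cn n) 1 E E.source ∧
      ContMDiffOn 𝓘(ℝ, Cn n) 𝓘(ℝ, Cn n) 1 E.symm E.target := by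
  have hloc := h.isLocalHomeomorphOn
  have hc : ContinuousOn Φ N := hloc.continuousOn
  have ho : IsOpenMap (N.domRestrict Φ) := by
    rw [isOpenMap_iff_nhds_le]
    rintro ⟨z, hz⟩
    have h1 : map (N.domRestrict Φ) (𝓝 ⟨z, hz⟩) = map Φ (map (↑) (𝓝 (⟨z, hz⟩ : N))) := rfl
    rw [h1, map_nhds_subtype_coe_eq_nhds hz (hN.mem_nhds hz), hloc.map_nhds_eq hz]
    rfl
  let E := OpenPartialHomeomorph.ofContinuousOpenRestrict
    ((hinj.bijOn_image).toPartialEquiv Φ N (Φ '' N)) hc ho hN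
  have hE : ⇑E = Φ := rfl
  have hEs : E.source = N := rfl
  refine ⟨E, hE, hEs, ?_, ?_⟩
  · intro z hz
    exact ((h ⟨z, hz⟩).contMDiffAt.of_le (by norm_cast)).contMDiffWithinAt
  · intro x hx
    -- Near `x` the global inverse agrees with the smooth inverse of a local diffeomorphism, because
    -- `E.symm` is continuous.
    obtain ⟨Φ', hz, heq⟩ := h ⟨E.symm x, E.map_target hx⟩
    have hx' : x = Φ' (E.symm x) := by
      rw [← heq hz]
      exact (E.right_inv hx).symm
    have h1 : ContMDiffAt 𝓘(ℝ, Cn n) 𝓘(ℝ, Cn n) 1 Φ'.invFun x := by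
      have hxt : x ∈ Φ'.target := by
        rw [hx']
        exact Φ'.map_source' hz
      exact (Φ'.contMDiffOn_invFun.contMDiffAt (Φ'.open_target.mem_nhds hxt)).of_le
        (by norm_cast)
    refine (h1.congr_of_eventuallyEq ?_).contMDiffWithinAt
    filter_upwards [(E.continuousAt_symm hx).eventually_mem (Φ'.open_source.mem_nhds hz),
      E.open_target.mem_nhds hx] with y hy hyt
    have h2 : y = Φ' (E.symm y) := by
      rw [← heq hy]
      exact (E.right_inv hyt).symm
    conv_rhs => rw [h2]
    exact (Φ'.left_inv' hy).symm

/-- A finite group of unitary maps acting freely moves the points at infinity far away. -/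
lemma exists_pos_mul_norm_le_of_free {Γ : Subgroup (Cn n ≃ₗᵢ[ℂ] Cn n)} [Finite Γ]
    (hfree : ∀ γ ∈ Γ, γ ≠ 1 → ∀ z, z ≠ 0 → γ z ≠ z) :
    ∃ δ : ℝ, 0 < δ ∧ ∀ γ ∈ Γ, γ ≠ 1 → ∀ z, δ * ‖z‖ ≤ ‖γ z - z‖ := by
  have h : ∀ γ : Γ, ∀ᶠ δ in 𝓝[>] (0 : ℝ), (γ : Cn n ≃ₗᵢ[ℂ] Cn n) ≠ 1 →
      ∀ z, δ * ‖z‖ ≤ ‖(γ : Cn n ≃ₗᵢ[ℂ] Cn n) z - z‖ := by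
    rintro ⟨γ, hγ⟩
    by_cases h1 : γ = 1
    · exact Eventually.of_forall fun _ hcon ↦ (hcon h1).elim
    -- Freeness says that `γ - 1` is injective, hence bounded below in finite dimension; finiteness
    -- of `Γ` then allows a common `δ`.
    let f : Cn n →ₗ[ℂ] Cn n := (γ.toLinearEquiv : Cn n →ₗ[ℂ] Cn n) - LinearMap.id
    have hf : ∀ z, f z = γ z - z := fun _ ↦ rfl
    have hker : LinearMap.ker f = ⊥ := by
      refine LinearMap.ker_eq_bot'.2 fun z hz ↦ ?_
      by_contra h0
      exact hfree γ hγ h1 z h0 (sub_eq_zero.1 hz)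
    obtain ⟨K, hK, hanti⟩ := f.exists_antilipschitzWith hker
    have hK' : (0 : ℝ) < K := hK
    filter_upwards [Ioo_mem_nhdsGT (inv_pos.2 hK')] with δ hδ _ z
    have h2 := hanti.le_mul_dist z 0
    rw [map_zero, dist_zero_right, dist_zero_right, hf] at h2
    calc δ * ‖z‖ ≤ (K : ℝ)⁻¹ * ‖z‖ := mul_le_mul_of_nonneg_right hδ.2.le (norm_nonneg _)
      _ ≤ ‖γ z - z‖ := by rwa [inv_mul_le_iff₀ hK']
  obtain ⟨δ, hδ, hδ0⟩ := ((eventually_all.2 h).and self_mem_nhdsWithin).exists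
  exact ⟨δ, hδ0, fun γ hγ ↦ hδ ⟨γ, hγ⟩⟩

/-- Near infinity an ALE metric has charts of a uniform size. -/
lemma IsALE.exists_isConeChart (h : IsALE g) (hD : IsCompact D) :
    ∃ K : Set X, IsCompact K ∧ ∀ x ∉ K, ∃ Ψ : OpenPartialHomeomorph X (Cn n),
      IsConeChart g D 2 Ψ ∧ x ∈ Ψ.source ∧ Metric.ball (Ψ x) 1 ⊆ Ψ.target := by
  obtain ⟨K, Γ, R₀, Φ, -, hfin, hfree, hloc, -, hfib, hmap, ℓ, hℓ, hdecay⟩ := h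
  obtain ⟨δ, hδ, hδΓ⟩ := exists_pos_mul_norm_le_of_free hfree
  have hev1 : ∀ᶠ z in Bornology.cobounded (Cn n), ‖pullbackMetric g Φ z - flatMetric n‖ ≤ 1 / 2 := by
    have h1 := hdecay 0
    have h2 : Tendsto (fun z : Cn n ↦ ‖z‖ ^ (-ℓ - (0 : ℕ))) (Bornology.cobounded (Cn n)) (𝓝 0) := by
      simp only [Nat.cast_zero, sub_zero]
      exact (tendsto_rpow_neg_atTop hℓ).comp tendsto_norm_cobounded_atTop
    have h3 := (h1.trans_tendsto h2).norm
    rw [norm_zero] at h3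
    filter_upwards [h3.eventually_le_const (by norm_num : (0 : ℝ) < 1 / 2)] with z hz
    rwa [norm_iteratedFDeriv_zero] at hz
  have hev2 : ∀ᶠ z in Bornology.cobounded (Cn n), Φ z ∉ D := by
    have h1 : Dᶜ ∈ map Φ (Bornology.cobounded (Cn n)) := by
      rw [hmap]
      exact hD.compl_mem_cocompact
    exact h1
  obtain ⟨R₁, -, hR₁⟩ := (Metric.hasBasis_cobounded_compl_closedBall (0 : Cn n)).eventually_iff.1
    (hev1.and hev2)
  -- Beyond `2 / δ` a nontrivial element of `Γ` moves points by more than `2`, too far for two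
  -- points of one unit ball to be identified.
  set R := max (max R₀ R₁) (2 / δ) with hR
  have hbig : ∀ z : Cn n, R < ‖z‖ → R₀ < ‖z‖ ∧ 2 / δ < ‖z‖ ∧
      ‖pullbackMetric g Φ z - flatMetric n‖ ≤ 1 / 2 ∧ Φ z ∉ D := by
    intro z hz
    have h1 : max R₀ R₁ < ‖z‖ := (le_max_left _ _).trans_lt hz
    have h2 : R₁ < ‖z‖ := (le_max_right _ _).trans_lt h1
    refine ⟨(le_max_left _ _).trans_lt h1, (le_max_right _ _).trans_lt hz, hR₁ ?_⟩
    simpa using h2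
  -- The extra `1` keeps the whole unit ball around the centre in the region `R < ‖z‖`.
  have hA : {z : Cn n | R + 1 < ‖z‖} ∈ Bornology.cobounded (Cn n) := by
    refine (Metric.hasBasis_cobounded_compl_closedBall (0 : Cn n)).mem_iff.2 ⟨R + 1, trivial, ?_⟩
    intro z hz
    have : R + 1 < ‖z‖ := by simpa using hz
    exact this
  have hAX := image_mem_map (m := Φ) hA
  rw [hmap] at hAX
  obtain ⟨K', hK', hsub⟩ := mem_cocompact.1 hAX
  refine ⟨K', hK', fun x hx ↦ ?_⟩
  obtain ⟨z₀, hz₀, rfl⟩ := hsub hx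
  have hz₀' : R + 1 < ‖z₀‖ := hz₀
  have hball : ∀ z ∈ Metric.ball z₀ 1, R < ‖z‖ := by
    intro z hz
    have h1 := norm_sub_norm_le z₀ z
    rw [← dist_eq_norm, dist_comm] at h1
    have h2 := Metric.mem_ball.1 hz
    linarith
  have hinj : InjOn Φ (Metric.ball z₀ 1) := by
    intro z hz w hw hzw
    have hbz := hbig z (hball z hz)
    obtain ⟨γ, hγ, rfl⟩ := (hfib z w hbz.1 (hbig w (hball w hw)).1).1 hzw
    by_cases h1 : γ = 1
    · rw [h1]
      rfl
    · exfalso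
      have h2 := hδΓ γ hγ h1 z
      have h3 : 2 < δ * ‖z‖ := by
        have := hbz.2.1
        rwa [div_lt_iff₀' hδ] at this
      have h4 : dist (γ z) z < 2 := by
        have := dist_triangle_right (γ z) z z₀
        have h5 := Metric.mem_ball.1 hz
        have h6 := Metric.mem_ball.1 hw
        linarith
      rw [dist_eq_norm] at h4
      linarith
  have hloc' : IsLocalDiffeomorphOn 𝓘(ℝ, Cn n) 𝓘(ℝ, Cn n) ∞ Φ (Metric.ball z₀ 1) :=
    fun z ↦ hloc ⟨z, (hbig z (hball z z.2)).1⟩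
  obtain ⟨E, hE, hEs, hE1, hE2⟩ := hloc'.exists_openPartialHomeomorph Metric.isOpen_ball hinj
  have hflat : ∀ v, flatMetric n v v = ‖v‖ ^ 2 := fun v ↦ real_inner_self_eq_norm_sq v
  have hbd : ∀ z ∈ E.source, ∀ v, |pullbackMetric g E z v v - ‖v‖ ^ 2| ≤ 1 / 2 * ‖v‖ ^ 2 := by
    intro z hz v
    rw [hEs] at hz
    rw [← hflat v, hE, hflat v, ← hflat v]
    have := abs_bilin_sub_le (hbig z (hball z hz)).2.2.1 v
    rwa [← hflat v] at this
  have hz₀s : z₀ ∈ E.source := by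
    rw [hEs]
    exact Metric.mem_ball_self one_pos
  refine ⟨E.symm, ⟨hE2.mono inter_subset_left, hE1.mono inter_subset_left, ?_, ?_, ∅, ?_⟩, ?_, ?_⟩
  · intro w hw _ v
    have := abs_le.1 (hbd w hw v)
    change _ ≤ 2 ^ 2 * pullbackMetric g E w v v
    nlinarith [sq_nonneg ‖v‖]
  · intro w hw _ v
    have := abs_le.1 (hbd w hw v)
    change pullbackMetric g E w v v ≤ _
    nlinarith [sq_nonneg ‖v‖]
  · intro w hw
    have hw' : w ∈ E.source := hw
    rw [hEs] at hw'
    refine ⟨fun hwD ↦ ((hbig w (hball w hw')).2.2.2 ?_).elim, fun ⟨j, hj, _⟩ ↦ hj.elim⟩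
    have h1 : E w ∈ D := hwD
    rwa [hE] at h1
  · rw [← hE]
    exact E.map_source hz₀s
  · rw [← hE]
    change Metric.ball (E.symm (E z₀)) 1 ⊆ E.source
    rw [E.left_inv hz₀s, hEs]

/-- Having charts of uniform size passes to subsets and finite unions and holds near each point,
since a chart also serves neighbouring centres at half the radius. Compact induction covers `K`; the
end is already uniform. -/
lemma IsALE.hasUniformConeCharts (h : IsALE g) (hD : IsCompact D)
    (hlocal : ∀ p, ∃ L, 1 ≤ L ∧ ∃ Ψ : OpenPartialHomeomorph X (Cn n), IsConeChart g D L Ψ ∧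
      p ∈ Ψ.source) :
    ∃ L, 1 ≤ L ∧ ∃ ρ, 0 < ρ ∧ HasUniformConeCharts g D L ρ := by
  obtain ⟨K, hK, hend⟩ := h.exists_isConeChart hD
  let P : Set X → Prop := fun S ↦ ∃ L, 1 ≤ L ∧ ∃ ρ, 0 < ρ ∧ ∀ x ∈ S,
    ∃ Ψ : OpenPartialHomeomorph X (Cn n), IsConeChart g D L Ψ ∧ x ∈ Ψ.source ∧
      Metric.ball (Ψ x) ρ ⊆ Ψ.target
  have hmono : ∀ s t, s ⊆ t → P t → P s := by
    rintro s t hst ⟨L, hL, ρ, hρ, hP⟩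
    exact ⟨L, hL, ρ, hρ, fun x hx ↦ hP x (hst hx)⟩
  have hunion : ∀ s t, P s → P t → P (s ∪ t) := by
    rintro s t ⟨L, hL, ρ, hρ, hP⟩ ⟨L', hL', ρ', hρ', hP'⟩
    refine ⟨max L L', hL.trans (le_max_left _ _), min ρ ρ', lt_min hρ hρ', ?_⟩
    rintro x (hx | hx)
    · obtain ⟨Ψ, hΨ, hxs, hb⟩ := hP x hx
      exact ⟨Ψ, hΨ.mono (by linarith) (le_max_left _ _), hxs,
        (Metric.ball_subset_ball (min_le_left _ _)).trans hb⟩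
    · obtain ⟨Ψ, hΨ, hxs, hb⟩ := hP' x hx
      exact ⟨Ψ, hΨ.mono (by linarith) (le_max_right _ _), hxs,
        (Metric.ball_subset_ball (min_le_right _ _)).trans hb⟩
  have hPK : P K := by
    refine hK.induction_on ⟨1, le_rfl, 1, one_pos, fun x hx ↦ hx.elim⟩ (fun s t ↦ hmono s t)
      (fun s t ↦ hunion s t) fun p _ ↦ ?_
    obtain ⟨L, hL, Ψ, hΨ, hp⟩ := hlocal p
    obtain ⟨ρ, hρ, hb⟩ := Metric.isOpen_iff.1 Ψ.open_target _ (Ψ.map_source hp)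
    refine ⟨Ψ.source ∩ Ψ ⁻¹' Metric.ball (Ψ p) (ρ / 2), mem_nhdsWithin_of_mem_nhds
      ((Ψ.isOpen_inter_preimage Metric.isOpen_ball).mem_nhds
        ⟨hp, Metric.mem_ball_self (half_pos hρ)⟩), L, hL, ρ / 2, half_pos hρ, ?_⟩
    rintro x ⟨hxs, hx⟩
    refine ⟨Ψ, hΨ, hxs, (Metric.ball_subset_ball' ?_).trans hb⟩
    have := Metric.mem_ball.1 hx
    linarith
  obtain ⟨L, hL, ρ, hρ, hP⟩ := hunion K Kᶜ hPK ⟨2, one_le_two, 1, one_pos, hend⟩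
  exact ⟨L, hL, ρ, hρ, fun x ↦ hP x (by rw [union_compl_self]; trivial)⟩

end Atlas

theorem proposition3p3 {n : ℕ} {X : Type*} [TopologicalSpace X] [ChartedSpace (Cn n) X]
    [IsManifold 𝓘(ℂ, Cn n) ω X] [T2Space X] [SecondCountableTopology X]
    [ConnectedSpace X] [NoncompactSpace X] [MeasurableSpace X] [BorelSpace X]
    {ι : Type*} [Finite ι] (D : ι → Set X) (hD : IsCompactSNCDivisor n D)
    (β : ι → ℝ) (hβ : ∀ i, β i ∈ Ioo (0 : ℝ) 1)
    (g : BilinField n X) (hg : IsALEConicalKahlerMetric D β g) :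
    Continuous (fun p : X × X ↦ conicalDist g (⋃ i, D i) p.1 p.2) ∧
    LocalPoincare12 (conicalDist g (⋃ i, D i)) (conicalMeasure g (⋃ i, D i)) := by
  have hDc : IsClosed (⋃ i, D i) := hD.isCompact.isClosed
  obtain ⟨L, hL, ρ, hρ, hu⟩ := hg.ale.hasUniformConeCharts hD.isCompact fun p ↦ by
    by_cases hp : p ∈ ⋃ i, D i
    · obtain ⟨ψ, k, hk, σ, hψ, C, hC, hb⟩ := hg.conical p hp
      exact hψ.exists_isConeChart (fun i ↦ hβ (σ i)) hC hb
    · exact hg.kahler.exists_isConeChart hDc hp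
  exact ⟨hu.continuous_conicalDist hDc (one_pos.trans_le hL) hρ,
    hu.localPoincare12 hDc hL hρ hg.kahler⟩

end
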